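/- Let $\ell\ge 4$ be even, $h=2\ell-2$, $\kappa=\tfrac12$, $n=2\ell$, and let $e_{a,b}$ be the $n\times n$ matrix units. **The algebra.** Put $E_i=e_{i+1,i}+e_{2\ell+1-i,2\ell-i}$, $F_i=e_{i,i+1}+e_{2\ell-i,2\ell+1-i}$ for $1\le i\le \ell-1$, $E_\ell=\frac12(e_{\ell+1,\ell-1}+e_{\ell+2,\ell})$, $F_\ell=2(e_{\ell-1,\ell+1}+e_{\ell,\ell+2})$, $E_0=\frac12(e_{1,2\ell-1}+e_{2,2\ell})$. The $E_i,F_i$ with $1\le i\le\ell$ generate the simple Lie algebra $\mathring{\mathfrak g}$ of type $D_\ell$, with invariant form $(X|Y)_0=\kappa\operatorname{Tr}(XY)$; the affine algebra $D^{(1)}_\ell$ is the central extension of its loop algebra with $[Xz^j,Yz^k]=[X,Y]z^{j+k}+\delta_{j,-k}\,j\,(X|Y)_0\,c$ and $c$ central. Let $\Lambda=zE_0+\sum_{i=1}^{\ell}E_i$ and $$\Gamma=-\Big(e_{\ell,1}-\tfrac12e_{\ell+1,1}-\tfrac z2e_{\ell,2\ell}+\tfrac z4e_{\ell+1,2\ell}+e_{2\ell,\ell+1}-\tfrac12e_{2\ell,\ell}-\tfrac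 z2e_{1,\ell+1}+\tfrac z4e_{1,\ell}\Big).$$ The positive exponents form the set $E_{>0}$ consisting of the odd integers $j>0$ and of a second copy $hs+(\ell-1)'$ of each $hs+\ell-1$, $s\ge0$; set $\Lambda_j=\sqrt2\,\Lambda^j$ for $j$ odd and $\Lambda_{hs+(\ell-1)'}=\sqrt{2\ell-2}\,\Gamma^{2s+1}$. **The hierarchy.** Let $\mathbf t=(t_j)_{j\in E_{>0}}$, and let $\Theta=\exp\xi$, $\xi=\sum_{k\ge1}\xi_kz^{-k}$ with $\xi_k\in\mathring{\mathfrak g}\otimes\mathbb C[[\mathbf t]]$, be a formal solution of the Drinfeld--Sokolov hierarchy $$\frac{\partial\Theta}{\partial t_j}=(\Theta\Lambda_j\Theta^{-1})_{<0}\,\Theta\qquad(j\in E_{>0}),$$ where $(\cdot)_{<0}$ keeps the negative powers of $z$. Its tau function $\tau_\Theta$ is given by a formal series $\log\tau_\Theta\in\mathbb C[[\mathbf t]]$ such that $\partial_{t_j}\log\tau_\Theta$ is minus the coefficient of $c$ in $\Theta\Lambda_j\Theta^{-1}=\exp(\mathrm{ad}_\xi)\Lambda_j$, computed in the affine algebra,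 for every $j\in E_{>0}$. Let $w(\mathbf t;z)=\exp\big(\sum_{j\in E_{>0}}t_j\Lambda_j\big)\Theta^{-1}$ be the wave function. **Diagonalization.** With $\omega=e^{2\pi\mathbf i/(2\ell-2)}$ let $P(\zeta)=\frac1{2\ell-2}(\beta_1,\beta_\omega,\dots,\beta_{\omega^{2\ell-3}},\beta_0,\beta_{0'})$ have the columns $$\beta_{\omega^i}=\big(\tfrac12,(\omega^i\zeta)^{-1},\dots,(\omega^i\zeta)^{-(\ell-1)},\tfrac12(\omega^i\zeta)^{-(\ell-1)},(\omega^i\zeta)^{-\ell},\dots,(\omega^i\zeta)^{-(2\ell-2)}\big)^T,$$ $$\beta_0,\beta_{0'}=(\ell-1)\big(\tfrac12,0,\dots,0,\mp\zeta^{-(\ell-1)},\pm\tfrac12\zeta^{-(\ell-1)},0,\dots,0,-\zeta^{-(2\ell-2)}\big)^T$$ (upper signs for $\beta_0$; the two middle entries are in rows $\ell,\ell+1$). With $z=\zeta^h$ put $D_j=P(\zeta)^{-1}\Lambda_jP(\zeta)\zeta^{-j}$ ($j\in E_{>0}$, the scalar power being $\zeta^{-(\ell-1)}$ for $j=(\ell-1)'$),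 $\tilde D=D_1+D_3+\dots+D_{2\ell-3}$, $\Psi(\zeta)=P(\zeta)^{-1}w(\mathbf t;\zeta^h)$, $K_1(\zeta)=\Psi(\zeta)^{-1}\tilde D\,\Psi(\zeta)$ and $K_2(\zeta)=\Psi(\zeta)^{-1}D_{(\ell-1)'}\Psi(\zeta)$. **Generating functions.** Let $\nabla_1(\zeta)=\sum_{j>0\ \mathrm{odd}}\zeta^{-j}\partial_{t_j}$, $\nabla_2(\hat\zeta)=\sum_{s\ge0}\hat\zeta^{-(hs+\ell-1)}\partial_{t_{hs+(\ell-1)'}}$ and $$F_m(\zeta_1,\hat\zeta_1,\dots,\zeta_m,\hat\zeta_m)=\big(\nabla_1(\zeta_1)+\nabla_2(\hat\zeta_1)\big)\cdots\big(\nabla_1(\zeta_m)+\nabla_2(\hat\zeta_m)\big)\log\tau_\Theta .$$ For matrices depending on distinct parameters let $$M_1(x_1)\star\cdots\star M_m(x_m)=\frac{x_1^h\cdots x_m^h\;M_1(x_1)\cdots M_m(x_m)}{(x_2^h-x_1^h)\cdots(x_m^h-x_{m-1}^h)(x_1^h-x_m^h)},$$ and extend $\star$ multilinearly to sums such as $K_1(\zeta_i)+K_2(\hat\zeta_i)$.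 **Theorem.** One has $\tilde D=\operatorname{diag}(\sqrt2(\ell-1),0,\dots,0,-\sqrt2(\ell-1),0,\dots,0)$, the second nonzero entry being at position $\ell$, and the following identities of power series in $\mathbf t$ hold, with coefficients in the field of fractions of the ring of formal power series in the inverses of the parameters $\zeta_i,\hat\zeta_i$. (i) For $m=1$, $$F_1(\zeta,\hat\zeta)=\frac{\kappa}{h}\operatorname{Tr}\Big(\zeta\partial_\zeta\Psi(\zeta)\cdot\Psi(\zeta)^{-1}\tilde D+\hat\zeta\partial_{\hat\zeta}\Psi(\hat\zeta)\cdot\Psi(\hat\zeta)^{-1}D_{(\ell-1)'}\Big)-\sum_{j>0\ \mathrm{odd}}j\,t_j\zeta^j-\sum_{s\ge0}(hs+\ell-1)\,t_{hs+(\ell-1)'}\,\hat\zeta^{hs+\ell-1}.$$ (ii) For $m\ge2$, $$F_m=-\frac1m\sum_{\rho\in S_m}\kappa\operatorname{Tr}\Big(\big(K_1(\zeta_{\rho(1)})+K_2(\hat\zeta_{\rho(1)})\big)\star\cdots\star\big(K_1(\zeta_{\rho(m)})+K_2(\hat\zeta_{\rho(m)})\big)\Big)-\delta_{m,2}\left(\frac{\zeta_1\zeta_2(\zeta_1^2+\zeta_2^2)}{(\zeta_1^2-\zeta_2^2)^2}+\frac{(\ell-1)\hat\zeta_1^{\ell-1}\hat\zeta_2^{\ell-1}(\hat\zeta_1^h+\hat\zeta_2^h)}{(\hat\zeta_1^h-\hat\zeta_2^h)^2}\right).$$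 -/

import Mathlib

noncomputable section

namespace DrinfeldSokolovD

/-! ### Formal series -/

/-- Laurent series in the inverse `u = 1/z` of a loop parameter `z`: they contain finitely many
positive and arbitrarily many negative powers of `z`.  The coefficient of `z ^ k` in `a` is
`a.coeff (-k)`. -/
abbrev InvLaurent : Type := LaurentSeries ℂ

/-- The monomial `c z ^ k`. -/
def zmon (k : ℤ) (c : ℂ) : InvLaurent := HahnSeries.single (-k) c

/-- The Euler operator `z d/dz`, which multiplies the coefficient of `z ^ k` by `k`. -/
def eulerK (a : InvLaurent) : InvLaurent where
  coeff n := (-n : ℂ) * a.coeff n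
  isPWO_support' := a.isPWO_support.mono fun n hn => by
    simp only [Function.mem_support, HahnSeries.mem_support] at hn ⊢
    exact right_ne_zero_of_mul hn

/-- The part of a series that consists of the powers `z ^ k` with `k < 0`. -/
def negPartK (a : InvLaurent) : InvLaurent where
  coeff n := if 0 < n then a.coeff n else 0
  isPWO_support' := a.isPWO_support.mono fun n hn => by
    simp only [Function.mem_support, HahnSeries.mem_support] at hn ⊢
    exact fun h => hn (by simp [h])

/-- The substitution `a(z) ↦ a(ζ ^ h)`, for `h > 0` (the value for `h = 0` is irrelevant). -/
def substPow (h : ℕ) : InvLaurent →+* InvLaurent :=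
  if hh : 0 < h then
    HahnSeries.embDomainRingHom (AddMonoidHom.mulLeft (h : ℤ))
      (fun a b hab => by
        have : (h : ℤ) ≠ 0 := by exact_mod_cast hh.ne'
        exact mul_left_cancel₀ this hab)
      (fun a b => by
        have : (0 : ℤ) < h := by exact_mod_cast hh
        exact mul_le_mul_iff_right₀ this)
  else RingHom.id _

/-- The coefficientwise sum of a family of power series, in which every coefficient receives only
finitely many nonzero contributions. -/
def coeffSum {σ ι R : Type} [Semiring R] (s : ι → MvPowerSeries σ R) : MvPowerSeries σ R :=
  fun e => ∑ᶠ i, MvPowerSeries.coeff e (s i)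

/-- Apply a map to every coefficient of a power series. -/
def coeffwise {σ R S : Type} [Semiring R] (φ : R → S) (f : MvPowerSeries σ R) :
    MvPowerSeries σ S :=
  fun e => φ (MvPowerSeries.coeff e f)

/-! ### The affine algebra of type `D_ℓ^{(1)}`, `ℓ` even -/

/-- The Coxeter number `h = 2ℓ - 2`. -/
def cox (ℓ : ℕ) : ℕ := 2 * ℓ - 2

/-- The constant of the invariant form `(X | Y)₀ = κ Tr (X Y)`. -/
def kappa : ℂ := 1 / 2

/-- The positive exponents, with multiplicity, for even `ℓ`: `odd a` is the exponent `2a + 1`,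
and `prime s` is the second copy `h s + (ℓ - 1)'` of the exponent `h s + ℓ - 1`. -/
inductive PosExp : Type
  | odd (a : ℕ)
  | prime (s : ℕ)

/-- The numerical value of an exponent. -/
def PosExp.val (ℓ : ℕ) : PosExp → ℕ
  | .odd a => 2 * a + 1
  | .prime s => cox ℓ * s + (ℓ - 1)

/-- `2ℓ × 2ℓ` matrices. -/
abbrev Mat (ℓ : ℕ) (R : Type) : Type := Matrix (Fin (2 * ℓ)) (Fin (2 * ℓ)) R

/-- The matrix unit `e_{a,b}`, with indices counted from `1`. -/
def unit (ℓ a b : ℕ) : Mat ℓ ℂ :=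
  Matrix.of fun i j => if i.val + 1 = a ∧ j.val + 1 = b then 1 else 0

/-- The generators `E_1, …, E_ℓ` of the simple Lie algebra. -/
def genE (ℓ i : ℕ) : Mat ℓ ℂ :=
  if i = ℓ then (1 / 2 : ℂ) • (unit ℓ (ℓ + 1) (ℓ - 1) + unit ℓ (ℓ + 2) ℓ)
  else unit ℓ (i + 1) i + unit ℓ (2 * ℓ + 1 - i) (2 * ℓ - i)

/-- The generators `F_1, …, F_ℓ` of the simple Lie algebra. -/
def genF (ℓ i : ℕ) : Mat ℓ ℂ :=
  if i = ℓ then (2 : ℂ) • (unit ℓ (ℓ - 1) (ℓ + 1) + unit ℓ ℓ (ℓ + 2))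
  else unit ℓ i (i + 1) + unit ℓ (2 * ℓ - i) (2 * ℓ + 1 - i)

/-- The element `E_0`. -/
def genE0 (ℓ : ℕ) : Mat ℓ ℂ :=
  (1 / 2 : ℂ) • (unit ℓ 1 (2 * ℓ - 1) + unit ℓ 2 (2 * ℓ))

attribute [local instance] LieRing.ofAssociativeRing LieAlgebra.ofAssociativeAlgebra

/-- The simple Lie algebra of type `D_ℓ`, generated by `E_i, F_i` with `1 ≤ i ≤ ℓ`. -/
def simpleLie (ℓ : ℕ) : LieSubalgebra ℂ (Mat ℓ ℂ) :=
  LieSubalgebra.lieSpan ℂ (Mat ℓ ℂ)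
    (genE ℓ '' Set.Icc 1 ℓ ∪ genF ℓ '' Set.Icc 1 ℓ)

/-- `Λ = z E_0 + E_1 + ⋯ + E_ℓ`. -/
def Lam (ℓ : ℕ) : Mat ℓ InvLaurent :=
  (genE0 ℓ).map (zmon 1) + (∑ i ∈ Finset.Icc 1 ℓ, genE ℓ i).map (zmon 0)

/-- The matrix `Γ` (for even `ℓ`). -/
def Gam (ℓ : ℕ) : Mat ℓ InvLaurent :=
  -((unit ℓ ℓ 1 - (1 / 2 : ℂ) • unit ℓ (ℓ + 1) 1
        + unit ℓ (2 * ℓ) (ℓ + 1) - (1 / 2 : ℂ) • unit ℓ (2 * ℓ) ℓ).map (zmon 0)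
    + (-(1 / 2 : ℂ) • unit ℓ ℓ (2 * ℓ) + (1 / 4 : ℂ) • unit ℓ (ℓ + 1) (2 * ℓ)
        - (1 / 2 : ℂ) • unit ℓ 1 (ℓ + 1) + (1 / 4 : ℂ) • unit ℓ 1 ℓ).map (zmon 1))

/-- The generators `Λ_j` of the positive half of the principal Heisenberg subalgebra:
`Λ_k = √2 Λ ^ k` for odd `k`, and `Λ_{k(ℓ-1)'} = √(2ℓ-2) Γ ^ k` for odd `k`; here
`h s + (ℓ-1)' = (2s+1)(ℓ-1)'`. -/
def heis (ℓ : ℕ) : PosExp → Mat ℓ InvLaurent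
  | .odd a => ((Real.sqrt 2 : ℝ) : ℂ) • Lam ℓ ^ (2 * a + 1)
  | .prime s => ((Real.sqrt (2 * ℓ - 2) : ℝ) : ℂ) • Gam ℓ ^ (2 * s + 1)

/-! ### Loops depending on the times `t_j` -/

/-- Formal power series in the times `t_j`, `j` a positive exponent. -/
abbrev TSeries (R : Type) : Type := MvPowerSeries PosExp R

/-- Matrix loops depending on the times. -/
abbrev Loop (ℓ : ℕ) : Type := Mat ℓ (TSeries InvLaurent)

/-- Constant-in-time loops. -/
def constLoop {ℓ : ℕ} (M : Mat ℓ InvLaurent) : Loop ℓ := M.map MvPowerSeries.C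

/-- `z ∂_z` on loops. -/
def euler {ℓ : ℕ} (A : Loop ℓ) : Loop ℓ := A.map (coeffwise eulerK)

/-- The projection of loops to the negative powers of `z` (the part of negative degree for the
homogeneous gradation). -/
def negPart {ℓ : ℕ} (A : Loop ℓ) : Loop ℓ := A.map (coeffwise negPartK)

/-- Series in the nonpositive powers of `z` as loops. -/
def toLoop {ℓ : ℕ} (A : Mat ℓ (TSeries (PowerSeries ℂ))) : Loop ℓ :=
  A.map (MvPowerSeries.map (HahnSeries.ofPowerSeries ℤ ℂ))

/-- `ξ = ∑_{k ≥ 1} ξ_k z ^ (-k)`, where every `ξ_k` is a power series in the times with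
coefficients in the simple Lie algebra. -/
def IsNegative {ℓ : ℕ} (ξ : Mat ℓ (TSeries (PowerSeries ℂ))) : Prop :=
  ∀ T : PosExp →₀ ℕ,
    (Matrix.of fun i j => PowerSeries.coeff 0 (MvPowerSeries.coeff T (ξ i j))) = (0 : Mat ℓ ℂ) ∧
    ∀ k : ℕ, (Matrix.of fun i j => PowerSeries.coeff k (MvPowerSeries.coeff T (ξ i j))) ∈
      simpleLie ℓ

/-- The exponential `∑ ξ ^ n / n!` of a series in the negative powers of `z`; every coefficient is
a finite sum since `ξ ^ n` only contains powers `z ^ (-k)` with `k ≥ n`. -/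
def negExp {ℓ : ℕ} (ξ : Mat ℓ (TSeries (PowerSeries ℂ))) : Mat ℓ (TSeries (PowerSeries ℂ)) :=
  Matrix.of fun i j => fun T => PowerSeries.mk fun k =>
    ∑ᶠ n : ℕ, ((n.factorial : ℂ))⁻¹ *
      PowerSeries.coeff k (MvPowerSeries.coeff T ((ξ ^ n) i j))

/-- The group element `Θ = exp ξ`. -/
def Theta {ℓ : ℕ} (ξ : Mat ℓ (TSeries (PowerSeries ℂ))) : Loop ℓ := toLoop (negExp ξ)

/-- `Θ = exp ξ` solves the hierarchy `∂Θ/∂t_j = (Θ Λ_j Θ⁻¹)_{<0} Θ`, for all positive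
exponents `j`. -/
def IsSolution (ℓ : ℕ) (ξ : Mat ℓ (TSeries (PowerSeries ℂ))) : Prop :=
  ∀ j : PosExp,
    (Theta ξ).map (MvPowerSeries.pderiv InvLaurent j) =
      negPart (Theta ξ * constLoop (heis ℓ j) * (Theta ξ)⁻¹) * Theta ξ

/-- Elements `A + x c` of the centrally extended loop algebra, with coefficients depending on the
times. -/
abbrev Affine (ℓ : ℕ) : Type := Loop ℓ × TSeries ℂ

/-- The bracket `[X z^j + x c, Y z^k + y c] = [X, Y] z^(j+k) + δ_{j,-k} j (X | Y)₀ c`, extended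
bilinearly: the central term is the coefficient of `z ^ 0` in `κ Tr (z ∂_z A · B)`. -/
def affBracket {ℓ : ℕ} (A B : Affine ℓ) : Affine ℓ :=
  (A.1 * B.1 - B.1 * A.1,
    coeffwise (fun a : InvLaurent => kappa * a.coeff 0) (Matrix.trace (euler A.1 * B.1)))

/-- The coefficient of `c` in `Θ Λ_j Θ⁻¹ = exp (ad ξ) Λ_j = ∑ (ad ξ)^n Λ_j / n!`, computed in the
centrally extended loop algebra (a finite sum, since `ad ξ` lowers the degree in `z`). -/
def centralCoeff (ℓ : ℕ) (ξ : Mat ℓ (TSeries (PowerSeries ℂ))) (j : PosExp) : TSeries ℂ :=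
  ∑ᶠ n : ℕ, ((n.factorial : ℂ))⁻¹ •
    ((affBracket (toLoop ξ, 0))^[n] (constLoop (heis ℓ j), 0)).2

/-- `logτ` is the logarithm of a tau function of the solution `Θ = exp ξ`:
`∂ log τ / ∂t_j = -(Θ Λ_j Θ⁻¹)_c`, for all positive exponents `j`. -/
def IsLogTau (ℓ : ℕ) (ξ : Mat ℓ (TSeries (PowerSeries ℂ))) (logτ : TSeries ℂ) : Prop :=
  ∀ j : PosExp, MvPowerSeries.pderiv ℂ j logτ = -centralCoeff ℓ ξ j

/-- `g(t; z) = exp (∑_j t_j Λ_j)`; the exponential is computed coefficientwise in the times. -/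
def gmat (ℓ : ℕ) : Loop ℓ :=
  let H : Loop ℓ := Matrix.of fun i k =>
    coeffSum fun j : PosExp => MvPowerSeries.monomial (Finsupp.single j 1) (heis ℓ j i k)
  Matrix.of fun i k => coeffSum fun n : ℕ => ((n.factorial : ℂ))⁻¹ • (H ^ n) i k

/-- The wave function `w = g Θ⁻¹`. -/
def wave (ℓ : ℕ) (ξ : Mat ℓ (TSeries (PowerSeries ℂ))) : Loop ℓ := gmat ℓ * (Theta ξ)⁻¹

/-! ### The matrices `P`, `D_j`, `Ψ`, `K_1`, `K_2` (series in `1/ζ`, where `z = ζ ^ h`) -/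

/-- The primitive root of unity `ω = exp (2πi / (2ℓ - 2))`. -/
def omega (ℓ : ℕ) : ℂ := Complex.exp (2 * Real.pi * Complex.I / (2 * ℓ - 2))

/-- The entry in row `r` (counted from `1`) of the column vector `β_x`, as a function of the
constant `x = ω ^ i`. -/
def betaEntry (ℓ : ℕ) (x : ℂ) (r : ℕ) : InvLaurent :=
  if r = 1 then zmon 0 (1 / 2)
  else if r ≤ ℓ then zmon (-((r - 1 : ℕ) : ℤ)) (x ^ (r - 1))⁻¹
  else if r = ℓ + 1 then zmon (-((ℓ - 1 : ℕ) : ℤ)) ((1 / 2) * (x ^ (ℓ - 1))⁻¹)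
  else zmon (-((r - 2 : ℕ) : ℤ)) (x ^ (r - 2))⁻¹

/-- The entry in row `r` (counted from `1`) of `β_0` (for `s = 1`) and of `β_{0'}` (for
`s = -1`); `ℓ` is even. -/
def betaZeroEntry (ℓ : ℕ) (s : ℂ) (r : ℕ) : InvLaurent :=
  if r = 1 then zmon 0 ((ℓ - 1) * (1 / 2))
  else if r = ℓ then zmon (-((ℓ - 1 : ℕ) : ℤ)) ((ℓ - 1) * (-s))
  else if r = ℓ + 1 then zmon (-((ℓ - 1 : ℕ) : ℤ)) ((ℓ - 1) * (s / 2))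
  else if r = 2 * ℓ then zmon (-((2 * ℓ - 2 : ℕ) : ℤ)) (-(ℓ - 1))
  else 0

/-- `P(ζ) = (2ℓ-2)⁻¹ (β_1, β_ω, …, β_{ω^(2ℓ-3)}, β_0, β_{0'})`. -/
def Pmat (ℓ : ℕ) : Mat ℓ InvLaurent :=
  Matrix.of fun r c => ((2 * ℓ - 2 : ℂ))⁻¹ •
    (if c.val < 2 * ℓ - 2 then betaEntry ℓ (omega ℓ ^ c.val) (r.val + 1)
      else if c.val = 2 * ℓ - 2 then betaZeroEntry ℓ 1 (r.val + 1)
      else betaZeroEntry ℓ (-1) (r.val + 1))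

/-- `D_j = P(ζ)⁻¹ Λ_j(ζ ^ h) P(ζ) ζ ^ (-j)`. -/
def Dmat (ℓ : ℕ) (j : PosExp) : Mat ℓ InvLaurent :=
  zmon (-(j.val ℓ : ℤ)) 1 • ((Pmat ℓ)⁻¹ * (heis ℓ j).map (substPow (cox ℓ)) * Pmat ℓ)

/-- `D̃ = D_1 + D_3 + ⋯ + D_{2ℓ-3}`. -/
def Dtilde (ℓ : ℕ) : Mat ℓ InvLaurent := ∑ a ∈ Finset.range (ℓ - 1), Dmat ℓ (.odd a)

/-- `D_{(ℓ-1)'}`. -/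
def Dprime (ℓ : ℕ) : Mat ℓ InvLaurent := Dmat ℓ (.prime 0)

/-- `Ψ(ζ) = P(ζ)⁻¹ w(ζ ^ h)`. -/
def Psi (ℓ : ℕ) (ξ : Mat ℓ (TSeries (PowerSeries ℂ))) : Loop ℓ :=
  constLoop (Pmat ℓ)⁻¹ * (wave ℓ ξ).map (MvPowerSeries.map (substPow (cox ℓ)))

/-- `K_1 = Ψ⁻¹ D̃ Ψ` (value at `false`) and `K_2 = Ψ⁻¹ D_{(ℓ-1)'} Ψ` (value at `true`). -/
def Kmat (ℓ : ℕ) (ξ : Mat ℓ (TSeries (PowerSeries ℂ))) (b : Bool) : Loop ℓ :=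
  (Psi ℓ ξ)⁻¹ * constLoop (if b then Dprime ℓ else Dtilde ℓ) * Psi ℓ ξ

/-! ### Several spectral parameters -/

/-- The spectral parameters: `(i, false)` stands for `ζ_i` and `(i, true)` for `ζ̂_i`. -/
abbrev Param : Type := ℕ × Bool

/-- Power series in the inverses of the spectral parameters; the variable `X p` is `1 / p`. -/
abbrev ParamSeries : Type := MvPowerSeries Param ℂ

instance : IsDomain ParamSeries := NoZeroDivisors.to_isDomain _

/-- The field of fractions of the power series in the inverses of the spectral parameters.  It
contains the formal series in one parameter and the rational functions of the parameters. -/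
abbrev ParamField : Type := FractionRing ParamSeries

/-- The spectral parameter `p` itself. -/
def par (p : Param) : ParamField := (algebraMap ParamSeries ParamField (MvPowerSeries.X p))⁻¹

/-- Evaluation of a power series in one variable at `1 / p`. -/
def powerAt (p : Param) : PowerSeries ℂ →+* ParamField :=
  (algebraMap ParamSeries ParamField).comp
    (MvPowerSeries.rename (R := ℂ) (Function.Embedding.punit (β := Param) p)).toRingHom

theorem powerAt_injective (p : Param) : Function.Injective (powerAt p) := by
  intro a b hab
  have h1 := IsFractionRing.injective ParamSeries ParamField hab
  exact MvPowerSeries.rename_injective (R := ℂ) (Function.Embedding.punit (β := Param) p) h1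

/-- The substitution of the spectral parameter `p` for the loop parameter `ζ`. -/
def laurentAt (p : Param) : InvLaurent →+* ParamField :=
  IsFractionRing.lift (powerAt_injective p)

/-- The substitution of `p` for `ζ` in series depending on the times. -/
def seriesAt (p : Param) : TSeries InvLaurent →+* TSeries ParamField :=
  MvPowerSeries.map (laurentAt p)

/-- `∇_1(ζ_i) = ∑_{j odd} ζ_i ^ (-j) ∂/∂t_j`. -/
def nabla1 (i : ℕ) (f : TSeries ParamSeries) : TSeries ParamSeries :=
  fun T => coeffSum fun a : ℕ =>
    MvPowerSeries.X (i, false) ^ (2 * a + 1) *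
      MvPowerSeries.coeff T (MvPowerSeries.pderiv ParamSeries (.odd a) f)

/-- `∇_2(ζ̂_i) = ∑_{s ≥ 0} ζ̂_i ^ (-(h s + ℓ - 1)) ∂/∂t_{h s + (ℓ-1)'}`. -/
def nabla2 (ℓ i : ℕ) (f : TSeries ParamSeries) : TSeries ParamSeries :=
  fun T => coeffSum fun s : ℕ =>
    MvPowerSeries.X (i, true) ^ (cox ℓ * s + (ℓ - 1)) *
      MvPowerSeries.coeff T (MvPowerSeries.pderiv ParamSeries (.prime s) f)

/-- The generating series
`F_m = (∇_1(ζ_0) + ∇_2(ζ̂_0)) ⋯ (∇_1(ζ_{m-1}) + ∇_2(ζ̂_{m-1})) log τ`. -/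
def genSeries (ℓ m : ℕ) (logτ : TSeries ℂ) : TSeries ParamSeries :=
  (List.range m).foldr (fun i f => nabla1 i f + nabla2 ℓ i f)
    (MvPowerSeries.map MvPowerSeries.C logτ)

/-- `F_m`, with coefficients in the field of fractions. -/
def mPointSeries (ℓ m : ℕ) (logτ : TSeries ℂ) : TSeries ParamField :=
  MvPowerSeries.map (algebraMap ParamSeries ParamField) (genSeries ℓ m logτ)

/-- The star product `M_0(p_0) ⋆ ⋯ ⋆ M_{m-1}(p_{m-1})` of matrices depending on the distinct
parameters `p_0, …, p_{m-1}`. -/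
def starProd (ℓ : ℕ) {m : ℕ} (p : Fin m → Param) (M : Fin m → Mat ℓ (TSeries ParamField)) :
    Mat ℓ (TSeries ParamField) :=
  ((∏ i, par (p i) ^ cox ℓ) /
      ∏ i, (par (p (finRotate m i)) ^ cox ℓ - par (p i) ^ cox ℓ)) • (List.ofFn M).prod

/-- The star product
`(K_1(ζ_{ρ(0)}) + K_2(ζ̂_{ρ(0)})) ⋆ ⋯ ⋆ (K_1(ζ_{ρ(m-1)}) + K_2(ζ̂_{ρ(m-1)}))`, expanded
multilinearly into star products of monomials. -/
def starK (ℓ : ℕ) (ξ : Mat ℓ (TSeries (PowerSeries ℂ))) {m : ℕ} (ρ : Equiv.Perm (Fin m)) :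
    Mat ℓ (TSeries ParamField) :=
  ∑ ε : Fin m → Bool,
    starProd ℓ (fun k => ((ρ k : ℕ), ε k))
      (fun k => (Kmat ℓ ξ (ε k)).map (seriesAt ((ρ k : ℕ), ε k)))

/-- The rational correction for `m = 2`. -/
def correction (ℓ : ℕ) : ParamField :=
  let ζ₁ := par (0, false)
  let ζ₂ := par (1, false)
  let η₁ := par (0, true)
  let η₂ := par (1, true)
  ζ₁ * ζ₂ * (ζ₁ ^ 2 + ζ₂ ^ 2) / (ζ₁ ^ 2 - ζ₂ ^ 2) ^ 2 +
    ((ℓ : ParamField) - 1) * η₁ ^ (ℓ - 1) * η₂ ^ (ℓ - 1) * (η₁ ^ cox ℓ + η₂ ^ cox ℓ) /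
      (η₁ ^ cox ℓ - η₂ ^ cox ℓ) ^ 2

end DrinfeldSokolovD

end

noncomputable section

namespace DrinfeldSokolovD

/-! ### Monomials -/

/-! Write R_j = Θ Λ_j Θ⁻¹. Summing exp(ad ξ) Λ_j in the affine algebra turns its central term into κ
times the z⁰ coefficient of Tr(Θ⁻¹ z∂_zΘ Λ_j) (`centralCoeff_eq`). All derivatives of log τ then
follow from two consequences of the hierarchy: ∂_j R_k = [(R_j)_{<0}, R_k] (`map_pderiv_dressed`)
and ∂_j Tr(Θ⁻¹ z∂_zΘ Λ_k) = Tr(z∂_z(R_j)_{<0} R_k) (`pderiv_logd`).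

The columns of P are common eigenvectors of Λ and Γ at z = ζ^h. Hence Λ^{h+1} = zΛ, Γ³ = zΓ, ΛΓ = ΓΛ
= 0, the Λ_j commute, and their traces are sums over roots of unity. Raising an exponent by h within
its kind multiplies Λ_j by z (`heis_shift`). Since exp(∑ t_j Λ_j) commutes with every Λ_j, K(q) is
the finite sum of q^{-j} R_j(q^h) over the exponents j < h of its kind (`Kmat_eq`). The operator ∇_q
splits over the same residues, and the sum over periods is geometric. Its closed forms `tele_eq` and
`teleE_eq` give ∇_q K(p) = q^h/(p^h - q^h) [K(q), K(p)] + [E(q), K(p)] with E(q) independent of p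
(`matHasNabla_Kpar`), and the formula for ∇_p ∇_q log τ (`incl_nab_nab_logTau`). The rational
correction in the latter comes from the constants Tr(Λ_i Λ_j) and Tr(z∂_zΛ_i Λ_j).

For m ≥ 3, apply one more ∇_q to the trace of a cyclic product of K's with weight s(p,p') =
p^h/(p'^h - p^h) on each edge. By s(p,p')(s(q,p') - s(q,p)) = s(p,q) s(q,p') (`sfac_mul_sfac`), the
commutator terms meeting at an edge combine into the insertion of K(q) into that edge, while E(q)
drops out of the trace. So ∇_q turns a sum over cyclic orders into the sum over cyclic orders with q
inserted (`incl_nabs_logTau`). The sum over S_m counts each cyclic order m times, which explains the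
factor 1/m (`sum_permutations'_cons`). As ∇ acts only on series in the inverse parameters,
identities with denominators are stated through `HasNabla`.

For m = 1 the logarithmic derivative of Ψ = P⁻¹ g Θ⁻¹, with g = exp(∑ t_j Λ_j), splits into three
terms. The P term vanishes because the rows of P are homogeneous in ζ and Λ_j has zero diagonal, j
being odd. The Θ term is the derivative of log τ. The g term is linear in the times (`sum_logdG`).
-/

theorem zmon_mul_zmon (k l : ℤ) (a b : ℂ) : zmon k a * zmon l b = zmon (k + l) (a * b) := by
  simp only [zmon, HahnSeries.single_mul_single, neg_add]

theorem zmon_zero_one : zmon 0 1 = 1 := by simp [zmon]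

theorem zmon_pow (k : ℤ) (a : ℂ) (n : ℕ) : zmon k a ^ n = zmon (n * k) (a ^ n) := by
  simp only [zmon, HahnSeries.single_pow]; congr 1; simp

theorem zmon_zero (k : ℤ) : zmon k 0 = 0 := by simp [zmon]

theorem zmon_neg (k : ℤ) (a : ℂ) : zmon k (-a) = -zmon k a := by simp [zmon]

theorem zmon_add (k : ℤ) (a b : ℂ) : zmon k (a + b) = zmon k a + zmon k b := by simp [zmon]

theorem zmon_eq_mul (k : ℤ) (a : ℂ) : zmon k a = zmon 0 a * zmon k 1 := by
  rw [zmon_mul_zmon, zero_add, mul_one]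

theorem smul_eq_zmon_mul (c : ℂ) (a : InvLaurent) : c • a = zmon 0 c * a := by
  rw [zmon, neg_zero, ← HahnSeries.C_apply, HahnSeries.C_mul_eq_smul]

theorem coeff_zmon (k n : ℤ) (a : ℂ) : (zmon k a).coeff n = if n = -k then a else 0 := by
  rw [zmon, HahnSeries.coeff_single]
  congr

theorem coeff_zmon_mul (k n : ℤ) (c : ℂ) (a : InvLaurent) :
    (zmon k c * a).coeff n = c * a.coeff (n + k) := by
  have h := HahnSeries.coeff_single_mul_add (r := c) (x := a) (a := n + k) (b := -k)
  rw [zmon, ← h]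
  congr 1
  ring

theorem zmon_ne_zero {k : ℤ} {a : ℂ} (ha : a ≠ 0) : zmon k a ≠ 0 := by
  simpa [zmon] using ha

theorem zmon_injective (k : ℤ) : Function.Injective (zmon k) := fun a b h => by
  exact HahnSeries.single_injective _ h

/-! ### The substitution z = ζ^h -/

theorem cox_pos {ℓ : ℕ} (hℓ : 4 ≤ ℓ) : 0 < cox ℓ := by simp only [cox]; omega

theorem substPow_coeff_mul {h : ℕ} (hh : 0 < h) (a : InvLaurent) (n : ℤ) :
    (substPow h a).coeff (h * n) = a.coeff n := by
  rw [substPow, dif_pos hh]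
  exact HahnSeries.embDomain_coeff (a := n)
    (f := ⟨⟨fun k => (h : ℤ) * k, _⟩, _⟩)

theorem substPow_coeff_of_not_dvd {h : ℕ} (hh : 0 < h) (a : InvLaurent) {n : ℤ}
    (hn : ¬ (h : ℤ) ∣ n) : (substPow h a).coeff n = 0 := by
  rw [substPow, dif_pos hh]
  refine HahnSeries.embDomain_of_notMem_range ?_
  rintro ⟨k, hk⟩
  exact hn ⟨k, hk.symm⟩

theorem substPow_injective {h : ℕ} (hh : 0 < h) : Function.Injective (substPow h) := by
  intro a b hab
  ext n
  rw [← substPow_coeff_mul hh a, hab, substPow_coeff_mul hh]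

theorem substPow_zmon {h : ℕ} (hh : 0 < h) (k : ℤ) (c : ℂ) :
    substPow h (zmon k c) = zmon (h * k) c := by
  ext n
  have h0 : (h : ℤ) ≠ 0 := by exact_mod_cast hh.ne'
  by_cases hn : (h : ℤ) ∣ n
  · obtain ⟨m, rfl⟩ := hn
    rw [substPow_coeff_mul hh, coeff_zmon, coeff_zmon, ← mul_neg]
    simp only [mul_right_inj' h0]
  · rw [substPow_coeff_of_not_dvd hh _ hn, coeff_zmon, if_neg]
    rintro rfl
    exact hn (by simp)

/-! ### The action of `Λ` and `Γ` on vectors -/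

theorem zmon_sum {ι : Type*} (k : ℤ) (s : Finset ι) (f : ι → ℂ) :
    zmon k (∑ i ∈ s, f i) = ∑ i ∈ s, zmon k (f i) :=
  map_sum (HahnSeries.single.addMonoidHom (-k)) f s

theorem sum_unit_mul {ℓ : ℕ} (a b : ℕ) (v : ℕ → InvLaurent) (i : Fin (2 * ℓ)) :
    ∑ j, zmon 0 (unit ℓ a b i j) * v (j.val + 1) =
      if i.val + 1 = a ∧ 1 ≤ b ∧ b ≤ 2 * ℓ then v b else 0 := by
  by_cases hb : 1 ≤ b ∧ b ≤ 2 * ℓ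
  · rw [Finset.sum_eq_single ⟨b - 1, by omega⟩]
    · have : b - 1 + 1 = b := by omega
      simp only [unit, Matrix.of_apply, this, hb, and_true]
      split_ifs <;> simp [zmon_zero_one, zmon_zero]
    · intro j _ hj
      rw [unit, Matrix.of_apply, if_neg, zmon_zero, zero_mul]
      rintro ⟨_, h⟩
      exact hj (Fin.ext (by simp; omega))
    · simp
  · rw [Finset.sum_eq_zero, if_neg (by tauto)]
    intro j _
    rw [unit, Matrix.of_apply, if_neg, zmon_zero, zero_mul]
    rintro ⟨_, h⟩
    have := j.isLt
    omega

theorem sum_genE0_mul {ℓ : ℕ} (hℓ : 4 ≤ ℓ) (v : ℕ → InvLaurent) (i : Fin (2 * ℓ)) :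
    ∑ j, zmon 0 (genE0 ℓ i j) * v (j.val + 1) =
      zmon 0 (1 / 2) * ((if i.val = 0 then v (2 * ℓ - 1) else 0) +
        (if i.val = 1 then v (2 * ℓ) else 0)) := by
  have h : ∀ j, zmon 0 (genE0 ℓ i j) * v (j.val + 1) = zmon 0 (1 / 2) *
      (zmon 0 (unit ℓ 1 (2 * ℓ - 1) i j) * v (j.val + 1) +
        zmon 0 (unit ℓ 2 (2 * ℓ) i j) * v (j.val + 1)) := by
    intro j
    rw [genE0, Matrix.smul_apply, Matrix.add_apply, smul_eq_mul, ← add_mul, ← zmon_add, ← mul_assoc,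
      zmon_mul_zmon, add_zero]
  rw [Finset.sum_congr rfl fun j _ => h j, ← Finset.mul_sum, Finset.sum_add_distrib,
    sum_unit_mul, sum_unit_mul]
  congr 2
  · congr 1; simp; omega
  · congr 1; simp; omega

theorem sum_ite_Icc {M : Type*} [AddCommMonoid M] (n t : ℕ) (g : ℕ → M) :
    (∑ k ∈ Finset.Icc 1 n, if k = t then g k else 0) = if 1 ≤ t ∧ t ≤ n then g t else 0 := by
  rw [Finset.sum_ite_eq']
  simp only [Finset.mem_Icc]

theorem sum_genE_mul {ℓ : ℕ} (hℓ : 4 ≤ ℓ) (v : ℕ → InvLaurent) (i : Fin (2 * ℓ)) :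
    ∑ j, zmon 0 ((∑ k ∈ Finset.Icc 1 ℓ, genE ℓ k) i j) * v (j.val + 1) =
      if i.val = 0 then 0
      else if i.val = ℓ then zmon 0 (1 / 2) * v (ℓ - 1)
      else if i.val = ℓ + 1 then zmon 0 (1 / 2) * v ℓ + v (ℓ + 1)
      else v i.val := by
  have hi := i.isLt
  obtain ⟨m, rfl⟩ : ∃ m, ℓ = m + 1 := ⟨ℓ - 1, by omega⟩
  have h0 : ∀ j, zmon 0 ((∑ k ∈ Finset.Icc 1 (m + 1), genE (m + 1) k) i j) * v (j.val + 1) =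
      ∑ k ∈ Finset.Icc 1 (m + 1), zmon 0 (genE (m + 1) k i j) * v (j.val + 1) := by
    intro j
    rw [Matrix.sum_apply, zmon_sum, Finset.sum_mul]
  rw [Finset.sum_congr rfl fun j _ => h0 j, Finset.sum_comm, Finset.sum_Icc_succ_top (by omega)]
  -- In row i, counted from 0, E_k with k < ℓ acts only if k = i or k = 2ℓ - i. In both cases it
  -- picks out the entry number i of the vector, counted from 1.
  have h1 : ∀ k ∈ Finset.Icc 1 m, ∑ j, zmon 0 (genE (m + 1) k i j) * v (j.val + 1) =
      (if k = i.val then v k else 0) +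
        (if k = 2 * (m + 1) - i.val then v (2 * (m + 1) - k) else 0) := by
    intro k hk
    rw [Finset.mem_Icc] at hk
    rw [genE, if_neg (by omega)]
    simp only [Matrix.add_apply, zmon_add, add_mul, Finset.sum_add_distrib, sum_unit_mul]
    congr 1
    · congr 1; simp; omega
    · congr 1; simp; omega
  have h2 : ∑ j, zmon 0 (genE (m + 1) (m + 1) i j) * v (j.val + 1) =
      zmon 0 (1 / 2) * ((if i.val = m + 1 then v m else 0) +
        (if i.val = m + 2 then v (m + 1) else 0)) := by
    have h : ∀ j, zmon 0 (genE (m + 1) (m + 1) i j) * v (j.val + 1) = zmon 0 (1 / 2) *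
        (zmon 0 (unit (m + 1) (m + 1 + 1) (m + 1 - 1) i j) * v (j.val + 1) +
          zmon 0 (unit (m + 1) (m + 1 + 2) (m + 1) i j) * v (j.val + 1)) := by
      intro j
      rw [genE, if_pos rfl, Matrix.smul_apply, Matrix.add_apply, smul_eq_mul, ← add_mul, ← zmon_add,
        ← mul_assoc, zmon_mul_zmon, add_zero]
    rw [Finset.sum_congr rfl fun j _ => h j, ← Finset.mul_sum, Finset.sum_add_distrib,
      sum_unit_mul, sum_unit_mul]
    congr 2
    · congr 1; simp; omega
    · congr 1; simp
  rw [Finset.sum_congr rfl h1, Finset.sum_add_distrib, sum_ite_Icc, sum_ite_Icc, h2]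
  have h3 : i.val ≠ 0 → 2 * (m + 1) - (2 * (m + 1) - i.val) = i.val := by omega
  split_ifs <;> first | omega | simp_all [add_comm]
  rw [add_comm, show 1 + (m + 1) = m + 2 by omega]

theorem Lam_apply (ℓ : ℕ) (i j : Fin (2 * ℓ)) :
    Lam ℓ i j = zmon 0 (genE0 ℓ i j) * zmon 1 1 +
      zmon 0 ((∑ k ∈ Finset.Icc 1 ℓ, genE ℓ k) i j) := by
  rw [Lam, Matrix.add_apply, Matrix.map_apply, Matrix.map_apply, zmon_eq_mul 1]

/-- `Λ(ζ ^ h)` applied to a vector. -/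
theorem sum_Lam_mul {ℓ : ℕ} (hℓ : 4 ≤ ℓ) (v : ℕ → InvLaurent) (i : Fin (2 * ℓ)) :
    ∑ j, substPow (cox ℓ) (Lam ℓ i j) * v (j.val + 1) =
      if i.val = 0 then zmon (cox ℓ) 1 * (zmon 0 (1 / 2) * v (2 * ℓ - 1))
      else if i.val = 1 then v 1 + zmon (cox ℓ) 1 * (zmon 0 (1 / 2) * v (2 * ℓ))
      else if i.val = ℓ then zmon 0 (1 / 2) * v (ℓ - 1)
      else if i.val = ℓ + 1 then zmon 0 (1 / 2) * v ℓ + v (ℓ + 1)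
      else v i.val := by
  have h : ∀ j, substPow (cox ℓ) (Lam ℓ i j) * v (j.val + 1) =
      zmon (cox ℓ) 1 * (zmon 0 (genE0 ℓ i j) * v (j.val + 1)) +
        zmon 0 ((∑ k ∈ Finset.Icc 1 ℓ, genE ℓ k) i j) * v (j.val + 1) := by
    intro j
    rw [Lam_apply, map_add, map_mul, substPow_zmon (cox_pos hℓ), substPow_zmon (cox_pos hℓ),
      substPow_zmon (cox_pos hℓ), mul_one, mul_zero]
    ring
  rw [Finset.sum_congr rfl fun j _ => h j, Finset.sum_add_distrib, ← Finset.mul_sum,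
    sum_genE0_mul hℓ, sum_genE_mul hℓ]
  split_ifs <;> first | omega | simp_all [add_comm]

theorem sum_comb_mul {n : ℕ} (v : ℕ → InvLaurent) (w : InvLaurent) (a b c d : ℂ)
    (A B C D : Fin n → ℂ) :
    ∑ j, (w * zmon 0 (a * A j + b * B j + c * C j + d * D j)) * v (j.val + 1) =
      w * (zmon 0 a * ∑ j, zmon 0 (A j) * v (j.val + 1) +
        zmon 0 b * ∑ j, zmon 0 (B j) * v (j.val + 1) +
        zmon 0 c * ∑ j, zmon 0 (C j) * v (j.val + 1) +
        zmon 0 d * ∑ j, zmon 0 (D j) * v (j.val + 1)) := by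
  simp only [Finset.mul_sum, ← Finset.sum_add_distrib]
  refine Finset.sum_congr rfl fun j _ => ?_
  have h : ∀ x y : ℂ, zmon 0 (x * y) = zmon 0 x * zmon 0 y := fun x y => by
    rw [zmon_mul_zmon, add_zero]
  simp only [zmon_add, h]
  ring

/-- `Γ(ζ ^ h)` applied to a vector. -/
theorem sum_Gam_mul {ℓ : ℕ} (hℓ : 4 ≤ ℓ) (v : ℕ → InvLaurent) (i : Fin (2 * ℓ)) :
    ∑ j, substPow (cox ℓ) (Gam ℓ i j) * v (j.val + 1) =
      if i.val = 0 then zmon (cox ℓ) 1 * (zmon 0 (1 / 2) * v (ℓ + 1) + zmon 0 (-1 / 4) * v ℓ)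
      else if i.val = ℓ - 1 then zmon (cox ℓ) 1 * (zmon 0 (1 / 2) * v (2 * ℓ)) - v 1
      else if i.val = ℓ then
        zmon 0 (1 / 2) * v 1 + zmon (cox ℓ) 1 * (zmon 0 (-1 / 4) * v (2 * ℓ))
      else if i.val = 2 * ℓ - 1 then zmon 0 (1 / 2) * v ℓ - v (ℓ + 1)
      else 0 := by
  have hi := i.isLt
  have h : ∀ j, substPow (cox ℓ) (Gam ℓ i j) * v (j.val + 1) =
      (1 * zmon 0 (-1 * unit ℓ ℓ 1 i j + 1 / 2 * unit ℓ (ℓ + 1) 1 i j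
        + -1 * unit ℓ (2 * ℓ) (ℓ + 1) i j + 1 / 2 * unit ℓ (2 * ℓ) ℓ i j)) * v (j.val + 1) +
      (zmon (cox ℓ) 1 * zmon 0 (1 / 2 * unit ℓ ℓ (2 * ℓ) i j +
        -1 / 4 * unit ℓ (ℓ + 1) (2 * ℓ) i j
        + 1 / 2 * unit ℓ 1 (ℓ + 1) i j + -1 / 4 * unit ℓ 1 ℓ i j)) * v (j.val + 1) := by
    intro j
    rw [Gam, Matrix.neg_apply, Matrix.add_apply, Matrix.map_apply, Matrix.map_apply, map_neg,
      map_add, substPow_zmon (cox_pos hℓ), substPow_zmon (cox_pos hℓ), mul_zero, mul_one,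
      zmon_eq_mul (cox ℓ : ℤ)]
    have aux : ∀ x y x' y' : ℂ, x' = -x → y' = -y →
        (-(zmon 0 x + zmon 0 y * zmon (cox ℓ) 1)) * v (j.val + 1) =
          1 * zmon 0 x' * v (j.val + 1) + zmon (cox ℓ) 1 * zmon 0 y' * v (j.val + 1) := by
      rintro x y _ _ rfl rfl
      rw [zmon_neg, zmon_neg]
      ring
    apply aux
    · simp only [Matrix.add_apply, Matrix.sub_apply, Matrix.smul_apply, smul_eq_mul]
      ring
    · simp only [Matrix.add_apply, Matrix.sub_apply, Matrix.smul_apply, smul_eq_mul]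
      ring
  rw [Finset.sum_congr rfl fun j _ => h j, Finset.sum_add_distrib, sum_comb_mul, sum_comb_mul]
  simp only [sum_unit_mul, zmon_neg, zmon_zero_one]
  have e1 : (i.val + 1 = ℓ ∧ 1 ≤ 1 ∧ 1 ≤ 2 * ℓ) ↔ i.val = ℓ - 1 := by omega
  have e2 : (i.val + 1 = ℓ + 1 ∧ 1 ≤ 1 ∧ 1 ≤ 2 * ℓ) ↔ i.val = ℓ := by omega
  have e3 : (i.val + 1 = 2 * ℓ ∧ 1 ≤ ℓ + 1 ∧ ℓ + 1 ≤ 2 * ℓ) ↔ i.val = 2 * ℓ - 1 := by omega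
  have e4 : (i.val + 1 = 2 * ℓ ∧ 1 ≤ ℓ ∧ ℓ ≤ 2 * ℓ) ↔ i.val = 2 * ℓ - 1 := by omega
  have e5 : (i.val + 1 = ℓ ∧ 1 ≤ 2 * ℓ ∧ 2 * ℓ ≤ 2 * ℓ) ↔ i.val = ℓ - 1 := by omega
  have e6 : (i.val + 1 = ℓ + 1 ∧ 1 ≤ 2 * ℓ ∧ 2 * ℓ ≤ 2 * ℓ) ↔ i.val = ℓ := by omega
  have e7 : (i.val + 1 = 1 ∧ 1 ≤ ℓ + 1 ∧ ℓ + 1 ≤ 2 * ℓ) ↔ i.val = 0 := by omega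
  have e8 : (i.val + 1 = 1 ∧ 1 ≤ ℓ ∧ ℓ ≤ 2 * ℓ) ↔ i.val = 0 := by omega
  simp only [e1, e2, e3, e4, e5, e6, e7, e8]
  split_ifs <;> first | omega | ring

end DrinfeldSokolovD

namespace DrinfeldSokolovD

/-! ### Eigenvectors of `Λ` and `Γ` -/

theorem two_mul_zmon_half : (2 : InvLaurent) * zmon 0 (1 / 2) = 1 := by
  rw [two_mul, ← zmon_add, add_halves, zmon_zero_one]

theorem zmon_neg_quarter : zmon 0 (-1 / 4) = -(zmon 0 (1 / 2) * zmon 0 (1 / 2)) := by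
  rw [zmon_mul_zmon, ← zmon_neg]
  congr 1
  norm_num

/-- Expressing all entries through the single element q = (xζ)⁻¹ makes the eigenvector equations
polynomial identities. -/
theorem betaEntry_eq (ℓ : ℕ) (x : ℂ) (r : ℕ) :
    betaEntry ℓ x r =
      if r = 1 then zmon 0 (1 / 2)
      else if r ≤ ℓ then zmon (-1) x⁻¹ ^ (r - 1)
      else if r = ℓ + 1 then zmon 0 (1 / 2) * zmon (-1) x⁻¹ ^ (ℓ - 1)
      else zmon (-1) x⁻¹ ^ (r - 2) := by
  have h : ∀ k : ℕ, zmon (-(k : ℤ)) (x ^ k)⁻¹ = zmon (-1) x⁻¹ ^ k := by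
    intro k
    rw [zmon_pow, inv_pow]
    congr 1
    ring
  simp only [betaEntry, h, zmon_pow, zmon_mul_zmon]
  split_ifs <;> first | rfl | (congr 1 <;> simp)

/-- Consecutive entries of β_x have ratio (xζ)⁻¹, with weight ½ in rows 1 and ℓ+1, where Λ branches.
The chain closes up through z E_0 because z (xζ)^{-h} = x^{-h} = 1. -/
theorem sum_Lam_beta {ℓ : ℕ} (hℓ : 4 ≤ ℓ) {x : ℂ} (hx : x ^ cox ℓ = 1) (i : Fin (2 * ℓ)) :
    ∑ j, substPow (cox ℓ) (Lam ℓ i j) * betaEntry ℓ x (j.val + 1) =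
      zmon 1 x * betaEntry ℓ x (i.val + 1) := by
  have hi := i.isLt
  have hx0 : x ≠ 0 := by
    rintro rfl
    rw [zero_pow (cox_pos hℓ).ne'] at hx
    exact zero_ne_one hx
  rw [sum_Lam_mul hℓ]
  simp only [betaEntry_eq]
  have hQ : zmon 1 x * zmon (-1) x⁻¹ = 1 := by
    rw [zmon_mul_zmon, mul_inv_cancel₀ hx0, ← zmon_zero_one]; rfl
  have hW : zmon (cox ℓ) 1 * zmon (-1) x⁻¹ ^ cox ℓ = 1 := by
    rw [zmon_pow, zmon_mul_zmon, inv_pow, hx, ← zmon_zero_one]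
    congr 1 <;> simp
  have h2 := two_mul_zmon_half
  -- Only the relations Qq = 1, W q^h = 1 and 2c = 1 are needed from here on, for Q = xζ, q = Q⁻¹, W
  -- = ζ^h, c = ½.
  generalize zmon 1 x = Q at *
  generalize zmon (-1) x⁻¹ = q at *
  generalize zmon (cox ℓ) 1 = W at *
  generalize zmon 0 (1 / 2) = c at *
  have hstep : ∀ k, Q * q ^ (k + 1) = q ^ k := fun k => by
    linear_combination q ^ k * hQ
  have hcox : cox ℓ = (2 * ℓ - 3) + 1 := by simp only [cox]; omega
  rw [hcox] at hW
  by_cases h0 : i.val = 0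
  · rw [if_pos h0, if_neg (by omega), if_neg (by omega), if_neg (by omega), if_pos (by omega)]
    rw [show 2 * ℓ - 1 - 2 = 2 * ℓ - 3 by omega]
    linear_combination -c * W * q ^ (2 * ℓ - 3) * hQ + c * Q * hW
  rw [if_neg h0]
  by_cases h1 : i.val = 1
  · rw [if_pos h1, h1]
    simp only [if_true]
    rw [if_neg (by omega), if_neg (by omega), if_neg (by omega), if_neg (by omega),
      if_pos (by omega), show 2 * ℓ - 2 = (2 * ℓ - 3) + 1 by omega]
    simp only [Nat.add_sub_cancel, pow_one]
    linear_combination c * hW + h2 - hQ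
  rw [if_neg h1, if_neg (show ¬ i.val + 1 = 1 by omega)]
  by_cases h3 : i.val = ℓ
  · rw [if_pos h3, if_neg (by omega), if_pos (by omega), if_neg (by omega), if_pos (by omega)]
    obtain ⟨k, hk⟩ : ∃ k, ℓ = k + 2 := ⟨ℓ - 2, by omega⟩
    rw [hk, show k + 2 - 1 - 1 = k by omega, show k + 2 - 1 = k + 1 by omega]
    linear_combination -c * hstep k
  rw [if_neg h3]
  by_cases h4 : i.val = ℓ + 1
  · rw [if_pos h4, h4, if_neg (by omega), if_pos (by omega), if_neg (by omega), if_neg (by omega),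
      if_pos trivial, if_neg (by omega), if_neg (by omega)]
    obtain ⟨k, hk⟩ : ∃ k, ℓ = k + 1 := ⟨ℓ - 1, by omega⟩
    rw [hk, show k + 1 - 1 = k by omega, show k + 1 + 1 + 1 - 2 = k + 1 by omega]
    linear_combination q ^ k * h2 - hstep k
  rw [if_neg h4, if_neg h1]
  by_cases h5 : i.val + 1 ≤ ℓ
  · rw [if_pos (by omega), if_pos h5]
    obtain ⟨k, hk⟩ : ∃ k, i.val = k + 1 := ⟨i.val - 1, by omega⟩
    rw [hk, Nat.add_sub_cancel, Nat.add_sub_cancel, hstep]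
  · rw [if_neg (by omega), if_neg h5, if_neg h4, if_neg (by omega)]
    obtain ⟨k, hk⟩ : ∃ k, i.val = k + 2 := ⟨i.val - 2, by omega⟩
    rw [hk, Nat.add_sub_cancel, show k + 2 + 1 - 2 = k + 1 by omega, hstep]

/-- Each row of Γ takes a difference of two proportional entries of β_x: rows ℓ and ℓ+1 are in the
ratio 1 : ½, and rows 1 and 2ℓ are linked by z (xζ)^{-h} = 1. -/
theorem sum_Gam_beta {ℓ : ℕ} (hℓ : 4 ≤ ℓ) {x : ℂ} (hx : x ^ cox ℓ = 1) (i : Fin (2 * ℓ)) :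
    ∑ j, substPow (cox ℓ) (Gam ℓ i j) * betaEntry ℓ x (j.val + 1) = 0 := by
  have hi := i.isLt
  rw [sum_Gam_mul hℓ, zmon_neg_quarter]
  simp only [betaEntry_eq]
  have hW : zmon (cox ℓ) 1 * zmon (-1) x⁻¹ ^ cox ℓ = 1 := by
    rw [zmon_pow, zmon_mul_zmon, inv_pow, hx, ← zmon_zero_one]
    congr 1 <;> simp
  have h2 := two_mul_zmon_half
  generalize zmon (-1) x⁻¹ = q at *
  generalize zmon (cox ℓ) 1 = W at *
  generalize zmon 0 (1 / 2) = c at *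
  have hcox : cox ℓ = 2 * ℓ - 2 := by simp only [cox]
  rw [hcox] at hW
  rw [if_neg (show ¬ ℓ + 1 = 1 by omega), if_neg (show ¬ ℓ + 1 ≤ ℓ by omega), if_pos trivial,
    if_neg (show ¬ ℓ = 1 by omega), if_pos le_rfl, if_pos trivial,
    if_neg (show ¬ 2 * ℓ = 1 by omega), if_neg (show ¬ 2 * ℓ ≤ ℓ by omega),
    if_neg (show ¬ 2 * ℓ = ℓ + 1 by omega)]
  split_ifs
  · ring
  · linear_combination c * hW
  · linear_combination -c ^ 2 * hW + (0 : InvLaurent) * h2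
  · ring
  · rfl

theorem zmon_cast_sub_one_mul (ℓ : ℕ) (k : ℤ) (a : ℂ) :
    zmon k ((ℓ - 1) * a) = zmon 0 (ℓ - 1) * zmon k a := by
  rw [zmon_mul_zmon, zero_add]

theorem betaZeroEntry_eq (ℓ : ℕ) (s : ℂ) (r : ℕ) :
    betaZeroEntry ℓ s r = zmon 0 (ℓ - 1) *
      (if r = 1 then zmon 0 (1 / 2)
      else if r = ℓ then -(zmon 0 s * zmon (-1) 1 ^ (ℓ - 1))
      else if r = ℓ + 1 then zmon 0 (1 / 2) * (zmon 0 s * zmon (-1) 1 ^ (ℓ - 1))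
      else if r = 2 * ℓ then -zmon (-1) 1 ^ (2 * ℓ - 2)
      else 0) := by
  have h : ∀ n : ℕ, zmon (-1) 1 ^ n = zmon (-(n : ℤ)) 1 := fun n => by
    rw [zmon_pow, one_pow, mul_neg, mul_one]
  have h' : ∀ k : ℤ, zmon 0 s * zmon k 1 = zmon k s := fun k => (zmon_eq_mul k s).symm
  simp only [betaZeroEntry, h, h']
  split_ifs
  · rw [zmon_cast_sub_one_mul]
  · rw [zmon_cast_sub_one_mul, zmon_neg]
  · rw [zmon_mul_zmon, zmon_mul_zmon, zero_add, zero_add]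
    congr 1
    ring
  · rw [zmon_neg, zmon_eq_mul]
    ring
  · rw [mul_zero]

theorem sum_Lam_betaZero {ℓ : ℕ} (hℓ : 4 ≤ ℓ) (s : ℂ) (i : Fin (2 * ℓ)) :
    ∑ j, substPow (cox ℓ) (Lam ℓ i j) * betaZeroEntry ℓ s (j.val + 1) = 0 := by
  have hi := i.isLt
  rw [sum_Lam_mul hℓ]
  simp only [betaZeroEntry_eq]
  have hW : zmon (cox ℓ) 1 * zmon (-1) 1 ^ cox ℓ = 1 := by
    rw [zmon_pow, zmon_mul_zmon, one_pow, ← zmon_zero_one]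
    congr 1 <;> simp
  rw [show cox ℓ = 2 * ℓ - 2 by rfl] at *
  generalize zmon (-1) 1 = q at *
  generalize zmon (2 * ℓ - 2 : ℕ) 1 = W at *
  generalize zmon 0 (1 / 2) = c at *
  by_cases h0 : i.val = 0
  · rw [if_pos h0, if_neg (by omega), if_neg (by omega), if_neg (by omega), if_neg (by omega)]
    ring
  rw [if_neg h0]
  by_cases h1 : i.val = 1
  · rw [if_pos h1, if_pos trivial, if_neg (by omega), if_neg (by omega), if_neg (by omega),
      if_pos trivial]
    linear_combination -zmon 0 (ℓ - 1) * c * hW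
  rw [if_neg h1]
  by_cases h3 : i.val = ℓ
  · rw [if_pos h3, if_neg (by omega), if_neg (by omega), if_neg (by omega), if_neg (by omega)]
    ring
  rw [if_neg h3]
  by_cases h4 : i.val = ℓ + 1
  · rw [if_pos h4, if_neg (by omega), if_pos trivial, if_neg (by omega), if_neg (by omega), if_pos trivial]
    ring
  rw [if_neg h4, if_neg h1, if_neg h3, if_neg h4, if_neg (by omega), mul_zero]

/-- On the span of the coordinates 1, ℓ, ℓ+1, 2ℓ the eigenvalue is s ζ^{ℓ-1}. With V = ζ^{ℓ-1} and q
= V⁻¹, the equation follows from z = V², Vq = 1 and s² = 1. -/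
theorem sum_Gam_betaZero {ℓ : ℕ} (hℓ : 4 ≤ ℓ) {s : ℂ} (hs : s * s = 1) (i : Fin (2 * ℓ)) :
    ∑ j, substPow (cox ℓ) (Gam ℓ i j) * betaZeroEntry ℓ s (j.val + 1) =
      zmon (ℓ - 1 : ℕ) s * betaZeroEntry ℓ s (i.val + 1) := by
  have hi := i.isLt
  rw [sum_Gam_mul hℓ, zmon_neg_quarter]
  simp only [betaZeroEntry_eq]
  have hs' : zmon 0 s * zmon 0 s = 1 := by
    rw [zmon_mul_zmon, hs, add_zero, zmon_zero_one]
  have hW : zmon (cox ℓ) 1 = zmon (ℓ - 1 : ℕ) 1 * zmon (ℓ - 1 : ℕ) 1 := by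
    rw [zmon_mul_zmon]
    congr 1
    · simp only [cox]; omega
    · simp
  have hV : zmon (ℓ - 1 : ℕ) 1 * zmon (-1) 1 ^ (ℓ - 1) = 1 := by
    rw [zmon_pow, zmon_mul_zmon, one_pow, ← zmon_zero_one]
    congr 1 <;> simp
  have h2 := two_mul_zmon_half
  rw [zmon_eq_mul ((ℓ - 1 : ℕ) : ℤ) s, hW, show 2 * ℓ - 2 = (ℓ - 1) + (ℓ - 1) by omega, pow_add]
  generalize zmon (-1) 1 ^ (ℓ - 1) = q at *
  generalize zmon (ℓ - 1 : ℕ) 1 = V at *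
  generalize zmon 0 (1 / 2) = c at *
  generalize zmon 0 s = t at *
  generalize zmon 0 ((ℓ : ℂ) - 1) = k at *
  rw [if_neg (show ¬ ℓ + 1 = 1 by omega), if_neg (show ¬ ℓ + 1 = ℓ by omega), if_pos trivial,
    if_neg (show ¬ ℓ = 1 by omega), if_pos trivial, if_pos trivial,
    if_neg (show ¬ 2 * ℓ = 1 by omega), if_neg (show ¬ 2 * ℓ = ℓ by omega),
    if_neg (show ¬ 2 * ℓ = ℓ + 1 by omega), if_pos trivial]
  by_cases h0 : i.val = 0
  · rw [if_pos h0, if_pos (by omega)]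
    linear_combination k * c * V * t * (c * hV + c * hV) + k * V * t * c * h2
  rw [if_neg h0, if_neg (show ¬ i.val + 1 = 1 by omega)]
  by_cases h1 : i.val = ℓ - 1
  · rw [if_pos h1, if_pos (by omega)]
    linear_combination -k * c * (V * q + 1) * hV + k * hV * (t * t) + k * hs' - k * h2
  rw [if_neg h1, if_neg (show ¬ i.val + 1 = ℓ by omega)]
  by_cases h3 : i.val = ℓ
  · rw [if_pos h3, if_pos (by omega)]
    linear_combination k * c * c * (V * q + 1) * hV - k * c * hV * (t * t) - k * c * hs'
      + k * c * h2
  rw [if_neg h3, if_neg (show ¬ i.val + 1 = ℓ + 1 by omega)]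
  by_cases h4 : i.val = 2 * ℓ - 1
  · rw [if_pos h4, if_pos (by omega)]
    linear_combination -k * t * q * h2 + k * t * q * hV
  rw [if_neg h4, if_neg (by omega), mul_zero, mul_zero]

end DrinfeldSokolovD

namespace DrinfeldSokolovD

/-! ### Multiples of matrices over a commutative ring -/

/-- The multiple `a M` of a matrix. -/
def scal {n : Type*} {R : Type*} [CommRing R] (a : R) (M : Matrix n n R) : Matrix n n R := a • M

section scal

variable {n : Type*} {R : Type*} [CommRing R]

theorem scal_apply (a : R) (M : Matrix n n R) (i j : n) : scal a M i j = a * M i j := rfl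

theorem scal_mul [Fintype n] (a : R) (M N : Matrix n n R) : scal a M * N = scal a (M * N) :=
  Matrix.smul_mul a M N

theorem mul_scal [Fintype n] (a : R) (M N : Matrix n n R) : M * scal a N = scal a (M * N) :=
  Matrix.mul_smul M a N

theorem scal_scal (a b : R) (M : Matrix n n R) : scal a (scal b M) = scal (a * b) M :=
  smul_smul a b M

theorem scal_add (a : R) (M N : Matrix n n R) : scal a (M + N) = scal a M + scal a N :=
  smul_add a M N

theorem scal_sub (a : R) (M N : Matrix n n R) : scal a (M - N) = scal a M - scal a N :=
  smul_sub a M N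

theorem add_scal (a b : R) (M : Matrix n n R) : scal (a + b) M = scal a M + scal b M :=
  add_smul a b M

theorem one_scal (M : Matrix n n R) : scal 1 M = M := one_smul R M

theorem scal_zero (a : R) : scal a (0 : Matrix n n R) = 0 := smul_zero a

theorem scal_sum {ι : Type*} (a : R) (s : Finset ι) (M : ι → Matrix n n R) :
    scal a (∑ i ∈ s, M i) = ∑ i ∈ s, scal a (M i) := Finset.smul_sum

theorem trace_scal [Fintype n] (a : R) (M : Matrix n n R) : (scal a M).trace = a * M.trace :=
  Matrix.trace_smul a M

theorem map_scal {S : Type*} [CommRing S] (f : R →+* S) (a : R) (M : Matrix n n R) :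
    (scal a M).map f = scal (f a) (M.map f) := by
  ext1 i j
  exact map_mul f a (M i j)

theorem scal_diagonal [DecidableEq n] (a : R) (v : n → R) :
    scal a (Matrix.diagonal v) = Matrix.diagonal fun c => a * v c :=
  (Matrix.diagonal_smul a v).symm

end scal

/-! ### Diagonalization -/

theorem cast_cox {ℓ : ℕ} (hℓ : 4 ≤ ℓ) : ((cox ℓ : ℕ) : ℂ) = 2 * ℓ - 2 := by
  rw [cox, Nat.cast_sub (by omega)]
  push_cast
  ring

theorem isPrimitiveRoot_omega {ℓ : ℕ} (hℓ : 4 ≤ ℓ) : IsPrimitiveRoot (omega ℓ) (cox ℓ) := by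
  rw [omega, ← cast_cox hℓ]
  exact Complex.isPrimitiveRoot_exp _ (cox_pos hℓ).ne'

/-- The eigenvalues of `Λ(ζ ^ h)`. -/
def lamEig (ℓ : ℕ) (c : Fin (2 * ℓ)) : InvLaurent :=
  if c.val < 2 * ℓ - 2 then zmon 1 (omega ℓ ^ c.val) else 0

/-- The eigenvalues of `Γ(ζ ^ h)`. -/
def gamEig (ℓ : ℕ) (c : Fin (2 * ℓ)) : InvLaurent :=
  if c.val < 2 * ℓ - 2 then 0
  else zmon (ℓ - 1 : ℕ) (if c.val = 2 * ℓ - 2 then 1 else -1)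

/-- `Λ(ζ ^ h)`. -/
def lamZ (ℓ : ℕ) : Mat ℓ InvLaurent := (Lam ℓ).map (substPow (cox ℓ))

/-- `Γ(ζ ^ h)`. -/
def gamZ (ℓ : ℕ) : Mat ℓ InvLaurent := (Gam ℓ).map (substPow (cox ℓ))

/-- The columns of `P(ζ)` before normalization. -/
def colP (ℓ c r : ℕ) : InvLaurent :=
  if c < 2 * ℓ - 2 then betaEntry ℓ (omega ℓ ^ c) r
  else betaZeroEntry ℓ (if c = 2 * ℓ - 2 then 1 else -1) r

theorem Pmat_apply (ℓ : ℕ) (r c : Fin (2 * ℓ)) :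
    Pmat ℓ r c = zmon 0 ((2 * ℓ - 2 : ℂ))⁻¹ * colP ℓ c.val (r.val + 1) := by
  rw [Pmat, Matrix.of_apply, smul_eq_zmon_mul, colP]
  split_ifs <;> rfl

theorem omega_pow_pow_cox {ℓ : ℕ} (hℓ : 4 ≤ ℓ) (c : ℕ) : (omega ℓ ^ c) ^ cox ℓ = 1 := by
  rw [pow_right_comm, (isPrimitiveRoot_omega hℓ).pow_eq_one, one_pow]

theorem lamZ_mul_Pmat {ℓ : ℕ} (hℓ : 4 ≤ ℓ) :
    lamZ ℓ * Pmat ℓ = Pmat ℓ * Matrix.diagonal (lamEig ℓ) := by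
  ext1 r c
  rw [Matrix.mul_diagonal, Matrix.mul_apply]
  have h : ∀ j, lamZ ℓ r j * Pmat ℓ j c = zmon 0 ((2 * ℓ - 2 : ℂ))⁻¹ *
      (substPow (cox ℓ) (Lam ℓ r j) * colP ℓ c.val (j.val + 1)) := by
    intro j
    rw [Pmat_apply, lamZ, Matrix.map_apply]
    ring
  rw [Finset.sum_congr rfl fun j _ => h j, ← Finset.mul_sum, Pmat_apply, mul_assoc]
  congr 1
  simp only [colP, lamEig]
  split_ifs with h0
  · rw [sum_Lam_beta hℓ (omega_pow_pow_cox hℓ _), mul_comm]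
  · rw [sum_Lam_betaZero hℓ, mul_zero]
  · rw [sum_Lam_betaZero hℓ, mul_zero]

theorem gamZ_mul_Pmat {ℓ : ℕ} (hℓ : 4 ≤ ℓ) :
    gamZ ℓ * Pmat ℓ = Pmat ℓ * Matrix.diagonal (gamEig ℓ) := by
  ext1 r c
  rw [Matrix.mul_diagonal, Matrix.mul_apply]
  have h : ∀ j, gamZ ℓ r j * Pmat ℓ j c = zmon 0 ((2 * ℓ - 2 : ℂ))⁻¹ *
      (substPow (cox ℓ) (Gam ℓ r j) * colP ℓ c.val (j.val + 1)) := by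
    intro j
    rw [Pmat_apply, gamZ, Matrix.map_apply]
    ring
  rw [Finset.sum_congr rfl fun j _ => h j, ← Finset.mul_sum, Pmat_apply, mul_assoc]
  congr 1
  simp only [colP, gamEig]
  split_ifs with h0
  · rw [sum_Gam_beta hℓ (omega_pow_pow_cox hℓ _), mul_zero]
  · rw [sum_Gam_betaZero hℓ (by norm_num), mul_comm]
  · rw [sum_Gam_betaZero hℓ (by norm_num), mul_comm]

theorem natCast_sub_one_ne_zero {ℓ : ℕ} (hℓ : 4 ≤ ℓ) : ((ℓ : ℂ) - 1) ≠ 0 := by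
  rw [sub_ne_zero]
  exact_mod_cast (show ℓ ≠ 1 by omega)

/-- The columns of P are eigenvectors of the single matrix Λ + 2ζ^{2-ℓ} Γ, with eigenvalues ω^i ζ
and ±2ζ. The factor 2 separates the last two from the roots of unity by absolute value, so the
eigenvalues are distinct and the columns independent. -/
theorem isUnit_Pmat {ℓ : ℕ} (hℓ : 4 ≤ ℓ) : IsUnit (Pmat ℓ) := by
  let q : InvLaurent := zmon (2 - ℓ) 2
  let M : Mat ℓ InvLaurent := lamZ ℓ + scal q (gamZ ℓ)
  let μ : Fin (2 * ℓ) → InvLaurent := fun c => zmon 1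
    (if c.val < 2 * ℓ - 2 then omega ℓ ^ c.val else if c.val = 2 * ℓ - 2 then 2 else -2)
  have hM : M * Pmat ℓ = Pmat ℓ * Matrix.diagonal μ := by
    rw [add_mul, scal_mul, lamZ_mul_Pmat hℓ, gamZ_mul_Pmat hℓ, ← mul_scal, ← mul_add]
    congr 1
    ext1 i j
    rw [Matrix.add_apply, scal_apply]
    by_cases hij : i = j
    · subst hij
      simp only [Matrix.diagonal_apply_eq, lamEig, gamEig, μ, q]
      have e : (2 : ℤ) - ℓ + (ℓ - 1 : ℕ) = 1 := by omega
      split_ifs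
      · rw [mul_zero, add_zero]
      · rw [zmon_mul_zmon, zero_add, e, mul_one]
      · rw [zmon_mul_zmon, zero_add, e]; norm_num
    · rw [Matrix.diagonal_apply_ne _ hij, Matrix.diagonal_apply_ne _ hij,
        Matrix.diagonal_apply_ne _ hij, mul_zero, add_zero]
  have hω := isPrimitiveRoot_omega hℓ
  have hnorm : ∀ n : ℕ, ‖omega ℓ ^ n‖ = 1 := fun n => by
    rw [norm_pow, hω.norm'_eq_one (cox_pos hℓ).ne', one_pow]
  have hμ : Function.Injective μ := by
    intro c d hcd
    have hcd := zmon_injective 1 hcd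
    have hc := c.isLt
    have hd := d.isLt
    apply Fin.ext
    split_ifs at hcd with h1 h2 h2 h3 h3 h3 h4 h4
    · exact hω.pow_inj h1 h2 hcd
    · exact absurd (congrArg norm hcd) (by rw [hnorm]; norm_num)
    · exact absurd (congrArg norm hcd) (by rw [hnorm]; norm_num)
    · exact absurd (congrArg norm hcd) (by rw [hnorm]; norm_num)
    · omega
    · norm_num at hcd
    · exact absurd (congrArg norm hcd) (by rw [hnorm]; norm_num)
    · norm_num at hcd
    · omega
  have heig : ∀ c, Module.End.HasEigenvector (Matrix.mulVecLin M) (μ c) ((Pmat ℓ).col c) := by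
    intro c
    refine ⟨Module.End.mem_eigenspace_iff.mpr ?_, ?_⟩
    · ext1 r
      have h := congrFun (congrFun hM r) c
      rw [Matrix.mul_diagonal, Matrix.mul_apply] at h
      rw [Matrix.mulVecLin_apply, Pi.smul_apply, smul_eq_mul]
      exact h.trans (mul_comm _ _)
    -- The first entry of every column is a nonzero constant.
    · intro h0
      have h := congrFun h0 ⟨0, by omega⟩
      rw [Matrix.col_apply, Pmat_apply, Pi.zero_apply] at h
      have h2 : (2 * ℓ - 2 : ℂ)⁻¹ ≠ 0 := by
        rw [← cast_cox hℓ]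
        exact inv_ne_zero (Nat.cast_ne_zero.mpr (cox_pos hℓ).ne')
      rcases mul_eq_zero.mp h with h | h
      · exact zmon_ne_zero h2 h
      · simp only [colP, betaEntry, betaZeroEntry, zero_add, if_true] at h
        split_ifs at h
        · exact zmon_ne_zero (by norm_num) h
        · exact zmon_ne_zero (mul_ne_zero (natCast_sub_one_ne_zero hℓ) (by norm_num)) h
  exact Matrix.linearIndependent_cols_iff_isUnit.mp
    (Module.End.eigenvectors_linearIndependent' _ μ hμ _ heig)

theorem isUnit_det_Pmat {ℓ : ℕ} (hℓ : 4 ≤ ℓ) : IsUnit (Pmat ℓ).det :=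
  (Matrix.isUnit_iff_isUnit_det _).mp (isUnit_Pmat hℓ)

theorem pow_mul_eq_mul_pow {n : Type*} [Fintype n] [DecidableEq n] {R : Type*} [CommRing R]
    {M P D : Matrix n n R} (h : M * P = P * D) (k : ℕ) : M ^ k * P = P * D ^ k := by
  induction k with
  | zero => simp
  | succ k ih => rw [pow_succ, mul_assoc, h, ← mul_assoc, ih, mul_assoc, ← pow_succ]

theorem lamZ_pow_eq {ℓ : ℕ} (hℓ : 4 ≤ ℓ) (k : ℕ) :
    lamZ ℓ ^ k = Pmat ℓ * Matrix.diagonal (lamEig ℓ ^ k) * (Pmat ℓ)⁻¹ := by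
  rw [← Matrix.diagonal_pow, ← pow_mul_eq_mul_pow (lamZ_mul_Pmat hℓ),
    Matrix.mul_nonsing_inv_cancel_right _ _ (isUnit_det_Pmat hℓ)]

theorem gamZ_pow_eq {ℓ : ℕ} (hℓ : 4 ≤ ℓ) (k : ℕ) :
    gamZ ℓ ^ k = Pmat ℓ * Matrix.diagonal (gamEig ℓ ^ k) * (Pmat ℓ)⁻¹ := by
  rw [← Matrix.diagonal_pow, ← pow_mul_eq_mul_pow (gamZ_mul_Pmat hℓ),
    Matrix.mul_nonsing_inv_cancel_right _ _ (isUnit_det_Pmat hℓ)]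

theorem map_pow_substPow {ℓ : ℕ} (h : ℕ) (M : Mat ℓ InvLaurent) (k : ℕ) :
    (M ^ k).map (substPow h) = M.map (substPow h) ^ k :=
  map_pow (substPow h).mapMatrix M k

theorem map_mul_substPow {ℓ : ℕ} (h : ℕ) (M N : Mat ℓ InvLaurent) :
    (M * N).map (substPow h) = M.map (substPow h) * N.map (substPow h) :=
  map_mul (substPow h).mapMatrix M N

theorem map_substPow_injective {ℓ : ℕ} (hℓ : 4 ≤ ℓ) :
    Function.Injective fun M : Mat ℓ InvLaurent => M.map (substPow (cox ℓ)) :=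
  Matrix.map_injective (substPow_injective (cox_pos hℓ))

/-! ### Relations between Λ and Γ read off from the eigenvalues -/

theorem lamEig_pow_cox_add_one {ℓ : ℕ} (hℓ : 4 ≤ ℓ) :
    lamEig ℓ ^ (cox ℓ + 1) = fun c => zmon (cox ℓ) 1 * lamEig ℓ c := by
  funext c
  simp only [Pi.pow_apply, lamEig]
  split_ifs
  · rw [zmon_pow, pow_succ, omega_pow_pow_cox hℓ, zmon_mul_zmon]
    congr 1
    push_cast
    ring
  · rw [mul_zero, zero_pow (by omega)]

/-- Every eigenvalue satisfies λ^{h+1} = ζ^h λ. The relation descends from ζ to z because z ↦ ζ^h is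
injective. -/
theorem Lam_pow_cox_add_one {ℓ : ℕ} (hℓ : 4 ≤ ℓ) : Lam ℓ ^ (cox ℓ + 1) = scal (zmon 1 1) (Lam ℓ) := by
  apply map_substPow_injective hℓ
  have h : (scal (zmon 1 1) (Lam ℓ)).map (substPow (cox ℓ)) = scal (zmon (cox ℓ) 1) (lamZ ℓ) := by
    rw [map_scal, substPow_zmon (cox_pos hℓ), mul_one]
    rfl
  simp only [map_pow_substPow, h]
  change lamZ ℓ ^ _ = _
  rw [lamZ_pow_eq hℓ, lamEig_pow_cox_add_one hℓ, ← scal_diagonal, mul_scal, scal_mul]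
  congr 1
  rw [← pow_one (lamEig ℓ), ← lamZ_pow_eq hℓ, pow_one]

theorem gamEig_pow_three {ℓ : ℕ} (hℓ : 4 ≤ ℓ) :
    gamEig ℓ ^ 3 = fun c => zmon (cox ℓ) 1 * gamEig ℓ c := by
  funext c
  have e : ((3 : ℕ) : ℤ) * (ℓ - 1 : ℕ) = (cox ℓ : ℕ) + (ℓ - 1 : ℕ) := by simp only [cox]; omega
  simp only [Pi.pow_apply, gamEig]
  split_ifs
  · rw [mul_zero, zero_pow (by omega)]
  · rw [zmon_pow, zmon_mul_zmon, e]; norm_num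
  · rw [zmon_pow, zmon_mul_zmon, e]; norm_num

theorem Gam_pow_three {ℓ : ℕ} (hℓ : 4 ≤ ℓ) : Gam ℓ ^ 3 = scal (zmon 1 1) (Gam ℓ) := by
  apply map_substPow_injective hℓ
  have h : (scal (zmon 1 1) (Gam ℓ)).map (substPow (cox ℓ)) = scal (zmon (cox ℓ) 1) (gamZ ℓ) := by
    rw [map_scal, substPow_zmon (cox_pos hℓ), mul_one]
    rfl
  simp only [map_pow_substPow, h]
  change gamZ ℓ ^ _ = _
  rw [gamZ_pow_eq hℓ, gamEig_pow_three hℓ, ← scal_diagonal, mul_scal, scal_mul]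
  congr 1
  rw [← pow_one (gamEig ℓ), ← gamZ_pow_eq hℓ, pow_one]

theorem lamEig_mul_gamEig (ℓ : ℕ) (c : Fin (2 * ℓ)) : lamEig ℓ c * gamEig ℓ c = 0 := by
  simp only [lamEig, gamEig]
  split_ifs <;> simp

/-- On each common eigenvector at least one of Λ and Γ vanishes. -/
theorem lamZ_mul_gamZ {ℓ : ℕ} (hℓ : 4 ≤ ℓ) : lamZ ℓ * gamZ ℓ = 0 := by
  rw [← pow_one (lamZ ℓ), ← pow_one (gamZ ℓ), lamZ_pow_eq hℓ, gamZ_pow_eq hℓ, mul_assoc,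
    mul_assoc, mul_assoc, Matrix.nonsing_inv_mul_cancel_left _ _ (isUnit_det_Pmat hℓ),
    ← mul_assoc (Matrix.diagonal _), Matrix.diagonal_mul_diagonal]
  simp only [pow_one, lamEig_mul_gamEig]
  simp

theorem gamZ_mul_lamZ {ℓ : ℕ} (hℓ : 4 ≤ ℓ) : gamZ ℓ * lamZ ℓ = 0 := by
  rw [← pow_one (lamZ ℓ), ← pow_one (gamZ ℓ), lamZ_pow_eq hℓ, gamZ_pow_eq hℓ, mul_assoc,
    mul_assoc, mul_assoc, Matrix.nonsing_inv_mul_cancel_left _ _ (isUnit_det_Pmat hℓ),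
    ← mul_assoc (Matrix.diagonal _), Matrix.diagonal_mul_diagonal]
  simp only [pow_one, mul_comm (gamEig ℓ _), lamEig_mul_gamEig]
  simp

theorem Lam_mul_Gam {ℓ : ℕ} (hℓ : 4 ≤ ℓ) : Lam ℓ * Gam ℓ = 0 := by
  apply map_substPow_injective hℓ
  simp only [map_mul_substPow]
  change lamZ ℓ * gamZ ℓ = _
  rw [lamZ_mul_gamZ hℓ]
  ext1; simp

theorem Gam_mul_Lam {ℓ : ℕ} (hℓ : 4 ≤ ℓ) : Gam ℓ * Lam ℓ = 0 := by
  apply map_substPow_injective hℓ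
  simp only [map_mul_substPow]
  change gamZ ℓ * lamZ ℓ = _
  rw [gamZ_mul_lamZ hℓ]
  ext1; simp

/-! ### Traces of powers of Λ and Γ -/

theorem trace_lamZ_pow {ℓ : ℕ} (hℓ : 4 ≤ ℓ) {k : ℕ} (hk : k ≠ 0) :
    (lamZ ℓ ^ k).trace = if cox ℓ ∣ k then zmon k (cox ℓ) else 0 := by
  have hω := isPrimitiveRoot_omega hℓ
  rw [lamZ_pow_eq hℓ, Matrix.trace_mul_comm, ← mul_assoc,
    Matrix.nonsing_inv_mul _ (isUnit_det_Pmat hℓ), one_mul, Matrix.trace_diagonal]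
  -- The two zero eigenvalues contribute nothing because k ≠ 0; what remains is the sum of the k-th
  -- powers of the h-th roots of unity.
  have h : ∀ c : Fin (2 * ℓ), (lamEig ℓ ^ k) c =
      if c.val < cox ℓ then zmon k ((omega ℓ ^ k) ^ c.val) else 0 := by
    intro c
    have hc : cox ℓ = 2 * ℓ - 2 := rfl
    simp only [Pi.pow_apply, lamEig, hc]
    by_cases h : c.val < 2 * ℓ - 2
    · rw [if_pos h, if_pos h, zmon_pow, pow_right_comm, mul_one]
    · rw [if_neg h, if_neg h, zero_pow hk]
  rw [Finset.sum_congr rfl fun c _ => h c,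
    Fin.sum_univ_eq_sum_range (fun c => if c < cox ℓ then zmon k ((omega ℓ ^ k) ^ c) else 0),
    ← Finset.sum_filter]
  have hf : (Finset.range (2 * ℓ)).filter (fun c => c < cox ℓ) = Finset.range (cox ℓ) := by
    ext c
    have : cox ℓ ≤ 2 * ℓ := by simp only [cox]; omega
    rw [Finset.mem_filter, Finset.mem_range, Finset.mem_range]
    omega
  rw [hf, ← zmon_sum]
  split_ifs with hd
  · rw [(hω.pow_eq_one_iff_dvd k).mpr hd]
    simp
  · rw [geom_sum_eq (fun h => hd ((hω.pow_eq_one_iff_dvd k).mp h)), omega_pow_pow_cox hℓ, sub_self,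
      zero_div, zmon_zero]

theorem trace_gamZ_pow {ℓ : ℕ} (hℓ : 4 ≤ ℓ) (k : ℕ) :
    (gamZ ℓ ^ (2 * (k + 1))).trace = zmon (cox ℓ * (k + 1)) 2 := by
  rw [gamZ_pow_eq hℓ, Matrix.trace_mul_comm, ← mul_assoc,
    Matrix.nonsing_inv_mul _ (isUnit_det_Pmat hℓ), one_mul, Matrix.trace_diagonal]
  have h : ∀ c : Fin (2 * ℓ), (gamEig ℓ ^ (2 * (k + 1))) c =
      if 2 * ℓ - 2 ≤ c.val then zmon (cox ℓ * (k + 1)) 1 else 0 := by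
    intro c
    have e : ((2 * (k + 1) : ℕ) : ℤ) * (ℓ - 1 : ℕ) = cox ℓ * (k + 1) := by
      rw [cox, show 2 * ℓ - 2 = 2 * (ℓ - 1) by omega]
      push_cast
      ring
    simp only [Pi.pow_apply, gamEig]
    by_cases hc : c.val < 2 * ℓ - 2
    · rw [if_pos hc, if_neg (Nat.not_le.mpr hc), zero_pow (by omega)]
    · rw [if_neg hc, if_pos (Nat.not_lt.mp hc), zmon_pow, e]
      by_cases hc' : c.val = 2 * ℓ - 2
      · rw [if_pos hc', one_pow]
      · rw [if_neg hc', pow_mul]; norm_num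
  obtain ⟨m, hm⟩ : ∃ m, 2 * ℓ = m + 2 := ⟨2 * ℓ - 2, by omega⟩
  rw [Finset.sum_congr rfl fun c _ => h c,
    Fin.sum_univ_eq_sum_range (fun c => if 2 * ℓ - 2 ≤ c then zmon (cox ℓ * (k + 1)) 1 else 0), hm,
    Finset.sum_range_succ, Finset.sum_range_succ, Finset.sum_eq_zero]
  · rw [if_pos (by omega), if_pos (by omega), zero_add, ← zmon_add]
    norm_num
  · intro c hc
    rw [Finset.mem_range] at hc
    rw [if_neg (by omega)]

theorem trace_map_substPow {ℓ : ℕ} (h : ℕ) (M : Mat ℓ InvLaurent) :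
    (M.map (substPow h)).trace = substPow h M.trace := by
  simp only [Matrix.trace, Matrix.diag_apply, Matrix.map_apply, map_sum]

theorem trace_Lam_pow_mul_cox {ℓ : ℕ} (hℓ : 4 ≤ ℓ) (s : ℕ) :
    (Lam ℓ ^ (cox ℓ * (s + 1))).trace = zmon (s + 1) (cox ℓ) := by
  apply substPow_injective (cox_pos hℓ)
  have := cox_pos hℓ
  rw [← trace_map_substPow, map_pow_substPow, substPow_zmon (cox_pos hℓ)]
  change (lamZ ℓ ^ _).trace = _
  rw [trace_lamZ_pow hℓ (by positivity), if_pos (dvd_mul_right _ _)]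
  push_cast
  rfl

theorem trace_Lam_pow_of_not_dvd {ℓ : ℕ} (hℓ : 4 ≤ ℓ) {k : ℕ} (hk : ¬ cox ℓ ∣ k) :
    (Lam ℓ ^ k).trace = 0 := by
  apply substPow_injective (cox_pos hℓ)
  rw [← trace_map_substPow, map_pow_substPow, map_zero]
  change (lamZ ℓ ^ _).trace = _
  rw [trace_lamZ_pow hℓ (by rintro rfl; simp at hk), if_neg hk]

theorem trace_Gam_pow {ℓ : ℕ} (hℓ : 4 ≤ ℓ) (s : ℕ) :
    (Gam ℓ ^ (2 * (s + 1))).trace = zmon (s + 1) 2 := by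
  apply substPow_injective (cox_pos hℓ)
  rw [← trace_map_substPow, map_pow_substPow, substPow_zmon (cox_pos hℓ)]
  exact trace_gamZ_pow hℓ s

end DrinfeldSokolovD

namespace DrinfeldSokolovD

/-! ### Derivations acting on matrices -/

/-- An additive map that satisfies the Leibniz rule. -/
structure IsDeriv {R : Type*} [CommRing R] (D : R → R) : Prop where
  add : ∀ a b, D (a + b) = D a + D b
  mul : ∀ a b, D (a * b) = D a * b + a * D b

namespace IsDeriv

variable {R : Type*} [CommRing R] {D : R → R} (hD : IsDeriv D)

include hD

theorem zero : D 0 = 0 := by simpa using hD.add 0 0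

theorem neg (a : R) : D (-a) = -D a := by
  have h := hD.add a (-a)
  rw [add_neg_cancel, hD.zero] at h
  exact eq_neg_of_add_eq_zero_right h.symm

theorem sub (a b : R) : D (a - b) = D a - D b := by
  rw [sub_eq_add_neg, hD.add, hD.neg, sub_eq_add_neg]

theorem one : D 1 = 0 := by simpa using hD.mul 1 1

theorem sum {ι : Type*} (s : Finset ι) (f : ι → R) : D (∑ i ∈ s, f i) = ∑ i ∈ s, D (f i) :=
  map_sum (⟨⟨D, hD.zero⟩, hD.add⟩ : R →+ R) f s

theorem natCast_mul (n : ℕ) (a : R) : D (n * a) = n * D a := by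
  have h : D (n • a) = n • D a := map_nsmul (⟨⟨D, hD.zero⟩, hD.add⟩ : R →+ R) n a
  simpa [nsmul_eq_mul] using h

variable {n : Type*}

theorem map_add (A B : Matrix n n R) : (A + B).map D = A.map D + B.map D := by
  ext1 i j; simpa using hD.add _ _

theorem map_sub (A B : Matrix n n R) : (A - B).map D = A.map D - B.map D := by
  ext1 i j; simpa using hD.sub _ _

theorem map_sum {ι : Type*} (s : Finset ι) (f : ι → Matrix n n R) :
    (∑ i ∈ s, f i).map D = ∑ i ∈ s, (f i).map D := by
  ext1 i j
  rw [Matrix.map_apply, Matrix.sum_apply, Matrix.sum_apply, hD.sum]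
  rfl

theorem map_one [DecidableEq n] : (1 : Matrix n n R).map D = 0 := by
  ext1 i j
  by_cases h : i = j
  · subst h; simpa using hD.one
  · simpa [h] using hD.zero

theorem map_mul [Fintype n] (A B : Matrix n n R) :
    (A * B).map D = A.map D * B + A * B.map D := by
  ext1 i j
  rw [Matrix.map_apply, Matrix.mul_apply, hD.sum, Matrix.add_apply, Matrix.mul_apply,
    Matrix.mul_apply, ← Finset.sum_add_distrib]
  exact Finset.sum_congr rfl fun k _ => hD.mul _ _

theorem map_scal_of_const {a : R} (ha : D a = 0) (A : Matrix n n R) :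
    (scal a A).map D = scal a (A.map D) := by
  ext1 i j
  rw [Matrix.map_apply, scal_apply, hD.mul, ha, zero_mul, zero_add]
  rfl

theorem trace_map [Fintype n] (A : Matrix n n R) : (A.map D).trace = D A.trace := by
  rw [Matrix.trace, Matrix.trace, hD.sum]
  rfl

/-- The derivative of an inverse matrix. -/
theorem map_inv [Fintype n] [DecidableEq n] {A B : Matrix n n R} (h : A * B = 1) :
    B.map D = -(B * A.map D * B) := by
  have h' : B * A = 1 := mul_eq_one_comm.mp h
  have h1 := hD.map_mul A B
  rw [h, hD.map_one] at h1
  have h2 := congrArg (B * ·) h1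
  simp only [mul_zero, mul_add, ← mul_assoc, h', one_mul] at h2
  exact eq_neg_of_add_eq_zero_right h2.symm

/-- `Tr (D(M ^ p) N) = p Tr (D(M) M ^ (p - 1) N)` if `N` commutes with `M`. -/
theorem trace_map_pow_mul [Fintype n] [DecidableEq n] (M : Matrix n n R) (p : ℕ) :
    ∀ N : Matrix n n R, M * N = N * M →
      ((M ^ (p + 1)).map D * N).trace = (p + 1 : ℕ) * (M.map D * (M ^ p * N)).trace := by
  induction p with
  | zero => intro N _; simp
  | succ p ih =>
    intro N hN
    have hN' : M * (M * N) = M * N * M := by rw [mul_assoc, hN]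
    have hc : Commute (M ^ (p + 1)) N := Commute.pow_left hN _
    have e : ((M ^ (p + 1)) * M.map D * N).trace = (M.map D * (M ^ (p + 1) * N)).trace := by
      rw [mul_assoc, Matrix.trace_mul_comm, mul_assoc, ← hc.eq]
    rw [pow_succ, hD.map_mul, add_mul, Matrix.trace_add, mul_assoc, ih _ hN', ← mul_assoc (M ^ p),
      ← pow_succ, e, Nat.cast_succ (p + 1)]
    ring

/-- Both sides equal p (p + q) Tr(D(M) M^{p+q-1}). -/
theorem trace_map_pow_mul_pow [Fintype n] [DecidableEq n] (M : Matrix n n R) (p q : ℕ) :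
    ((p + q : ℕ) : R) * ((M ^ p).map D * M ^ q).trace = p * D (M ^ (p + q)).trace := by
  rcases p with _ | p
  · rw [pow_zero, hD.map_one, zero_mul, Matrix.trace_zero]; simp
  have h1 := hD.trace_map_pow_mul M p (M ^ q) (Commute.self_pow M q).eq
  have h2 := hD.trace_map_pow_mul M (p + q) 1 (by simp)
  rw [mul_one, mul_one, hD.trace_map] at h2
  rw [h1, show p + 1 + q = p + q + 1 by ring, h2, ← pow_add]
  ring

end IsDeriv

theorem eulerK_coeff (a : InvLaurent) (n : ℤ) : (eulerK a).coeff n = (-n : ℂ) * a.coeff n := rfl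

theorem isDeriv_eulerK : IsDeriv eulerK where
  add a b := by
    ext n
    rw [HahnSeries.coeff_add, eulerK_coeff, eulerK_coeff, eulerK_coeff, HahnSeries.coeff_add]
    ring
  mul a b := by
    have hs : ∀ c : InvLaurent, (eulerK c).support ⊆ c.support := by
      intro c n hn
      rw [HahnSeries.mem_support, eulerK_coeff] at hn
      exact right_ne_zero_of_mul hn
    ext n
    rw [HahnSeries.coeff_add, eulerK_coeff, HahnSeries.coeff_mul,
      HahnSeries.coeff_mul_left' a.isPWO_support (hs a),
      HahnSeries.coeff_mul_right' b.isPWO_support (hs b), Finset.mul_sum,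
      ← Finset.sum_add_distrib]
    refine Finset.sum_congr rfl fun ij hij => ?_
    have h : ((ij.1 : ℤ) : ℂ) + (ij.2 : ℤ) = n := by
      rw [← (Finset.mem_antidiagonal.mp hij).2.2]
      push_cast
      ring
    rw [eulerK_coeff, eulerK_coeff, ← h]
    ring

theorem eulerK_zmon (k : ℤ) (c : ℂ) : eulerK (zmon k c) = zmon k (k * c) := by
  ext n
  rw [eulerK_coeff, coeff_zmon, coeff_zmon]
  split_ifs with h
  · rw [h]; push_cast; ring
  · ring

/-! ### The principal Heisenberg subalgebra -/

/-- The exponents of either kind. -/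
def pexp : Bool → ℕ → PosExp
  | false, a => .odd a
  | true, s => .prime s

/-- The number of exponents of either kind in a period. -/
def nres (ℓ : ℕ) (b : Bool) : ℕ := if b then 1 else ℓ - 1

/-- The kind of an exponent. -/
def PosExp.kind : PosExp → Bool
  | .odd _ => false
  | .prime _ => true

theorem kind_pexp (b : Bool) (a : ℕ) : (pexp b a).kind = b := by cases b <;> rfl

theorem exists_pexp (j : PosExp) : ∃ b a, j = pexp b a := by
  cases j with
  | odd a => exact ⟨false, a, rfl⟩
  | prime s => exact ⟨true, s, rfl⟩

theorem cox_eq {ℓ : ℕ} (hℓ : 4 ≤ ℓ) : cox ℓ = 2 * (ℓ - 1) := by simp only [cox]; omega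

theorem nres_pos {ℓ : ℕ} (hℓ : 4 ≤ ℓ) (b : Bool) : 0 < nres ℓ b := by
  cases b <;> simp [nres]; omega

theorem val_pexp_shift {ℓ : ℕ} (hℓ : 4 ≤ ℓ) (b : Bool) (s r : ℕ) :
    (pexp b (nres ℓ b * s + r)).val ℓ = cox ℓ * s + (pexp b r).val ℓ := by
  cases b
  · simp only [pexp, nres, PosExp.val, cox_eq hℓ]
    simp
    ring
  · simp only [pexp, nres, PosExp.val]
    simp
    ring

theorem val_pexp_lt {ℓ : ℕ} (hℓ : 4 ≤ ℓ) {b : Bool} {r : ℕ} (hr : r < nres ℓ b) :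
    (pexp b r).val ℓ < cox ℓ := by
  have := cox_eq hℓ
  cases b
  · simp only [nres, Bool.false_eq_true, if_false] at hr
    simp only [pexp, PosExp.val]
    omega
  · simp only [nres, if_true] at hr
    obtain rfl : r = 0 := by omega
    simp only [pexp, PosExp.val]
    omega

/-- As h is even, the parity of h s + ℓ - 1 is that of ℓ - 1; this is where ℓ has to be even. -/
theorem odd_val {ℓ : ℕ} (hℓ : 4 ≤ ℓ) (he : Even ℓ) (j : PosExp) : Odd (j.val ℓ) := by
  cases j with
  | odd a => exact ⟨a, rfl⟩
  | prime s =>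
    obtain ⟨k, rfl⟩ := he
    refine ⟨(k + k - 1) * s + (k - 1), ?_⟩
    simp only [PosExp.val, cox_eq hℓ]
    zify [show 1 ≤ k + k by omega, show 1 ≤ k by omega]
    ring

theorem val_pos {ℓ : ℕ} (hℓ : 4 ≤ ℓ) (j : PosExp) : 0 < j.val ℓ := by
  cases j <;> simp only [PosExp.val] <;> omega

theorem val_prime {ℓ : ℕ} (hℓ : 4 ≤ ℓ) (s : ℕ) :
    (PosExp.prime s).val ℓ = (ℓ - 1) * (2 * s + 1) := by
  simp only [PosExp.val, cox_eq hℓ]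
  ring

theorem matrix_smul_eq_scal {ℓ : ℕ} (c : ℂ) (M : Mat ℓ InvLaurent) : c • M = scal (zmon 0 c) M := by
  ext1 i j
  rw [Matrix.smul_apply, smul_eq_zmon_mul]
  rfl

theorem heis_odd (ℓ a : ℕ) : heis ℓ (.odd a) =
    scal (zmon 0 ((Real.sqrt 2 : ℝ) : ℂ)) (Lam ℓ ^ (2 * a + 1)) := matrix_smul_eq_scal _ _

theorem heis_prime (ℓ s : ℕ) : heis ℓ (.prime s) =
    scal (zmon 0 ((Real.sqrt (2 * ℓ - 2) : ℝ) : ℂ)) (Gam ℓ ^ (2 * s + 1)) := matrix_smul_eq_scal _ _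

theorem sqrt_two_mul_self : ((Real.sqrt 2 : ℝ) : ℂ) * ((Real.sqrt 2 : ℝ) : ℂ) = 2 := by
  rw [← Complex.ofReal_mul, Real.mul_self_sqrt (by norm_num)]
  norm_num

theorem sqrt_cox_mul_self {ℓ : ℕ} (hℓ : 4 ≤ ℓ) :
    ((Real.sqrt (2 * ℓ - 2) : ℝ) : ℂ) * ((Real.sqrt (2 * ℓ - 2) : ℝ) : ℂ) = cox ℓ := by
  have : (4 : ℝ) ≤ ℓ := by exact_mod_cast hℓ
  rw [← Complex.ofReal_mul, Real.mul_self_sqrt (by linarith), cast_cox hℓ]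
  norm_num

/-- One factor M has to be kept, since M is not invertible and M^p itself is not a multiple of the
identity; hence the exponent k + 1. -/
theorem pow_add_mul_of_pow {n : Type*} [Fintype n] [DecidableEq n] {R : Type*} [CommRing R]
    {M : Matrix n n R} {z : R} {p : ℕ} (h : M ^ (p + 1) = scal z M) (s k : ℕ) :
    M ^ (p * s + (k + 1)) = scal (z ^ s) (M ^ (k + 1)) := by
  induction s with
  | zero => rw [mul_zero, zero_add, pow_zero, one_scal]
  | succ s ih =>
    rw [show p * (s + 1) + (k + 1) = p * s + (k + 1) + p by ring, pow_add, ih, scal_mul,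
      show M ^ (k + 1) * M ^ p = M ^ k * M ^ (p + 1) by rw [← pow_add, ← pow_add]; congr 1; ring,
      h, mul_scal, scal_scal, ← pow_succ, ← pow_succ]

theorem heis_shift {ℓ : ℕ} (hℓ : 4 ≤ ℓ) (b : Bool) (s r : ℕ) :
    heis ℓ (pexp b (nres ℓ b * s + r)) = scal (zmon s 1) (heis ℓ (pexp b r)) := by
  have hz : zmon 1 1 ^ s = zmon s 1 := by rw [zmon_pow, one_pow, mul_one]
  cases b
  · simp only [pexp, heis_odd]
    rw [show 2 * (nres ℓ false * s + r) + 1 = cox ℓ * s + (2 * r + 1) by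
      rw [cox_eq hℓ]; simp only [nres, Bool.false_eq_true, if_false]; ring,
      pow_add_mul_of_pow (Lam_pow_cox_add_one hℓ), hz, scal_scal, scal_scal, mul_comm (zmon 0 _)]
  · simp only [pexp, heis_prime]
    rw [show 2 * (nres ℓ true * s + r) + 1 = 2 * s + (2 * r + 1) by
      simp only [nres, if_true]; ring,
      pow_add_mul_of_pow (Gam_pow_three hℓ), hz, scal_scal, scal_scal, mul_comm (zmon 0 _)]

theorem heis_odd_mul_prime {ℓ : ℕ} (hℓ : 4 ≤ ℓ) (a s : ℕ) :
    heis ℓ (.odd a) * heis ℓ (.prime s) = 0 := by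
  rw [heis_odd, heis_prime, scal_mul, mul_scal, pow_succ (Lam ℓ), pow_succ' (Gam ℓ), mul_assoc,
    ← mul_assoc (Lam ℓ), Lam_mul_Gam hℓ, zero_mul, mul_zero, scal_zero, scal_zero]

theorem heis_prime_mul_odd {ℓ : ℕ} (hℓ : 4 ≤ ℓ) (a s : ℕ) :
    heis ℓ (.prime s) * heis ℓ (.odd a) = 0 := by
  rw [heis_odd, heis_prime, scal_mul, mul_scal, pow_succ (Gam ℓ), pow_succ' (Lam ℓ), mul_assoc,
    ← mul_assoc (Gam ℓ), Gam_mul_Lam hℓ, zero_mul, mul_zero, scal_zero, scal_zero]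

theorem heis_mul_comm {ℓ : ℕ} (hℓ : 4 ≤ ℓ) (i j : PosExp) :
    heis ℓ i * heis ℓ j = heis ℓ j * heis ℓ i := by
  cases i <;> cases j
  · rw [heis_odd, heis_odd, scal_mul, mul_scal, scal_mul, mul_scal, scal_scal, scal_scal,
      (Commute.pow_pow_self (Lam ℓ) _ _).eq]
  · rw [heis_odd_mul_prime hℓ, heis_prime_mul_odd hℓ]
  · rw [heis_odd_mul_prime hℓ, heis_prime_mul_odd hℓ]
  · rw [heis_prime, heis_prime, scal_mul, mul_scal, scal_mul, mul_scal, scal_scal, scal_scal,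
      (Commute.pow_pow_self (Gam ℓ) _ _).eq]

theorem zmon_zero_mul_self (c : ℂ) : zmon 0 c * zmon 0 c = zmon 0 (c * c) := by
  rw [zmon_mul_zmon, add_zero]

theorem zmon_zero_mul_zmon (c d : ℂ) (k : ℤ) : zmon 0 c * zmon k d = zmon k (c * d) := by
  rw [zmon_mul_zmon, zero_add]

/-! ### The trace form and the cocycle on the Heisenberg generators -/

theorem trace_heis_mul_heis {ℓ : ℕ} (hℓ : 4 ≤ ℓ) (i j : PosExp) :
    (heis ℓ i * heis ℓ j).trace =
      if i.kind = j.kind ∧ cox ℓ ∣ i.val ℓ + j.val ℓ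
      then zmon ((i.val ℓ + j.val ℓ) / cox ℓ : ℕ) (2 * cox ℓ) else 0 := by
  have hc := cox_pos hℓ
  cases i with
  | odd a =>
    cases j with
    | odd b =>
      rw [heis_odd, heis_odd, scal_mul, mul_scal, scal_scal, trace_scal, zmon_zero_mul_self,
        sqrt_two_mul_self, ← pow_add]
      simp only [PosExp.kind, PosExp.val, true_and]
      split_ifs with hd
      · obtain ⟨s, hs⟩ := hd
        rcases s with _ | s
        · omega
        rw [hs, trace_Lam_pow_mul_cox hℓ, zmon_zero_mul_zmon, Nat.mul_div_cancel_left _ hc]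
        push_cast
        rfl
      · rw [trace_Lam_pow_of_not_dvd hℓ hd, mul_zero]
    | prime s => rw [heis_odd_mul_prime hℓ, if_neg (by simp [PosExp.kind]), Matrix.trace_zero]
  | prime a =>
    cases j with
    | odd s => rw [heis_prime_mul_odd hℓ, if_neg (by simp [PosExp.kind]), Matrix.trace_zero]
    | prime b =>
      have e : (PosExp.prime a).val ℓ + (PosExp.prime b).val ℓ = cox ℓ * (a + b + 1) := by
        rw [val_prime hℓ, val_prime hℓ, cox_eq hℓ]; ring
      rw [heis_prime, heis_prime, scal_mul, mul_scal, scal_scal, trace_scal, zmon_zero_mul_self,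
        sqrt_cox_mul_self hℓ, ← pow_add, if_pos ⟨rfl, e ▸ dvd_mul_right _ _⟩, e,
        Nat.mul_div_cancel_left _ hc, show 2 * a + 1 + (2 * b + 1) = 2 * (a + b + 1) by ring,
        trace_Gam_pow hℓ, zmon_zero_mul_zmon, mul_comm]
      push_cast
      rfl

theorem zmon_natCast (n : ℕ) : zmon 0 n = n := by
  rw [zmon, neg_zero, ← HahnSeries.C_apply, map_natCast]

theorem eulerK_zmon_zero (c : ℂ) : eulerK (zmon 0 c) = 0 := by
  rw [eulerK_zmon, Int.cast_zero, zero_mul, zmon_zero]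

theorem map_eulerK_scal {ℓ : ℕ} (c : ℂ) (M : Mat ℓ InvLaurent) :
    (scal (zmon 0 c) M).map eulerK = scal (zmon 0 c) (M.map eulerK) :=
  isDeriv_eulerK.map_scal_of_const (eulerK_zmon_zero c) M

theorem trace_map_eulerK_pow_mul_pow {ℓ : ℕ} (M : Mat ℓ InvLaurent) {p q : ℕ} (hp : 0 < p)
    {k : ℤ} {c d : ℂ} (h : (M ^ (p + q)).trace = zmon k c) (hd : (p + q : ℕ) * d = p * (k * c)) :
    ((M ^ p).map eulerK * M ^ q).trace = zmon k d := by
  have h1 := isDeriv_eulerK.trace_map_pow_mul_pow M p q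
  rw [h, eulerK_zmon, ← zmon_natCast, ← zmon_natCast, zmon_zero_mul_zmon, ← hd,
    ← zmon_zero_mul_zmon] at h1
  exact mul_left_cancel₀ (zmon_ne_zero (Nat.cast_ne_zero.mpr (by omega))) h1

/-- For exponents of one kind this is the derivative of the trace of a power, shared out in the
proportion p : p + q. For different kinds it vanishes because Λ and Γ annihilate each other. -/
theorem trace_euler_heis_mul_heis {ℓ : ℕ} (hℓ : 4 ≤ ℓ) (i j : PosExp) :
    ((heis ℓ i).map eulerK * heis ℓ j).trace =
      if i.kind = j.kind ∧ cox ℓ ∣ i.val ℓ + j.val ℓ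
      then zmon ((i.val ℓ + j.val ℓ) / cox ℓ : ℕ) (2 * i.val ℓ) else 0 := by
  have hc := cox_pos hℓ
  have hc' : ((cox ℓ : ℕ) : ℂ) ≠ 0 := Nat.cast_ne_zero.mpr hc.ne'
  -- For a power of exponent at least 2, `trace_map_pow_mul` leaves a factor M N = 0. The first
  -- power of M is reached through M^{e+2} = z M: the term with z∂_z z meets M N = 0, and z can be
  -- cancelled.
  have hmix : ∀ {M N : Mat ℓ InvLaurent} {e : ℕ} (p q : ℕ), M ^ (e + 2) = scal (zmon 1 1) M →
      M * N = 0 → N * M = 0 → ((M ^ (p + 1)).map eulerK * N ^ (q + 1)).trace = 0 := by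
    intro M N e p q hM h1 h2
    have h3 : M * N ^ (q + 1) = 0 := by rw [pow_succ', ← mul_assoc, h1, zero_mul]
    have h4 : N ^ (q + 1) * M = 0 := by rw [pow_succ, mul_assoc, h2, mul_zero]
    have h5 : ∀ p, ((M ^ (p + 2)).map eulerK * N ^ (q + 1)).trace = 0 := by
      intro p
      rw [isDeriv_eulerK.trace_map_pow_mul M (p + 1) _ (by rw [h3, h4]), pow_succ, mul_assoc, h3,
        mul_zero, mul_zero, Matrix.trace_zero, mul_zero]
    rcases p with _ | p
    · have h6 : (scal (zmon 1 1) M).map eulerK =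
          scal (eulerK (zmon 1 1)) M + scal (zmon 1 1) (M.map eulerK) := by
        ext1 i j
        exact isDeriv_eulerK.mul _ _
      have h7 := h5 e
      rw [hM, h6, add_mul, scal_mul, scal_mul, h3, scal_zero, zero_add, trace_scal] at h7
      rw [zero_add, pow_one]
      exact (mul_eq_zero.mp h7).resolve_left (zmon_ne_zero one_ne_zero)
    · exact h5 p
  have hΛ : Lam ℓ ^ (cox ℓ - 1 + 2) = scal (zmon 1 1) (Lam ℓ) := by
    rw [show cox ℓ - 1 + 2 = cox ℓ + 1 by omega, Lam_pow_cox_add_one hℓ]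
  cases i with
  | odd a =>
    cases j with
    | odd b =>
      rw [heis_odd, heis_odd, map_eulerK_scal, scal_mul, mul_scal, scal_scal, trace_scal,
        zmon_zero_mul_self, sqrt_two_mul_self]
      simp only [PosExp.kind, PosExp.val, true_and]
      split_ifs with hd
      · obtain ⟨s, hs⟩ := hd
        rcases s with _ | s
        · omega
        rw [hs, Nat.mul_div_cancel_left _ hc,
          trace_map_eulerK_pow_mul_pow (k := s + 1) (c := cox ℓ) (d := (2 * a + 1 : ℕ)) _ (by omega),
          zmon_zero_mul_zmon]
        · push_cast
          rfl
        · rw [hs, trace_Lam_pow_mul_cox hℓ]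
        · rw [hs]
          push_cast
          ring
      · rw [trace_map_eulerK_pow_mul_pow (k := 0) (c := 0) (d := 0) _ (by omega), zmon_zero,
          mul_zero]
        · rw [trace_Lam_pow_of_not_dvd hℓ hd, zmon_zero]
        · simp
    | prime s =>
      rw [heis_odd, heis_prime, map_eulerK_scal, scal_mul, mul_scal, trace_scal, trace_scal,
        hmix _ _ hΛ (Lam_mul_Gam hℓ) (Gam_mul_Lam hℓ), if_neg (by simp [PosExp.kind]), mul_zero,
        mul_zero]
  | prime a =>
    cases j with
    | odd s =>
      rw [heis_odd, heis_prime, map_eulerK_scal, scal_mul, mul_scal, trace_scal, trace_scal,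
        hmix _ _ (Gam_pow_three hℓ) (Gam_mul_Lam hℓ) (Lam_mul_Gam hℓ), if_neg (by simp [PosExp.kind]), mul_zero,
        mul_zero]
    | prime b =>
      have e : (PosExp.prime a).val ℓ + (PosExp.prime b).val ℓ = cox ℓ * (a + b + 1) := by
        rw [val_prime hℓ, val_prime hℓ, cox_eq hℓ]; ring
      have e2 : ((cox ℓ : ℕ) : ℂ) = 2 * (ℓ - 1 : ℕ) := by rw [cox_eq hℓ]; push_cast; rfl
      rw [heis_prime, heis_prime, map_eulerK_scal, scal_mul, mul_scal, scal_scal, trace_scal,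
        zmon_zero_mul_self, sqrt_cox_mul_self hℓ, if_pos ⟨rfl, e ▸ dvd_mul_right _ _⟩, e,
        Nat.mul_div_cancel_left _ hc,
        trace_map_eulerK_pow_mul_pow (k := (a + b : ℕ) + 1) (c := 2) (d := (2 * a + 1 : ℕ)) _
          (by omega), zmon_zero_mul_zmon, val_prime hℓ, e2]
      · push_cast
        congr 1
        ring
      · rw [show 2 * a + 1 + (2 * b + 1) = 2 * (a + b + 1) by ring, trace_Gam_pow hℓ]
      · push_cast
        ring

end DrinfeldSokolovD

namespace DrinfeldSokolovD

/-! ### The matrices `D_j` -/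

theorem Dmat_eq (ℓ : ℕ) (j : PosExp) : Dmat ℓ j = scal (zmon (-(j.val ℓ : ℤ)) 1)
    ((Pmat ℓ)⁻¹ * (heis ℓ j).map (substPow (cox ℓ)) * Pmat ℓ) := rfl

theorem Pmat_mul_Dmat_mul {ℓ : ℕ} (hℓ : 4 ≤ ℓ) (j : PosExp) :
    Pmat ℓ * Dmat ℓ j * (Pmat ℓ)⁻¹ =
      scal (zmon (-(j.val ℓ : ℤ)) 1) ((heis ℓ j).map (substPow (cox ℓ))) := by
  rw [Dmat_eq, mul_scal, scal_mul, ← mul_assoc, ← mul_assoc,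
    Matrix.mul_nonsing_inv _ (isUnit_det_Pmat hℓ), one_mul,
    Matrix.mul_nonsing_inv_cancel_right _ _ (isUnit_det_Pmat hℓ)]

theorem Dmat_odd {ℓ : ℕ} (hℓ : 4 ≤ ℓ) (a : ℕ) : Dmat ℓ (.odd a) = Matrix.diagonal fun c =>
    if c.val < 2 * ℓ - 2 then
      zmon 0 (((Real.sqrt 2 : ℝ) : ℂ) * (omega ℓ ^ c.val) ^ (2 * a + 1)) else 0 := by
  rw [Dmat_eq, heis_odd, map_scal, map_pow_substPow, substPow_zmon (cox_pos hℓ), mul_zero,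
    mul_scal, scal_mul, scal_scal, zmon_mul_zmon]
  change scal _ (_ * lamZ ℓ ^ _ * _) = _
  rw [lamZ_pow_eq hℓ, mul_assoc, mul_assoc, Matrix.nonsing_inv_mul _ (isUnit_det_Pmat hℓ), mul_one,
    Matrix.nonsing_inv_mul_cancel_left _ _ (isUnit_det_Pmat hℓ), scal_diagonal]
  congr 1
  funext c
  simp only [Pi.pow_apply, lamEig, PosExp.val]
  split_ifs
  · rw [zmon_pow, zmon_mul_zmon]
    congr 1
    · push_cast; ring
    · ring
  · rw [zero_pow (by omega), mul_zero]

/-- A geometric sum of ratio ω^{2c}. In the given range the ratio is 1 only for c = 0 and c = ℓ - 1,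
where ω^c = ±1. Otherwise the sum vanishes because ω^{ch} = 1. -/
theorem sum_omega_pow_odd {ℓ : ℕ} (hℓ : 4 ≤ ℓ) {c : ℕ} (hc : c < 2 * ℓ - 2) :
    ∑ a ∈ Finset.range (ℓ - 1), (omega ℓ ^ c) ^ (2 * a + 1) =
      if c = 0 then (ℓ - 1 : ℂ) else if c = ℓ - 1 then -(ℓ - 1 : ℂ) else 0 := by
  have hω := isPrimitiveRoot_omega hℓ
  have hcast : ((ℓ - 1 : ℕ) : ℂ) = ℓ - 1 := by rw [Nat.cast_sub (by omega), Nat.cast_one]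
  have hsq : (omega ℓ ^ (ℓ - 1)) ^ 2 = 1 := by
    rw [← pow_mul, mul_comm, ← cox_eq hℓ, hω.pow_eq_one]
  have hm1 : omega ℓ ^ (ℓ - 1) = -1 := by
    rcases eq_or_eq_neg_of_sq_eq_sq _ 1 (hsq.trans (one_pow 2).symm) with h | h
    · have := (hω.pow_eq_one_iff_dvd _).mp h
      rw [cox_eq hℓ] at this
      have := Nat.le_of_dvd (by omega) this
      omega
    · exact h
  simp only [pow_add, pow_mul, pow_one]
  rw [← Finset.sum_mul]
  split_ifs with h1 h2
  · subst h1
    simp [hcast]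
  · subst h2
    rw [hm1]
    simp [hcast]
  · have hne : (omega ℓ ^ c) ^ 2 ≠ 1 := by
      intro h
      rw [← pow_mul, hω.pow_eq_one_iff_dvd, cox_eq hℓ] at h
      obtain ⟨k, hk⟩ := h
      rcases k with _ | _ | k
      · omega
      · omega
      · have : (ℓ - 1) * (k + 2) = c := by linarith
        have : (ℓ - 1) * 2 ≤ c := by rw [← this]; exact Nat.mul_le_mul_left _ (by omega)
        omega
    rw [geom_sum_eq hne, ← pow_mul, ← cox_eq hℓ, omega_pow_pow_cox hℓ, sub_self, zero_div, zero_mul]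

theorem sum_diagonal {n ι : Type*} [DecidableEq n] {R : Type*} [CommRing R] (s : Finset ι)
    (v : ι → n → R) :
    ∑ i ∈ s, Matrix.diagonal (v i) = Matrix.diagonal fun c => ∑ i ∈ s, v i c := by
  have h := map_sum (Matrix.diagonalAddMonoidHom n R) v s
  simp only [Matrix.diagonalAddMonoidHom_apply] at h
  rw [← h]
  congr 1
  funext c
  rw [Finset.sum_apply]

theorem Dtilde_eq {ℓ : ℕ} (hℓ : 4 ≤ ℓ) : Dtilde ℓ = Matrix.diagonal fun i =>
    if i.val = 0 then zmon 0 (((Real.sqrt 2 : ℝ) : ℂ) * (ℓ - 1))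
    else if i.val = ℓ - 1 then zmon 0 (-(((Real.sqrt 2 : ℝ) : ℂ) * (ℓ - 1))) else 0 := by
  rw [Dtilde, Finset.sum_congr rfl fun a _ => Dmat_odd hℓ a, sum_diagonal]
  congr 1
  funext c
  by_cases hc : c.val < 2 * ℓ - 2
  · simp only [if_pos hc]
    rw [← zmon_sum, ← Finset.mul_sum, sum_omega_pow_odd hℓ hc]
    split_ifs
    · rfl
    · rw [mul_neg]
    · rw [mul_zero, zmon_zero]
  · simp only [if_neg hc]
    rw [Finset.sum_const_zero, if_neg (by omega), if_neg (by omega)]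

/-! ### The principal gradation -/

/-- The principal height of a basis vector. -/
def height (ℓ : ℕ) (i : Fin (2 * ℓ)) : ℤ := if i.val < ℓ then i.val else i.val - 1

/-- A matrix loop which is homogeneous of degree `d` for the principal gradation. -/
def IsGraded {ℓ : ℕ} (d : ℤ) (M : Mat ℓ InvLaurent) : Prop :=
  ∀ r c n, (M r c).coeff n ≠ 0 → -n * (cox ℓ : ℤ) = d - height ℓ r + height ℓ c

theorem IsGraded.mul {ℓ : ℕ} {d e : ℤ} {M N : Mat ℓ InvLaurent} (hM : IsGraded d M)
    (hN : IsGraded e N) : IsGraded (d + e) (M * N) := by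
  intro r c n hn
  rw [Matrix.mul_apply, HahnSeries.coeff_sum] at hn
  obtain ⟨k, -, hk⟩ := Finset.exists_ne_zero_of_sum_ne_zero hn
  rw [HahnSeries.coeff_mul] at hk
  obtain ⟨ij, hij, hk⟩ := Finset.exists_ne_zero_of_sum_ne_zero hk
  have h1 := hM r k ij.1 (left_ne_zero_of_mul hk)
  have h2 := hN k c ij.2 (right_ne_zero_of_mul hk)
  have h3 := (Finset.mem_antidiagonal.mp hij).2.2
  rw [← h3]
  linear_combination h1 + h2

theorem IsGraded.pow_succ {ℓ : ℕ} {d : ℤ} {M : Mat ℓ InvLaurent} (hM : IsGraded d M) (k : ℕ) :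
    IsGraded (d * (k + 1 : ℕ)) (M ^ (k + 1)) := by
  induction k with
  | zero => simpa using hM
  | succ k ih =>
    rw [_root_.pow_succ, Nat.cast_succ, mul_add, mul_one]
    exact ih.mul hM

theorem IsGraded.scal_zmon_zero {ℓ : ℕ} {d : ℤ} {M : Mat ℓ InvLaurent} (hM : IsGraded d M)
    (a : ℂ) : IsGraded d (scal (zmon 0 a) M) := by
  intro r c n hn
  rw [scal_apply, coeff_zmon_mul, add_zero] at hn
  exact hM r c n (right_ne_zero_of_mul hn)

theorem height_of_lt {ℓ : ℕ} {i : Fin (2 * ℓ)} (h : i.val < ℓ) : height ℓ i = i.val := if_pos h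

theorem height_of_not_lt {ℓ : ℕ} {i : Fin (2 * ℓ)} (h : ¬ i.val < ℓ) :
    height ℓ i = i.val - 1 := if_neg h

theorem unit_ne_zero {ℓ a b : ℕ} {i j : Fin (2 * ℓ)} (h : unit ℓ a b i j ≠ 0) :
    i.val + 1 = a ∧ j.val + 1 = b := by
  by_contra hne
  exact h (if_neg hne)

/-- Rows ℓ and ℓ+1, counted from 1, have equal height. Every E_i with i ≥ 1 raises the height by
one, and E_0 lowers it by h - 1, which the degree h of z compensates. -/
theorem isGraded_Lam {ℓ : ℕ} (hℓ : 4 ≤ ℓ) : IsGraded 1 (Lam ℓ) := by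
  have hc : (cox ℓ : ℤ) = 2 * ℓ - 2 := by simp only [cox]; omega
  intro r c n hn
  have hr := r.isLt
  have hcl := c.isLt
  have key : ∀ {k : ℤ} {x : ℂ}, (zmon k x).coeff n ≠ 0 → n = -k ∧ x ≠ 0 := by
    intro k x h
    rw [coeff_zmon] at h
    exact ⟨by by_contra h'; exact h (if_neg h'), fun h' => h (by rw [h', ite_self])⟩
  rw [Lam, Matrix.add_apply, Matrix.map_apply, Matrix.map_apply, HahnSeries.coeff_add] at hn
  by_cases h1 : (zmon 1 (genE0 ℓ r c)).coeff n = 0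
  · rw [h1, zero_add] at hn
    obtain ⟨rfl, h2⟩ := key hn
    rw [Matrix.sum_apply] at h2
    obtain ⟨k, hk, h3⟩ := Finset.exists_ne_zero_of_sum_ne_zero h2
    rw [Finset.mem_Icc] at hk
    have h4 : height ℓ r = height ℓ c + 1 := by
      rw [genE] at h3
      split_ifs at h3 with hkl
      · rw [Matrix.smul_apply] at h3
        have h3 := right_ne_zero_of_smul h3
        rw [Matrix.add_apply] at h3
        have h5 : unit ℓ (ℓ + 1) (ℓ - 1) r c ≠ 0 ∨ unit ℓ (ℓ + 2) ℓ r c ≠ 0 := by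
          by_contra h
          push Not at h
          exact h3 (by rw [h.1, h.2, add_zero])
        rcases h5 with h5 | h5 <;> obtain ⟨h6, h7⟩ := unit_ne_zero h5
        · rw [height_of_not_lt (by omega), height_of_lt (by omega)]; omega
        · rw [height_of_not_lt (by omega), height_of_lt (by omega)]; omega
      · rw [Matrix.add_apply] at h3
        have h5 : unit ℓ (k + 1) k r c ≠ 0 ∨ unit ℓ (2 * ℓ + 1 - k) (2 * ℓ - k) r c ≠ 0 := by
          by_contra h
          push Not at h
          exact h3 (by rw [h.1, h.2, add_zero])
        rcases h5 with h5 | h5 <;> obtain ⟨h6, h7⟩ := unit_ne_zero h5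
        · rw [height_of_lt (by omega), height_of_lt (by omega)]; omega
        · rw [height_of_not_lt (by omega), height_of_not_lt (by omega)]; omega
    rw [h4]
    ring
  · obtain ⟨rfl, h2⟩ := key h1
    rw [genE0, Matrix.smul_apply] at h2
    have h3 := right_ne_zero_of_smul h2
    rw [Matrix.add_apply] at h3
    have h5 : unit ℓ 1 (2 * ℓ - 1) r c ≠ 0 ∨ unit ℓ 2 (2 * ℓ) r c ≠ 0 := by
      by_contra h
      push Not at h
      exact h3 (by rw [h.1, h.2, add_zero])
    rw [hc]
    rcases h5 with h5 | h5 <;> obtain ⟨h6, h7⟩ := unit_ne_zero h5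
    · rw [height_of_lt (by omega), height_of_not_lt (by omega)]; omega
    · rw [height_of_lt (by omega), height_of_not_lt (by omega)]; omega

theorem isGraded_Gam {ℓ : ℕ} (hℓ : 4 ≤ ℓ) : IsGraded (ℓ - 1) (Gam ℓ) := by
  have hc : (cox ℓ : ℤ) = 2 * ℓ - 2 := by simp only [cox]; omega
  intro r c n hn
  have hr := r.isLt
  have hcl := c.isLt
  have key : ∀ {k : ℤ} {x : ℂ}, (zmon k x).coeff n ≠ 0 → n = -k ∧ x ≠ 0 := by
    intro k x h
    rw [coeff_zmon] at h
    exact ⟨by by_contra h'; exact h (if_neg h'), fun h' => h (by rw [h', ite_self])⟩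
  have or4 : ∀ {x y z w : ℂ}, x + y + z + w ≠ 0 → x ≠ 0 ∨ y ≠ 0 ∨ z ≠ 0 ∨ w ≠ 0 := by
    intro x y z w h
    by_contra h'
    push Not at h'
    exact h (by rw [h'.1, h'.2.1, h'.2.2.1, h'.2.2.2]; ring)
  rw [Gam, Matrix.neg_apply, Matrix.add_apply, Matrix.map_apply, Matrix.map_apply,
    HahnSeries.coeff_neg, HahnSeries.coeff_add] at hn
  have hn := neg_ne_zero.mp hn
  set A := (unit ℓ ℓ 1 - (1 / 2 : ℂ) • unit ℓ (ℓ + 1) 1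
        + unit ℓ (2 * ℓ) (ℓ + 1) - (1 / 2 : ℂ) • unit ℓ (2 * ℓ) ℓ) r c with hA
  by_cases h1 : (zmon 0 A).coeff n = 0
  · rw [h1, zero_add] at hn
    obtain ⟨rfl, h2⟩ := key hn
    simp only [Matrix.add_apply, Matrix.smul_apply, smul_eq_mul, sub_eq_add_neg] at h2
    rw [hc]
    rcases or4 h2 with h | h | h | h
    · obtain ⟨h6, h7⟩ := unit_ne_zero (right_ne_zero_of_mul h)
      rw [height_of_lt (by omega), height_of_not_lt (by omega)]; omega
    · obtain ⟨h6, h7⟩ := unit_ne_zero (right_ne_zero_of_mul h)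
      rw [height_of_not_lt (by omega), height_of_not_lt (by omega)]; omega
    · obtain ⟨h6, h7⟩ := unit_ne_zero (right_ne_zero_of_mul (neg_ne_zero.mp h))
      rw [height_of_lt (by omega), height_of_not_lt (by omega)]; omega
    · obtain ⟨h6, h7⟩ := unit_ne_zero (right_ne_zero_of_mul h)
      rw [height_of_lt (by omega), height_of_lt (by omega)]; omega
  · obtain ⟨rfl, h2⟩ := key h1
    simp only [hA, Matrix.add_apply, Matrix.sub_apply, Matrix.smul_apply, smul_eq_mul,
      sub_eq_add_neg] at h2
    rw [neg_zero, neg_zero, zero_mul]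
    rcases or4 h2 with h | h | h | h
    · obtain ⟨h6, h7⟩ := unit_ne_zero h
      rw [height_of_lt (by omega), height_of_lt (by omega)]; omega
    · obtain ⟨h6, h7⟩ := unit_ne_zero (right_ne_zero_of_mul (neg_ne_zero.mp h))
      rw [height_of_not_lt (by omega), height_of_lt (by omega)]; omega
    · obtain ⟨h6, h7⟩ := unit_ne_zero h
      rw [height_of_not_lt (by omega), height_of_not_lt (by omega)]; omega
    · obtain ⟨h6, h7⟩ := unit_ne_zero (right_ne_zero_of_mul (neg_ne_zero.mp h))
      rw [height_of_not_lt (by omega), height_of_lt (by omega)]; omega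

theorem isGraded_heis {ℓ : ℕ} (hℓ : 4 ≤ ℓ) (j : PosExp) : IsGraded (j.val ℓ) (heis ℓ j) := by
  cases j with
  | odd a =>
    have h := ((isGraded_Lam hℓ).pow_succ (2 * a)).scal_zmon_zero ((Real.sqrt 2 : ℝ) : ℂ)
    rw [heis_odd]
    rwa [one_mul] at h
  | prime s =>
    have h := ((isGraded_Gam hℓ).pow_succ (2 * s)).scal_zmon_zero ((Real.sqrt (2 * ℓ - 2) : ℝ) : ℂ)
    rw [heis_prime, val_prime hℓ]
    rwa [show ((ℓ : ℤ) - 1) * ((2 * s + 1 : ℕ) : ℤ) = (((ℓ - 1) * (2 * s + 1) : ℕ) : ℤ) by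
      push_cast [Nat.cast_sub (show 1 ≤ ℓ by omega)]; ring] at h

/-- A diagonal entry has degree a multiple of the even number h, whereas the exponent is odd. -/
theorem heis_diag_eq_zero {ℓ : ℕ} (hℓ : 4 ≤ ℓ) (he : Even ℓ) (j : PosExp) (i : Fin (2 * ℓ)) :
    heis ℓ j i i = 0 := by
  ext n
  by_contra hn
  have h := isGraded_heis hℓ j i i n hn
  have h2 := odd_val hℓ he j
  rw [sub_add_cancel, cox_eq hℓ] at h
  rw [← Int.odd_coe_nat, ← h, Int.odd_mul] at h2
  exact Int.not_even_iff_odd.mpr h2.2 (by push_cast; exact even_two_mul _)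

/-- An exponent below h and heights between 0 and h force the degree of a power of z to be less than
2h, so no power beyond z¹ occurs. Hence z⁻¹ R_j is a power series in 1/z. -/
theorem heis_coeff_eq_zero {ℓ : ℕ} (hℓ : 4 ≤ ℓ) {b : Bool} {r : ℕ} (hr : r < nres ℓ b)
    (i k : Fin (2 * ℓ)) {n : ℤ} (hn : n < -1) : (heis ℓ (pexp b r) i k).coeff n = 0 := by
  by_contra h
  have h1 := isGraded_heis hℓ _ i k n h
  have h2 := val_pexp_lt hℓ hr
  have hi : 0 ≤ height ℓ i := by rw [height]; split_ifs <;> omega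
  have hk : height ℓ k ≤ cox ℓ := by
    have := k.isLt
    rw [height, cox]; split_ifs <;> omega
  nlinarith [cox_pos hℓ]

end DrinfeldSokolovD

namespace DrinfeldSokolovD

/-! ### Derivatives of powers in a noncommutative ring -/

section Powers

variable {A : Type*} [Ring A]

/-- The operator `z ↦ z x - x z`. -/
def negAd (x z : A) : A := z * x - x * z

/-- Right multiplication by x is left multiplication by x plus `negAd x`. These two operators
commute, so the binomial theorem applies. -/
theorem mul_pow_eq_sum_negAd (x z : A) (M : ℕ) :
    z * x ^ M = ∑ n ∈ Finset.range (M + 1), M.choose n • (x ^ (M - n) * (negAd x)^[n] z) := by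
  have hc : Commute (LinearMap.mulRight ℤ x - LinearMap.mulLeft ℤ x) (LinearMap.mulLeft ℤ x) :=
    Commute.sub_left (LinearMap.ext fun z => mul_assoc x z x) (Commute.refl _)
  have h1 := hc.add_pow M
  rw [sub_add_cancel, LinearMap.pow_mulRight] at h1
  have h2 := congrArg (fun f : A →ₗ[ℤ] A => f z) h1
  have h3 : ∀ n, ((LinearMap.mulRight ℤ x - LinearMap.mulLeft ℤ x) ^ n : A →ₗ[ℤ] A) z =
      (negAd x)^[n] z := by
    intro n
    rw [Module.End.pow_apply]
    rfl
  simp only [LinearMap.mulRight_apply, LinearMap.sum_apply] at h2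
  rw [h2]
  refine Finset.sum_congr rfl fun n _ => ?_
  rw [hc.pow_pow n (M - n), LinearMap.pow_mulLeft, ← h3, Module.End.mul_apply, Module.End.mul_apply,
    LinearMap.mulLeft_apply, ← nsmul_one, LinearMap.smul_apply, Module.End.one_apply, map_nsmul,
    mul_smul_comm]

/-- Induction with all factors x moved to the left; the coefficients add up by Pascal's rule. This
is the degree-by-degree form of exp(-x) D(exp x) = ∑ (-ad x)^n D(x) / (n+1)!. -/
theorem leibniz_pow_eq_sum_negAd {D : A → A} (hmul : ∀ a b, D (a * b) = D a * b + a * D b) (x : A)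
    (N : ℕ) : D (x ^ (N + 1)) =
      ∑ n ∈ Finset.range (N + 1), (N + 1).choose (n + 1) • (x ^ (N - n) * (negAd x)^[n] (D x)) := by
  induction N with
  | zero => simp
  | succ N ih =>
    rw [pow_succ' x (N + 1), hmul, ih, mul_pow_eq_sum_negAd, Finset.sum_range_succ,
      Finset.sum_range_succ _ (N + 1), Finset.mul_sum, add_right_comm, ← Finset.sum_add_distrib]
    congr 1
    · refine Finset.sum_congr rfl fun n hn => ?_
      have hn' : n ≤ N := Nat.lt_succ_iff.mp (Finset.mem_range.mp hn)
      rw [mul_smul_comm, ← mul_assoc, ← pow_succ', show N - n + 1 = N + 1 - n by omega, ← add_smul,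
        Nat.choose_succ_succ (N + 1) n]
    · simp

end Powers

/-! ### The filtration of loops by the degree in `1/z` -/

/-- Only powers `z ^ k` with `k ≤ -M` occur in `f`. -/
def OrdGe (M : ℤ) (f : TSeries InvLaurent) : Prop :=
  ∀ T, ∀ n < M, (MvPowerSeries.coeff T f).coeff n = 0

namespace OrdGe

variable {M N : ℤ} {f g : TSeries InvLaurent}

theorem mono (hf : OrdGe M f) (h : N ≤ M) : OrdGe N f := fun T n hn => hf T n (by omega)

theorem zero : OrdGe M 0 := fun T n _ => by simp

theorem add (hf : OrdGe M f) (hg : OrdGe M g) : OrdGe M (f + g) := fun T n hn => by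
  rw [_root_.map_add, HahnSeries.coeff_add, hf T n hn, hg T n hn, add_zero]

theorem neg (hf : OrdGe M f) : OrdGe M (-f) := fun T n hn => by
  rw [_root_.map_neg, HahnSeries.coeff_neg, hf T n hn, neg_zero]

theorem sub (hf : OrdGe M f) (hg : OrdGe M g) : OrdGe M (f - g) := by
  rw [sub_eq_add_neg]; exact hf.add hg.neg

theorem sum {ι : Type*} {s : Finset ι} {f : ι → TSeries InvLaurent}
    (h : ∀ i ∈ s, OrdGe M (f i)) : OrdGe M (∑ i ∈ s, f i) :=
  Finset.sum_induction f (OrdGe M) (fun _ _ => add) zero h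

theorem mul (hf : OrdGe M f) (hg : OrdGe N g) : OrdGe (M + N) (f * g) := fun T n hn => by
  classical
  rw [MvPowerSeries.coeff_mul]
  have h : ∀ a b : InvLaurent, (∀ k < M, a.coeff k = 0) → (∀ k < N, b.coeff k = 0) →
      (a * b).coeff n = 0 := by
    intro a b ha hb
    rw [HahnSeries.coeff_mul]
    refine Finset.sum_eq_zero fun ij hij => ?_
    have h3 := (Finset.mem_antidiagonal.mp hij).2.2
    rcases lt_or_ge ij.1 M with h1 | h1
    · rw [ha _ h1, zero_mul]
    · rw [hb _ (by omega), mul_zero]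
  have hs : ∀ s : Finset ((PosExp →₀ ℕ) × (PosExp →₀ ℕ)),
      (∑ p ∈ s, MvPowerSeries.coeff p.1 f * MvPowerSeries.coeff p.2 g).coeff n = 0 := by
    intro s
    induction s using Finset.induction_on with
    | empty => simp
    | insert a s ha ih =>
      rw [Finset.sum_insert ha, HahnSeries.coeff_add, ih, add_zero]
      exact h _ _ (hf _) (hg _)
  exact hs _

theorem C {a : InvLaurent} (h : ∀ n < M, a.coeff n = 0) : OrdGe M (MvPowerSeries.C a) :=
  fun T n hn => by
    classical
    rw [MvPowerSeries.coeff_C]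
    split_ifs
    · exact h n hn
    · rfl

theorem euler (hf : OrdGe M f) : OrdGe M (coeffwise eulerK f) := fun T n hn => by
  change (eulerK (MvPowerSeries.coeff T f)).coeff n = 0
  rw [eulerK_coeff, hf T n hn, mul_zero]

end OrdGe

/-- The filtration on matrices. -/
def MatOrdGe {ℓ : ℕ} (M : ℤ) (A : Loop ℓ) : Prop := ∀ i j, OrdGe M (A i j)

namespace MatOrdGe

variable {ℓ : ℕ} {M N : ℤ} {A B : Loop ℓ}

theorem mono (h : MatOrdGe M A) (hN : N ≤ M) : MatOrdGe N A := fun i j => (h i j).mono hN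

theorem add (hA : MatOrdGe M A) (hB : MatOrdGe M B) : MatOrdGe M (A + B) :=
  fun i j => (hA i j).add (hB i j)

theorem neg (hA : MatOrdGe M A) : MatOrdGe M (-A) := fun i j => (hA i j).neg

theorem sub (hA : MatOrdGe M A) (hB : MatOrdGe M B) : MatOrdGe M (A - B) :=
  fun i j => (hA i j).sub (hB i j)

theorem zero : MatOrdGe M (0 : Loop ℓ) := fun _ _ => OrdGe.zero

theorem sum {ι : Type*} {s : Finset ι} {f : ι → Loop ℓ}
    (h : ∀ i ∈ s, MatOrdGe M (f i)) : MatOrdGe M (∑ i ∈ s, f i) :=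
  Finset.sum_induction f (MatOrdGe M) (fun _ _ => add) zero h

theorem mul (hA : MatOrdGe M A) (hB : MatOrdGe N B) : MatOrdGe (M + N) (A * B) := fun i j => by
  rw [Matrix.mul_apply]
  exact OrdGe.sum fun k _ => (hA i k).mul (hB k j)

theorem one : MatOrdGe 0 (1 : Loop ℓ) := fun i j => by
  classical
  rw [Matrix.one_apply]
  split_ifs
  · exact OrdGe.C (a := 1) fun n hn => by rw [HahnSeries.coeff_one, if_neg hn.ne]
  · exact OrdGe.zero

theorem pow (hA : MatOrdGe M A) (n : ℕ) : MatOrdGe (n * M) (A ^ n) := by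
  induction n with
  | zero => simpa using one
  | succ n ih =>
    rw [pow_succ]
    have h := ih.mul hA
    rwa [show (n : ℤ) * M + M = ((n + 1 : ℕ) : ℤ) * M by push_cast; ring] at h

theorem scal {a : TSeries InvLaurent} (ha : OrdGe M a) (hA : MatOrdGe N A) :
    MatOrdGe (M + N) (scal a A) := fun i j => ha.mul (hA i j)

theorem euler (hA : MatOrdGe M A) : MatOrdGe M (euler A) := fun i j => (hA i j).euler

theorem trace (hA : MatOrdGe M A) : OrdGe M (Matrix.trace A) := OrdGe.sum fun i _ => hA i i

theorem negAd_iterate (hA : MatOrdGe 1 A) (hB : MatOrdGe N B) (n : ℕ) :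
    MatOrdGe (N + n) ((negAd A)^[n] B) := by
  induction n with
  | zero => simpa using hB
  | succ n ih =>
    rw [Function.iterate_succ_apply']
    have h1 := ih.mul hA
    have h2 := hA.mul ih
    rw [show (1 : ℤ) + (N + n) = N + n + 1 by ring] at h2
    have h3 := h1.sub h2
    push_cast
    rw [← add_assoc]
    exact h3

end MatOrdGe

theorem exists_ordGe_constLoop {ℓ : ℕ} (A : Mat ℓ InvLaurent) :
    ∃ d : ℕ, MatOrdGe (-d) (constLoop A) := by
  have h : ∀ a : InvLaurent, ∃ d : ℕ, ∀ n : ℤ, n < -d → a.coeff n = 0 := by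
    intro a
    refine ⟨(-a.order).toNat, fun n hn => HahnSeries.coeff_eq_zero_of_lt_order ?_⟩
    omega
  choose d hd using fun i j => h (A i j)
  refine ⟨∑ i, ∑ j, d i j, fun i j => OrdGe.C fun n hn => hd i j n ?_⟩
  have h1 : d i j ≤ ∑ j, d i j := Finset.single_le_sum (f := fun j => d i j)
    (fun _ _ => Nat.zero_le _) (Finset.mem_univ j)
  have h2 : ∑ j, d i j ≤ ∑ i, ∑ j, d i j := Finset.single_le_sum (f := fun i => ∑ j, d i j)
    (fun _ _ => Nat.zero_le _) (Finset.mem_univ i)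
  omega

/-! ### Derivations of series in the times -/

theorem coeff_coeffwise {σ R S : Type} [Semiring R] [Semiring S] (φ : R → S)
    (f : MvPowerSeries σ R) (T : σ →₀ ℕ) :
    MvPowerSeries.coeff T (coeffwise φ f) = φ (MvPowerSeries.coeff T f) := rfl

theorem isDeriv_coeffwise {σ R : Type} [CommRing R] {φ : R → R} (hφ : IsDeriv φ) :
    IsDeriv (coeffwise φ : MvPowerSeries σ R → MvPowerSeries σ R) where
  add f g := by
    ext T
    simp only [coeff_coeffwise, map_add, hφ.add]
  mul f g := by
    classical
    ext T
    rw [coeff_coeffwise, map_add, MvPowerSeries.coeff_mul, MvPowerSeries.coeff_mul,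
      MvPowerSeries.coeff_mul, hφ.sum, ← Finset.sum_add_distrib]
    refine Finset.sum_congr rfl fun p _ => ?_
    rw [hφ.mul, coeff_coeffwise, coeff_coeffwise]

theorem isDeriv_pderiv {σ R : Type} [CommRing R] (j : σ) :
    IsDeriv (MvPowerSeries.pderiv R j) where
  add f g := map_add _ f g
  mul f g := by
    rw [Derivation.leibniz, smul_eq_mul, smul_eq_mul]
    ring

theorem isDeriv_euler : IsDeriv (coeffwise eulerK : TSeries InvLaurent → TSeries InvLaurent) :=
  isDeriv_coeffwise isDeriv_eulerK

theorem pderiv_coeffwise {σ R : Type} [CommRing R] {φ : R → R} (hφ : IsDeriv φ) (j : σ)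
    (f : MvPowerSeries σ R) : MvPowerSeries.pderiv R j (coeffwise φ f) =
      coeffwise φ (MvPowerSeries.pderiv R j f) := by
  ext T
  rw [MvPowerSeries.coeff_pderiv, coeff_coeffwise, coeff_coeffwise, MvPowerSeries.coeff_pderiv,
    mul_comm, mul_comm (MvPowerSeries.coeff _ f)]
  exact_mod_cast (hφ.natCast_mul (T j + 1) _).symm

end DrinfeldSokolovD

namespace DrinfeldSokolovD

/-! ### The group element -/

/-- The inclusion of the power series in `1/z` into the Laurent series. -/
def laur : TSeries (PowerSeries ℂ) →+* TSeries InvLaurent :=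
  MvPowerSeries.map (HahnSeries.ofPowerSeries ℤ ℂ)

theorem toLoop_eq {ℓ : ℕ} (A : Mat ℓ (TSeries (PowerSeries ℂ))) :
    toLoop A = laur.mapMatrix A := rfl

theorem laur_coeff (f : TSeries (PowerSeries ℂ)) (T : PosExp →₀ ℕ) (n : ℕ) :
    (MvPowerSeries.coeff T (laur f)).coeff n = PowerSeries.coeff n (MvPowerSeries.coeff T f) := by
  rw [laur, MvPowerSeries.coeff_map, HahnSeries.ofPowerSeries_apply_coeff]

theorem ordGe_laur (f : TSeries (PowerSeries ℂ)) : OrdGe 0 (laur f) := fun T n hn => by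
  rw [laur, MvPowerSeries.coeff_map, HahnSeries.ofPowerSeries_apply]
  refine HahnSeries.embDomain_of_notMem_range ?_
  rintro ⟨k, hk⟩
  have : (k : ℤ) = n := hk
  omega

theorem matOrdGe_toLoop {ℓ : ℕ} (A : Mat ℓ (TSeries (PowerSeries ℂ))) : MatOrdGe 0 (toLoop A) :=
  fun _ _ => ordGe_laur _

/-- The constant series `c`. -/
def cst (c : ℂ) : TSeries InvLaurent := MvPowerSeries.C (zmon 0 c)

theorem coeff_cst_mul (c : ℂ) (f : TSeries InvLaurent) (T : PosExp →₀ ℕ) (n : ℤ) :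
    (MvPowerSeries.coeff T (cst c * f)).coeff n = c * (MvPowerSeries.coeff T f).coeff n := by
  rw [cst, MvPowerSeries.coeff_C_mul, coeff_zmon_mul, add_zero]

theorem cst_mul_cst (c d : ℂ) : cst c * cst d = cst (c * d) := by
  rw [cst, cst, cst, ← map_mul, zmon_zero_mul_zmon]

theorem cst_natCast (n : ℕ) : cst n = n := by
  rw [cst, zmon_natCast, map_natCast]

theorem ordGe_cst (c : ℂ) : OrdGe 0 (cst c) := OrdGe.C fun n hn => by
  rw [coeff_zmon, if_neg (by omega)]

theorem euler_cst (c : ℂ) : coeffwise eulerK (cst c) = 0 := by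
  classical
  ext1 T
  rw [coeff_coeffwise, cst, MvPowerSeries.coeff_C]
  split_ifs
  · rw [eulerK_zmon_zero, map_zero]
  · rw [isDeriv_eulerK.zero, map_zero]

section Theta

variable {ℓ : ℕ} {ξ : Mat ℓ (TSeries (PowerSeries ℂ))}

theorem matOrdGe_one (hneg : IsNegative ξ) : MatOrdGe 1 (toLoop ξ) := fun i j T n hn => by
  rcases lt_or_ge n 0 with h | h
  · exact ordGe_laur _ T n h
  · obtain rfl : n = ((0 : ℕ) : ℤ) := by push_cast; omega
    have h1 := congrFun (congrFun (hneg T).1 i) j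
    exact (laur_coeff (ξ i j) T 0).trans h1

theorem toLoop_pow (n : ℕ) : toLoop (ξ ^ n) = toLoop ξ ^ n := by
  rw [toLoop_eq, toLoop_eq, map_pow]

theorem coeff_pow_eq_zero (hneg : IsNegative ξ) {n k : ℕ} (h : k < n) (i j : Fin (2 * ℓ))
    (T : PosExp →₀ ℕ) : PowerSeries.coeff k (MvPowerSeries.coeff T ((ξ ^ n) i j)) = 0 := by
  have h1 := (matOrdGe_one hneg).pow n i j T k (by omega)
  rw [← toLoop_pow, toLoop_eq, RingHom.mapMatrix_apply, Matrix.map_apply, laur_coeff] at h1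
  exact h1

theorem coeff_negExp (hneg : IsNegative ξ) {M k : ℕ} (h : k < M) (i j : Fin (2 * ℓ))
    (T : PosExp →₀ ℕ) : PowerSeries.coeff k (MvPowerSeries.coeff T (negExp ξ i j)) =
      ∑ n ∈ Finset.range M, ((n.factorial : ℂ))⁻¹ *
        PowerSeries.coeff k (MvPowerSeries.coeff T ((ξ ^ n) i j)) := by
  have e : MvPowerSeries.coeff T (negExp ξ i j) = PowerSeries.mk fun k =>
    ∑ᶠ n : ℕ, ((n.factorial : ℂ))⁻¹ *
      PowerSeries.coeff k (MvPowerSeries.coeff T ((ξ ^ n) i j)) := rfl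
  rw [e, PowerSeries.coeff_mk]
  refine finsum_eq_sum_of_support_subset _ fun n hn => ?_
  rw [Finset.coe_range, Set.mem_Iio]
  by_contra h1
  exact hn (mul_eq_zero_of_right _ (coeff_pow_eq_zero hneg (by omega) i j T))

/-- The partial sums of the exponential series. -/
def expSum (x : Loop ℓ) (M : ℕ) : Loop ℓ :=
  ∑ n ∈ Finset.range M, scal (cst ((n.factorial : ℂ))⁻¹) (x ^ n)

theorem coeff_sum_coeff {ι : Type*} (s : Finset ι) (f : ι → TSeries InvLaurent) (T : PosExp →₀ ℕ)
    (n : ℤ) : (MvPowerSeries.coeff T (∑ i ∈ s, f i)).coeff n =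
      ∑ i ∈ s, (MvPowerSeries.coeff T (f i)).coeff n := by
  classical
  induction s using Finset.induction_on with
  | empty => simp
  | insert a s ha ih =>
    rw [Finset.sum_insert ha, Finset.sum_insert ha, map_add, HahnSeries.coeff_add, ih]

/-- The n-th term of exp ξ has order at least n in 1/z. So Θ can be replaced by a finite sum modulo
any given power of 1/z. -/
theorem matOrdGe_Theta_sub (hneg : IsNegative ξ) (M : ℕ) :
    MatOrdGe M (Theta ξ - expSum (toLoop ξ) M) := fun i j T n hn => by
  rcases lt_or_ge n 0 with h | h
  · refine ((matOrdGe_toLoop (negExp ξ)).sub (MatOrdGe.sum fun k _ => ?_)) i j T n h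
    rw [← toLoop_pow]
    exact MatOrdGe.scal (ordGe_cst _) (matOrdGe_toLoop (ξ ^ k))
  · lift n to ℕ using h
    rw [Matrix.sub_apply, map_sub, HahnSeries.coeff_sub, expSum, Matrix.sum_apply,
      coeff_sum_coeff, Theta, toLoop_eq, RingHom.mapMatrix_apply, Matrix.map_apply, laur_coeff,
      coeff_negExp hneg (M := M) (by omega), sub_eq_zero]
    refine Finset.sum_congr rfl fun k _ => ?_
    rw [scal_apply, coeff_cst_mul, ← toLoop_pow, toLoop_eq, RingHom.mapMatrix_apply,
      Matrix.map_apply, laur_coeff]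

/-- At zero times and 1/z = 0 the exponential is the identity matrix. -/
theorem isUnit_det_negExp (hneg : IsNegative ξ) : IsUnit (negExp ξ).det := by
  rw [MvPowerSeries.isUnit_iff_constantCoeff, PowerSeries.isUnit_iff_constantCoeff]
  have h : (negExp ξ).map ((PowerSeries.constantCoeff (R := ℂ)).comp
      (MvPowerSeries.constantCoeff (σ := PosExp) (R := PowerSeries ℂ))) = 1 := by
    ext i j
    rw [Matrix.map_apply]
    have h1 := coeff_negExp hneg (M := 1) zero_lt_one i j 0
    rw [Finset.sum_range_one, pow_zero] at h1
    rw [RingHom.comp_apply, ← MvPowerSeries.coeff_zero_eq_constantCoeff_apply,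
      ← PowerSeries.coeff_zero_eq_constantCoeff_apply, h1, Matrix.one_apply, Matrix.one_apply]
    split_ifs <;> simp
  have h2 := RingHom.map_det ((PowerSeries.constantCoeff (R := ℂ)).comp
      (MvPowerSeries.constantCoeff (σ := PosExp) (R := PowerSeries ℂ))) (negExp ξ)
  rw [RingHom.mapMatrix_apply, h, Matrix.det_one] at h2
  change IsUnit (((PowerSeries.constantCoeff (R := ℂ)).comp
      (MvPowerSeries.constantCoeff (σ := PosExp) (R := PowerSeries ℂ))) (negExp ξ).det)
  rw [h2]
  exact isUnit_one

theorem isUnit_det_Theta (hneg : IsNegative ξ) : IsUnit (Theta ξ).det := by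
  rw [Theta, toLoop_eq, ← RingHom.map_det]
  exact (isUnit_det_negExp hneg).map laur

theorem Theta_inv (hneg : IsNegative ξ) : (Theta ξ)⁻¹ = toLoop (negExp ξ)⁻¹ := by
  refine Matrix.inv_eq_right_inv ?_
  rw [Theta, toLoop_eq, toLoop_eq, ← map_mul, Matrix.mul_nonsing_inv _ (isUnit_det_negExp hneg),
    map_one]

theorem Theta_mul_inv (hneg : IsNegative ξ) : Theta ξ * (Theta ξ)⁻¹ = 1 :=
  Matrix.mul_nonsing_inv _ (isUnit_det_Theta hneg)

theorem Theta_inv_mul (hneg : IsNegative ξ) : (Theta ξ)⁻¹ * Theta ξ = 1 :=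
  Matrix.nonsing_inv_mul _ (isUnit_det_Theta hneg)

/-! ### The central coefficient -/

/-- The partial sums of the series for `exp (-x) (z ∂_z exp x)`. -/
def dexpSum (x : Loop ℓ) (M : ℕ) : Loop ℓ :=
  ∑ n ∈ Finset.range M, scal (cst (((n + 1).factorial : ℂ))⁻¹) ((negAd x)^[n] (euler x))

theorem euler_scal_cst (c : ℂ) (A : Loop ℓ) : euler (scal (cst c) A) = scal (cst c) (euler A) :=
  isDeriv_euler.map_scal_of_const (euler_cst c) A

/-- The factorials separate because (N+1 choose n+1)/(N+1)! = 1/((N-n)! (n+1)!). This exhibits the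
terms of the product of exp x with the series for exp(-x) z∂_z(exp x). -/
theorem euler_expSum (x : Loop ℓ) (M : ℕ) : euler (expSum x (M + 1)) =
    ∑ N ∈ Finset.range M, ∑ n ∈ Finset.range (N + 1),
      scal (cst (((N - n).factorial : ℂ)⁻¹ * ((n + 1).factorial : ℂ)⁻¹))
        (x ^ (N - n) * (negAd x)^[n] (euler x)) := by
  rw [expSum, Finset.sum_range_succ']
  have h0 : euler (scal (cst (((0).factorial : ℂ))⁻¹) (x ^ 0)) = 0 := by
    rw [euler_scal_cst, pow_zero]
    exact (congrArg _ isDeriv_euler.map_one).trans (scal_zero _)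
  have h1 : ∀ A B : Loop ℓ, euler (A + B) = euler A + euler B := isDeriv_euler.map_add
  rw [h1, h0, add_zero]
  refine (isDeriv_euler.map_sum _ _).trans (Finset.sum_congr rfl fun N _ => ?_)
  refine (euler_scal_cst _ _).trans ?_
  rw [leibniz_pow_eq_sum_negAd (D := euler) isDeriv_euler.map_mul, scal_sum]
  refine Finset.sum_congr rfl fun n hn => ?_
  have hn' : n ≤ N := Nat.lt_succ_iff.mp (Finset.mem_range.mp hn)
  have h2 : ∀ (k : ℕ) (A : Loop ℓ), k • A = scal (cst k) A := by
    intro k A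
    rw [cst_natCast]
    exact (Nat.cast_smul_eq_nsmul _ k A).symm
  rw [h2, scal_scal, cst_mul_cst]
  congr 2
  have h3 := Nat.choose_mul_factorial_mul_factorial (show n + 1 ≤ N + 1 by omega)
  rw [show N + 1 - (n + 1) = N - n by omega] at h3
  have h4 : ((N + 1).factorial : ℂ) ≠ 0 := Nat.cast_ne_zero.mpr (Nat.factorial_ne_zero _)
  have h5 : ((n + 1).factorial : ℂ) ≠ 0 := Nat.cast_ne_zero.mpr (Nat.factorial_ne_zero _)
  have h6 : ((N - n).factorial : ℂ) ≠ 0 := Nat.cast_ne_zero.mpr (Nat.factorial_ne_zero _)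
  field_simp
  rw [← h3]
  push_cast
  ring

/-- The product of truncations runs over the square n, k < M and the derivative over the triangle n
+ k < M. The terms in the difference have n + k ≥ M, hence order at least M. -/
theorem matOrdGe_expSum_mul_dexpSum {x : Loop ℓ} (hx : MatOrdGe 1 x) (M : ℕ) :
    MatOrdGe M (expSum x M * dexpSum x M - euler (expSum x (M + 1))) := by
  let f : ℕ → ℕ → Loop ℓ := fun n k =>
    scal (cst ((k.factorial : ℂ)⁻¹ * ((n + 1).factorial : ℂ)⁻¹)) (x ^ k * (negAd x)^[n] (euler x))
  have hf : ∀ n k, M ≤ n + k → MatOrdGe M (f n k) := by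
    intro n k h
    have h1 := MatOrdGe.scal (ordGe_cst ((k.factorial : ℂ)⁻¹ * ((n + 1).factorial : ℂ)⁻¹))
      ((hx.pow k).mul (hx.negAd_iterate hx.euler n))
    exact h1.mono (by omega)
  have e1 : expSum x M * dexpSum x M = ∑ n ∈ Finset.range M, ∑ k ∈ Finset.range M, f n k := by
    rw [expSum, dexpSum, Finset.sum_mul_sum, Finset.sum_comm]
    refine Finset.sum_congr rfl fun n _ => Finset.sum_congr rfl fun k _ => ?_
    rw [scal_mul, mul_scal, scal_scal, cst_mul_cst]
  have e2 : euler (expSum x (M + 1)) =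
      ∑ n ∈ Finset.range M, ∑ k ∈ Finset.range (M - n), f n k := by
    rw [euler_expSum, ← Finset.sum_range_diag_flip]
  rw [e1, e2, ← Finset.sum_sub_distrib]
  refine MatOrdGe.sum fun n _ => ?_
  rw [Finset.sum_range_sub_sum_range (Nat.sub_le M n)]
  refine MatOrdGe.sum fun k hk => hf n k ?_
  have := (Finset.mem_filter.mp hk).2
  omega

/-- Truncated form of Θ⁻¹ z∂_zΘ = ∑ (-ad ξ)^n (z∂_zξ) / (n+1)!. It is proved after multiplication by
Θ, which together with its inverse has order at least 0. -/
theorem matOrdGe_log_deriv (hneg : IsNegative ξ) (M : ℕ) :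
    MatOrdGe M ((Theta ξ)⁻¹ * euler (Theta ξ) - dexpSum (toLoop ξ) M) := by
  have hx := matOrdGe_one hneg
  have hd : MatOrdGe 0 (dexpSum (toLoop ξ) M) := MatOrdGe.sum fun n _ =>
    (MatOrdGe.scal (ordGe_cst _) (hx.negAd_iterate hx.euler n)).mono (by omega)
  have h1 := (matOrdGe_Theta_sub hneg M).mul hd
  have h2 := matOrdGe_expSum_mul_dexpSum hx M
  have h3 := ((matOrdGe_Theta_sub hneg (M + 1)).mono
    (show ((M : ℕ) : ℤ) ≤ (M + 1 : ℕ) by push_cast; omega)).euler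
  have e3 : euler (Theta ξ - expSum (toLoop ξ) (M + 1)) =
      euler (Theta ξ) - euler (expSum (toLoop ξ) (M + 1)) := isDeriv_euler.map_sub _ _
  have h0 : MatOrdGe 0 ((Theta ξ)⁻¹) := by
    rw [Theta_inv hneg]
    exact matOrdGe_toLoop _
  rw [add_zero] at h1
  have h4 := h0.mul ((h1.add h2).sub h3)
  rw [zero_add, e3] at h4
  have e : (Theta ξ)⁻¹ * euler (Theta ξ) - dexpSum (toLoop ξ) M =
      -((Theta ξ)⁻¹ * ((Theta ξ - expSum (toLoop ξ) M) * dexpSum (toLoop ξ) M +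
        (expSum (toLoop ξ) M * dexpSum (toLoop ξ) M - euler (expSum (toLoop ξ) (M + 1))) -
        (euler (Theta ξ) - euler (expSum (toLoop ξ) (M + 1))))) := by
    have : (Theta ξ - expSum (toLoop ξ) M) * dexpSum (toLoop ξ) M +
        (expSum (toLoop ξ) M * dexpSum (toLoop ξ) M - euler (expSum (toLoop ξ) (M + 1))) -
        (euler (Theta ξ) - euler (expSum (toLoop ξ) (M + 1))) =
        Theta ξ * dexpSum (toLoop ξ) M - euler (Theta ξ) := by
      rw [sub_mul]; abel
    rw [this, mul_sub, ← mul_assoc, Theta_inv_mul hneg, one_mul, neg_sub]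
  rw [e]
  exact h4.neg

theorem negAd_neg {A : Type*} [Ring A] (x z : A) : negAd (-x) z = x * z - z * x := by
  rw [negAd, mul_neg, neg_mul, sub_neg_eq_add, neg_add_eq_sub]

/-- The adjoint action is skew for the trace form. -/
theorem trace_negAd_mul {R n : Type*} [CommRing R] [Fintype n] [DecidableEq n] (x : Matrix n n R)
    (k : ℕ) : ∀ z w : Matrix n n R, ((negAd x)^[k] z * w).trace = (z * (negAd (-x))^[k] w).trace := by
  induction k with
  | zero => intro z w; rfl
  | succ k ih =>
    intro z w
    rw [Function.iterate_succ_apply, Function.iterate_succ_apply', ih]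
    rw [negAd_neg, negAd, sub_mul, mul_sub, Matrix.trace_sub, Matrix.trace_sub,
      Matrix.mul_assoc x z, Matrix.trace_mul_comm x, mul_assoc, mul_assoc]

theorem affBracket_iterate (x L : Loop ℓ) (n : ℕ) :
    ((affBracket (x, 0))^[n] (L, 0)).1 = (negAd (-x))^[n] L := by
  induction n with
  | zero => rfl
  | succ n ih =>
    rw [Function.iterate_succ_apply', Function.iterate_succ_apply', ← ih, negAd_neg]
    rfl

/-- The coefficient of `z ^ 0`, multiplied by `κ`. -/
def resKappa (f : TSeries InvLaurent) : TSeries ℂ :=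
  coeffwise (fun a : InvLaurent => kappa * a.coeff 0) f

theorem coeff_resKappa (f : TSeries InvLaurent) (T : PosExp →₀ ℕ) :
    MvPowerSeries.coeff T (resKappa f) = kappa * (MvPowerSeries.coeff T f).coeff 0 := rfl

theorem resKappa_eq_zero {f : TSeries InvLaurent} (h : OrdGe 1 f) : resKappa f = 0 := by
  ext T
  rw [coeff_resKappa, h T 0 zero_lt_one, mul_zero, map_zero]

/-- Only the last bracket contributes to the central term of (ad ξ)^{n+1} Λ_j, which is thus κ [z⁰]
Tr(z∂_zξ (ad ξ)^n Λ_j). Moving ad ξ to the other factor under the trace and dividing by (n+1)!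
produces the series for Θ⁻¹ z∂_zΘ. -/
theorem centralCoeff_eq (hneg : IsNegative ξ) (j : PosExp) :
    centralCoeff ℓ ξ j =
      resKappa (((Theta ξ)⁻¹ * euler (Theta ξ) * constLoop (heis ℓ j)).trace) := by
  obtain ⟨d, hd⟩ := exists_ordGe_constLoop (heis ℓ j)
  set L := constLoop (heis ℓ j)
  set x := toLoop ξ
  have hx : MatOrdGe 1 x := matOrdGe_one hneg
  have hx' : MatOrdGe 1 (-x) := hx.neg
  -- If Λ_j has no power of z above z^d, then n ≥ d commutators with ξ and the factor z∂_zξ leave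
  -- only negative powers.
  have hz : ∀ n, d ≤ n → resKappa ((euler x * (negAd (-x))^[n] L).trace) = 0 := fun n hn =>
    resKappa_eq_zero (((hx.euler.mul (hx'.negAd_iterate hd n)).trace).mono (by omega))
  have hg : ∀ n, ((affBracket (x, 0))^[n + 1] (L, 0)).2 =
      resKappa ((euler x * (negAd (-x))^[n] L).trace) := by
    intro n
    rw [Function.iterate_succ_apply', ← affBracket_iterate]
    rfl
  have h0 : ((affBracket (x, 0))^[0] (L, 0)).2 = 0 := rfl
  have h1 : centralCoeff ℓ ξ j = ∑ n ∈ Finset.range (d + 1), (((n + 1).factorial : ℂ))⁻¹ •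
      resKappa ((euler x * (negAd (-x))^[n] L).trace) := by
    rw [centralCoeff, finsum_eq_sum_of_support_subset (s := Finset.range (d + 1 + 1)),
      Finset.sum_range_succ', h0, smul_zero, add_zero]
    · exact Finset.sum_congr rfl fun n _ => by rw [hg]
    · intro n hn
      rw [Finset.coe_range, Set.mem_Iio]
      by_contra h
      obtain ⟨k, rfl⟩ : ∃ k, n = k + 1 := ⟨n - 1, by omega⟩
      refine hn ?_
      change _ • ((affBracket (x, 0))^[k + 1] (L, 0)).2 = 0
      rw [hg, hz k (by omega), smul_zero]
  have h2 : OrdGe 1 ((((Theta ξ)⁻¹ * euler (Theta ξ) - dexpSum x (d + 1)) * L).trace) :=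
    (((matOrdGe_log_deriv hneg (d + 1)).mul hd).trace).mono (by push_cast; omega)
  rw [h1]
  ext T
  have h3 := h2 T 0 zero_lt_one
  rw [sub_mul, Matrix.trace_sub, map_sub, HahnSeries.coeff_sub, sub_eq_zero] at h3
  rw [coeff_resKappa, h3, dexpSum, Finset.sum_mul, Matrix.trace_sum, coeff_sum_coeff, map_sum,
    Finset.mul_sum]
  refine Finset.sum_congr rfl fun n _ => ?_
  rw [scal_mul, trace_scal, coeff_cst_mul, trace_negAd_mul, MvPowerSeries.coeff_smul,
    coeff_resKappa]
  ring

end Theta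

end DrinfeldSokolovD

namespace DrinfeldSokolovD

/-! ### The dressed Heisenberg generators -/

theorem pderiv_map {σ R S : Type} [CommSemiring R] [CommSemiring S] (φ : R →+* S) (j : σ)
    (f : MvPowerSeries σ R) : MvPowerSeries.pderiv S j (MvPowerSeries.map φ f) =
      MvPowerSeries.map φ (MvPowerSeries.pderiv R j f) := by
  ext T
  simp only [MvPowerSeries.coeff_pderiv, MvPowerSeries.coeff_map, map_mul, map_add, map_natCast,
    map_one]

theorem constLoop_mul {ℓ : ℕ} (A B : Mat ℓ InvLaurent) :
    constLoop (A * B) = constLoop A * constLoop B :=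
  map_mul (MvPowerSeries.C (σ := PosExp) (R := InvLaurent)).mapMatrix A B

theorem constLoop_scal {ℓ : ℕ} (a : InvLaurent) (A : Mat ℓ InvLaurent) :
    constLoop (scal a A) = scal (MvPowerSeries.C a) (constLoop A) :=
  map_scal (MvPowerSeries.C (σ := PosExp) (R := InvLaurent)) a A

theorem trace_constLoop {ℓ : ℕ} (A : Mat ℓ InvLaurent) :
    (constLoop A).trace = MvPowerSeries.C A.trace := by
  rw [Matrix.trace, Matrix.trace, map_sum]
  rfl

theorem coeffwise_C {σ R : Type} [CommRing R] {φ : R → R} (hφ : IsDeriv φ) (a : R) :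
    coeffwise φ (MvPowerSeries.C a : MvPowerSeries σ R) = MvPowerSeries.C (φ a) := by
  classical
  ext T
  rw [coeff_coeffwise, MvPowerSeries.coeff_C, MvPowerSeries.coeff_C]
  split_ifs
  · rfl
  · exact hφ.zero

theorem euler_constLoop {ℓ : ℕ} (A : Mat ℓ InvLaurent) :
    euler (constLoop A) = constLoop (A.map eulerK) := by
  ext1 i j
  exact coeffwise_C isDeriv_eulerK _

theorem map_pderiv_constLoop {ℓ : ℕ} (A : Mat ℓ InvLaurent) (j : PosExp) :
    (constLoop A).map (MvPowerSeries.pderiv InvLaurent j) = 0 := by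
  ext1 i k
  exact MvPowerSeries.pderiv_C

theorem euler_map_pderiv {ℓ : ℕ} (A : Loop ℓ) (j : PosExp) :
    (euler A).map (MvPowerSeries.pderiv InvLaurent j) =
      euler (A.map (MvPowerSeries.pderiv InvLaurent j)) := by
  ext1 i k
  exact pderiv_coeffwise isDeriv_eulerK j _

theorem euler_mul {ℓ : ℕ} (A B : Loop ℓ) : euler (A * B) = euler A * B + A * euler B :=
  isDeriv_euler.map_mul A B

/-- The derivative of `T A T⁻¹`. -/
theorem IsDeriv.map_conj {R n : Type*} [CommRing R] [Fintype n] [DecidableEq n] {D : R → R}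
    (hD : IsDeriv D) {T S : Matrix n n R} (h : T * S = 1) (A : Matrix n n R) :
    (T * A * S).map D = T.map D * S * (T * A * S) + T * A.map D * S - T * A * S * (T.map D * S) := by
  rw [hD.map_mul, hD.map_mul, hD.map_inv h]
  have : T.map D * S * (T * A * S) = T.map D * A * S := by
    rw [← mul_assoc, ← mul_assoc, mul_assoc _ _ T, mul_eq_one_comm.mp h, mul_one]
  rw [this, add_mul, mul_neg, sub_eq_add_neg]
  simp only [mul_assoc]

/-- To be read with T = Θ, S = Θ⁻¹, ∂_jΘ = BΘ, E = z∂_zΘ and F = z∂_zB: the two terms with S B E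
cancel. -/
theorem trace_log_deriv {R n : Type*} [CommRing R] [Fintype n] [DecidableEq n]
    {T S : Matrix n n R} (h : T * S = 1) (B E F L : Matrix n n R) :
    ((-(S * (B * T) * S) * E + S * (F * T + B * E)) * L).trace = (F * (T * L * S)).trace := by
  have e : S * (B * T) * S = S * B := by rw [mul_assoc, mul_assoc B, h, mul_one]
  rw [e, mul_add, neg_mul, ← mul_assoc S B E, add_comm (S * (F * T)), neg_add_cancel_left,
    ← mul_assoc F, Matrix.trace_mul_comm _ S]
  simp only [mul_assoc]

section Dressed

variable {ℓ : ℕ} {ξ : Mat ℓ (TSeries (PowerSeries ℂ))}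

/-- `Θ Λ_j Θ⁻¹`. -/
def dressed (ξ : Mat ℓ (TSeries (PowerSeries ℂ))) (j : PosExp) : Loop ℓ :=
  Theta ξ * constLoop (heis ℓ j) * (Theta ξ)⁻¹

theorem conj_mul_conj (hneg : IsNegative ξ) (A B : Loop ℓ) :
    Theta ξ * A * (Theta ξ)⁻¹ * (Theta ξ * B * (Theta ξ)⁻¹) =
      Theta ξ * (A * B) * (Theta ξ)⁻¹ := by
  rw [← mul_assoc, ← mul_assoc, mul_assoc (Theta ξ * A), Theta_inv_mul hneg, mul_one,
    mul_assoc (Theta ξ) A B]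

theorem trace_conj (hneg : IsNegative ξ) (A : Loop ℓ) :
    (Theta ξ * A * (Theta ξ)⁻¹).trace = A.trace := by
  rw [Matrix.trace_mul_comm, ← mul_assoc, Theta_inv_mul hneg, one_mul]

theorem dressed_mul (hneg : IsNegative ξ) (i j : PosExp) : dressed ξ i * dressed ξ j =
    Theta ξ * constLoop (heis ℓ i * heis ℓ j) * (Theta ξ)⁻¹ := by
  rw [dressed, dressed, conj_mul_conj hneg, constLoop_mul]

theorem dressed_comm (hℓ : 4 ≤ ℓ) (hneg : IsNegative ξ) (i j : PosExp) :
    dressed ξ i * dressed ξ j = dressed ξ j * dressed ξ i := by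
  rw [dressed_mul hneg, dressed_mul hneg, heis_mul_comm hℓ]

theorem trace_dressed_mul (hneg : IsNegative ξ) (i j : PosExp) :
    (dressed ξ i * dressed ξ j).trace = MvPowerSeries.C (heis ℓ i * heis ℓ j).trace := by
  rw [dressed_mul hneg, trace_conj hneg, trace_constLoop]

theorem dressed_shift (hℓ : 4 ≤ ℓ) (b : Bool) (s r : ℕ) : dressed ξ (pexp b (nres ℓ b * s + r)) =
    scal (MvPowerSeries.C (zmon s 1)) (dressed ξ (pexp b r)) := by
  rw [dressed, heis_shift hℓ, constLoop_scal, mul_scal, scal_mul]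
  rfl

/-- Differentiating the conjugation adds a commutator of (z∂_zΘ)Θ⁻¹ with R_i, whose trace against
R_j vanishes since R_i and R_j commute. -/
theorem trace_euler_dressed_mul (hℓ : 4 ≤ ℓ) (hneg : IsNegative ξ) (i j : PosExp) :
    (euler (dressed ξ i) * dressed ξ j).trace =
      MvPowerSeries.C ((heis ℓ i).map eulerK * heis ℓ j).trace := by
  have h : euler (dressed ξ i) = _ := isDeriv_euler.map_conj (Theta_mul_inv hneg) (constLoop (heis ℓ i))
  rw [h, sub_mul, add_mul, Matrix.trace_sub, Matrix.trace_add]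
  change ((_ * dressed ξ i * dressed ξ j).trace +
    (Theta ξ * euler (constLoop (heis ℓ i)) * (Theta ξ)⁻¹ * dressed ξ j).trace) -
      (dressed ξ i * _ * dressed ξ j).trace = _
  have h2 : Theta ξ * euler (constLoop (heis ℓ i)) * (Theta ξ)⁻¹ * dressed ξ j =
      Theta ξ * constLoop ((heis ℓ i).map eulerK * heis ℓ j) * (Theta ξ)⁻¹ := by
    rw [euler_constLoop, constLoop_mul, ← conj_mul_conj hneg]
    rfl
  rw [h2, trace_conj hneg, trace_constLoop, mul_assoc (_ * _) (dressed ξ i), mul_assoc (dressed ξ i) _ (dressed ξ j),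
    Matrix.trace_mul_comm (dressed ξ i), mul_assoc (_ * _) (dressed ξ j), dressed_comm hℓ hneg j i]
  ring

theorem map_pderiv_dressed (hneg : IsNegative ξ) (hsol : IsSolution ℓ ξ) (j k : PosExp) :
    (dressed ξ k).map (MvPowerSeries.pderiv InvLaurent j) =
      negPart (dressed ξ j) * dressed ξ k - dressed ξ k * negPart (dressed ξ j) := by
  have h : (dressed ξ k).map (MvPowerSeries.pderiv InvLaurent j) = _ :=
    (isDeriv_pderiv j).map_conj (Theta_mul_inv hneg) (constLoop (heis ℓ k))
  rw [h, hsol j, map_pderiv_constLoop, mul_zero, zero_mul, add_zero,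
    mul_assoc _ (Theta ξ) (Theta ξ)⁻¹, Theta_mul_inv hneg, mul_one]
  rfl

/-- `Tr (Θ⁻¹ z ∂_z Θ Λ_j)`. -/
def logd (ξ : Mat ℓ (TSeries (PowerSeries ℂ))) (j : PosExp) : TSeries InvLaurent :=
  ((Theta ξ)⁻¹ * euler (Theta ξ) * constLoop (heis ℓ j)).trace

theorem logd_shift (hℓ : 4 ≤ ℓ) (b : Bool) (s r : ℕ) : logd ξ (pexp b (nres ℓ b * s + r)) =
    MvPowerSeries.C (zmon s 1) * logd ξ (pexp b r) := by
  rw [logd, heis_shift hℓ, constLoop_scal, mul_scal, trace_scal]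
  rfl

/-- Θ⁻¹ z∂_zΘ changes along t_j by Θ⁻¹ (z∂_z (R_j)_{<0}) Θ; cyclicity of the trace moves the
conjugation onto Λ_k. -/
theorem pderiv_logd (hneg : IsNegative ξ) (hsol : IsSolution ℓ ξ) (j k : PosExp) :
    MvPowerSeries.pderiv InvLaurent j (logd ξ k) =
      (euler (negPart (dressed ξ j)) * dressed ξ k).trace := by
  have hD := isDeriv_pderiv (R := InvLaurent) j
  rw [logd, ← hD.trace_map, hD.map_mul, hD.map_mul, map_pderiv_constLoop, mul_zero, add_zero,
    hD.map_inv (Theta_mul_inv hneg), euler_map_pderiv, hsol j, euler_mul]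
  change ((-((Theta ξ)⁻¹ * (negPart (dressed ξ j) * Theta ξ) * (Theta ξ)⁻¹) * euler (Theta ξ) +
    (Theta ξ)⁻¹ * (euler (negPart (dressed ξ j)) * Theta ξ +
      negPart (dressed ξ j) * euler (Theta ξ))) * constLoop (heis ℓ k)).trace = _
  exact trace_log_deriv (Theta_mul_inv hneg) _ _ _ _

/-- Θ⁻¹ z∂_zΘ has only negative powers of z, which absorb the single positive power allowed in Λ_j.
-/
theorem ordGe_logd {j : PosExp} (hneg : IsNegative ξ) (hj : MatOrdGe (-1) (constLoop (heis ℓ j))) :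
    OrdGe 0 (logd ξ j) := by
  have hx := matOrdGe_one hneg
  have h1 : MatOrdGe 1 (dexpSum (toLoop ξ) 1) := MatOrdGe.sum fun n _ =>
    (MatOrdGe.scal (ordGe_cst _) (hx.negAd_iterate hx.euler n)).mono (by omega)
  have h2 := (matOrdGe_log_deriv hneg 1).add h1
  rw [sub_add_cancel] at h2
  exact (h2.mul hj).trace

end Dressed

/-! ### Series in nonnegative powers of `1/z` -/

theorem laur_injective : Function.Injective laur := by
  intro f g h
  ext T k
  rw [← laur_coeff, ← laur_coeff, h]

/-- The series of the nonpositive powers of `z`. -/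
def down (f : TSeries InvLaurent) : TSeries (PowerSeries ℂ) :=
  fun T => PowerSeries.mk fun k => (MvPowerSeries.coeff T f).coeff k

theorem coeff_down (f : TSeries InvLaurent) (T : PosExp →₀ ℕ) (k : ℕ) :
    PowerSeries.coeff k (MvPowerSeries.coeff T (down f)) = (MvPowerSeries.coeff T f).coeff k :=
  PowerSeries.coeff_mk k fun k : ℕ => (MvPowerSeries.coeff T f).coeff (k : ℤ)

theorem laur_ext {f g : TSeries InvLaurent} (h : ∀ T n, (MvPowerSeries.coeff T f).coeff n =
    (MvPowerSeries.coeff T g).coeff n) : f = g := by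
  ext T n
  exact h T n

theorem laur_down {f : TSeries InvLaurent} (hf : OrdGe 0 f) : laur (down f) = f := by
  refine laur_ext fun T n => ?_
  rcases lt_or_ge n 0 with h | h
  · rw [hf T n h, ordGe_laur _ T n h]
  · lift n to ℕ using h
    rw [laur_coeff, coeff_down]

theorem laur_pderiv (f : TSeries (PowerSeries ℂ)) (j : PosExp) :
    laur (MvPowerSeries.pderiv (PowerSeries ℂ) j f) = MvPowerSeries.pderiv InvLaurent j (laur f) :=
  (pderiv_map _ j f).symm

/-- The Euler operator on power series in `1/z`. -/
def eulerP (a : PowerSeries ℂ) : PowerSeries ℂ :=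
  PowerSeries.mk fun k => -(k : ℂ) * PowerSeries.coeff k a

theorem laur_eulerP (f : TSeries (PowerSeries ℂ)) :
    laur (coeffwise eulerP f) = coeffwise eulerK (laur f) := by
  refine laur_ext fun T n => ?_
  rcases lt_or_ge n 0 with h | h
  · rw [ordGe_laur _ T n h, (ordGe_laur _).euler T n h]
  · lift n to ℕ using h
    rw [laur_coeff, coeff_coeffwise, coeff_coeffwise, eulerK_coeff, laur_coeff, eulerP,
      PowerSeries.coeff_mk]
    norm_cast

/-- The negative part of `z ^ (s + 1) a`. -/
def negShift (s : ℕ) (a : PowerSeries ℂ) : PowerSeries ℂ :=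
  PowerSeries.mk fun k => if k = 0 then 0 else PowerSeries.coeff (k + s + 1) a

/-- The series `1/z`. -/
def zinv : TSeries InvLaurent := MvPowerSeries.C (zmon (-1) 1)

theorem laur_X : laur (MvPowerSeries.C PowerSeries.X) = zinv := by
  rw [laur, MvPowerSeries.map_C, HahnSeries.ofPowerSeries_X]
  rfl

theorem coeff_zinv_mul (f : TSeries InvLaurent) (T : PosExp →₀ ℕ) (n : ℤ) :
    (MvPowerSeries.coeff T (zinv * f)).coeff n = (MvPowerSeries.coeff T f).coeff (n - 1) := by
  rw [zinv, MvPowerSeries.coeff_C_mul, coeff_zmon_mul, one_mul]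
  rfl

theorem ordGe_zinv : OrdGe 1 zinv := OrdGe.C fun n hn => by
  rw [coeff_zmon, if_neg (by omega)]

/-! ### The dressed generators multiplied by 1/z -/

section Reduced

variable {ℓ : ℕ} {ξ : Mat ℓ (TSeries (PowerSeries ℂ))}

/-- `z⁻¹ Θ Λ_j Θ⁻¹` for the `r`-th exponent of a kind, as a series in `1/z`. -/
def red (ξ : Mat ℓ (TSeries (PowerSeries ℂ))) (b : Bool) (r : ℕ) :
    Mat ℓ (TSeries (PowerSeries ℂ)) :=
  (scal zinv (dressed ξ (pexp b r))).map down

/-- `z⁻¹ Tr (Θ⁻¹ z ∂_z Θ Λ_j)` for the `r`-th exponent of a kind, as a series in `1/z`. -/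
def redLogd (ξ : Mat ℓ (TSeries (PowerSeries ℂ))) (b : Bool) (r : ℕ) : TSeries (PowerSeries ℂ) :=
  down (zinv * logd ξ (pexp b r))

theorem matOrdGe_heis (hℓ : 4 ≤ ℓ) {b : Bool} {r : ℕ} (hr : r < nres ℓ b) :
    MatOrdGe (-1) (constLoop (heis ℓ (pexp b r))) := fun i j => OrdGe.C fun _ hn =>
  heis_coeff_eq_zero hℓ hr i j hn

theorem matOrdGe_dressed (hℓ : 4 ≤ ℓ) (hneg : IsNegative ξ) {b : Bool} {r : ℕ}
    (hr : r < nres ℓ b) : MatOrdGe (-1) (dressed ξ (pexp b r)) := by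
  have h0 : MatOrdGe 0 ((Theta ξ)⁻¹) := by
    rw [Theta_inv hneg]
    exact matOrdGe_toLoop _
  exact (((matOrdGe_toLoop (negExp ξ)).mul (matOrdGe_heis hℓ hr)).mul h0).mono (by omega)

theorem toLoop_red (hℓ : 4 ≤ ℓ) (hneg : IsNegative ξ) {b : Bool} {r : ℕ} (hr : r < nres ℓ b) :
    laur.mapMatrix (red ξ b r) = scal zinv (dressed ξ (pexp b r)) := by
  ext1 i j
  exact laur_down ((ordGe_zinv.mul (matOrdGe_dressed hℓ hneg hr i j)).mono (by omega))

theorem laur_redLogd (hℓ : 4 ≤ ℓ) (hneg : IsNegative ξ) {b : Bool} {r : ℕ} (hr : r < nres ℓ b) :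
    laur (redLogd ξ b r) = zinv * logd ξ (pexp b r) :=
  laur_down ((ordGe_zinv.mul (ordGe_logd hneg (matOrdGe_heis hℓ hr))).mono (by omega))

theorem coeff_zero_redLogd (hℓ : 4 ≤ ℓ) (hneg : IsNegative ξ) {b : Bool} {r : ℕ}
    (hr : r < nres ℓ b) (T : PosExp →₀ ℕ) :
    PowerSeries.coeff 0 (MvPowerSeries.coeff T (redLogd ξ b r)) = 0 := by
  rw [redLogd, coeff_down]
  exact (ordGe_zinv.mul (ordGe_logd hneg (matOrdGe_heis hℓ hr))) T _ (by norm_num)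

/-- The exponent with index s beyond r gives z^s R = z^{s+1} (z⁻¹ R); this accounts for the shift s
+ 1 in `negShift`. -/
theorem negPart_dressed (hℓ : 4 ≤ ℓ) (b : Bool) (s r : ℕ) : negPart (dressed ξ (pexp b (nres ℓ b * s + r))) =
      laur.mapMatrix ((red ξ b r).map (coeffwise (negShift s))) := by
  rw [dressed_shift hℓ]
  ext1 i j
  refine laur_ext fun T n => ?_
  change (if 0 < n then (MvPowerSeries.coeff T (scal (MvPowerSeries.C (zmon s 1))
    (dressed ξ (pexp b r)) i j)).coeff n else 0) =
      (MvPowerSeries.coeff T (laur (coeffwise (negShift s) (red ξ b r i j)))).coeff n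
  rcases lt_or_ge n 0 with h | h
  · rw [if_neg (by omega), ordGe_laur _ T n h]
  · lift n to ℕ using h
    rw [laur_coeff, coeff_coeffwise, negShift, PowerSeries.coeff_mk]
    rcases Nat.eq_zero_or_pos n with rfl | hn
    · rw [if_neg (by simp), if_pos rfl]
    · rw [if_pos (by omega), if_neg (by omega), scal_apply, MvPowerSeries.coeff_C_mul,
        coeff_zmon_mul, one_mul, red, Matrix.map_apply, coeff_down, scal_apply, coeff_zinv_mul]
      congr 1
      push_cast
      ring

theorem pderiv_red (hℓ : 4 ≤ ℓ) (hneg : IsNegative ξ) (hsol : IsSolution ℓ ξ) {b : Bool}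
    {r : ℕ} (hr : r < nres ℓ b) (b' : Bool) (s r' : ℕ) :
    (red ξ b r).map (MvPowerSeries.pderiv (PowerSeries ℂ) (pexp b' (nres ℓ b' * s + r'))) =
      (red ξ b' r').map (coeffwise (negShift s)) * red ξ b r -
        red ξ b r * (red ξ b' r').map (coeffwise (negShift s)) := by
  have hinj : Function.Injective (laur.mapMatrix : Mat ℓ (TSeries (PowerSeries ℂ)) →+* Loop ℓ) :=
    fun A B h => Matrix.map_injective laur_injective h
  apply hinj
  have h1 : laur.mapMatrix ((red ξ b r).map
      (MvPowerSeries.pderiv (PowerSeries ℂ) (pexp b' (nres ℓ b' * s + r')))) =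
      (laur.mapMatrix (red ξ b r)).map
        (MvPowerSeries.pderiv InvLaurent (pexp b' (nres ℓ b' * s + r'))) := by
    ext1 i j
    exact laur_pderiv _ _
  rw [h1, map_sub, map_mul, map_mul, toLoop_red hℓ hneg hr, ← negPart_dressed hℓ,
    (isDeriv_pderiv _).map_scal_of_const (a := zinv) MvPowerSeries.pderiv_C, map_pderiv_dressed hneg hsol,
    scal_sub, mul_scal, scal_mul]

theorem red_comm (hℓ : 4 ≤ ℓ) (hneg : IsNegative ξ) {b b' : Bool} {r r' : ℕ}
    (hr : r < nres ℓ b) (hr' : r' < nres ℓ b') :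
    red ξ b r * red ξ b' r' = red ξ b' r' * red ξ b r := by
  have hinj : Function.Injective (laur.mapMatrix : Mat ℓ (TSeries (PowerSeries ℂ)) →+* Loop ℓ) :=
    fun A B h => Matrix.map_injective laur_injective h
  apply hinj
  rw [map_mul, map_mul, toLoop_red hℓ hneg hr, toLoop_red hℓ hneg hr', mul_scal, scal_mul,
    mul_scal, scal_mul, dressed_comm hℓ hneg]

theorem laur_trace {A : Mat ℓ (TSeries (PowerSeries ℂ))} :
    laur A.trace = (laur.mapMatrix A).trace := by
  rw [Matrix.trace, Matrix.trace, map_sum]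
  rfl

theorem pderiv_redLogd (hℓ : 4 ≤ ℓ) (hneg : IsNegative ξ) (hsol : IsSolution ℓ ξ) {b : Bool}
    {r : ℕ} (hr : r < nres ℓ b) (b' : Bool) (s r' : ℕ) :
    MvPowerSeries.pderiv (PowerSeries ℂ) (pexp b' (nres ℓ b' * s + r')) (redLogd ξ b r) =
      ((red ξ b' r').map (coeffwise fun a => eulerP (negShift s a)) * red ξ b r).trace := by
  apply laur_injective
  have h0 : ∀ j, MvPowerSeries.pderiv InvLaurent j zinv = 0 := fun j => MvPowerSeries.pderiv_C
  rw [laur_pderiv, laur_redLogd hℓ hneg hr, laur_trace, RingHom.map_mul, toLoop_red hℓ hneg hr,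
    mul_scal, trace_scal, (isDeriv_pderiv _).mul, h0, zero_mul, zero_add,
    pderiv_logd hneg hsol, negPart_dressed hℓ]
  congr 3
  ext1 i j
  exact (laur_eulerP _).symm

/-- Two exponents below h have a sum strictly between 0 and 2h. -/
theorem cox_dvd_val_add_iff (hℓ : 4 ≤ ℓ) {b b' : Bool} {r r' : ℕ}
    (hr : r < nres ℓ b) (hr' : r' < nres ℓ b') :
    cox ℓ ∣ (pexp b r).val ℓ + (pexp b' r').val ℓ ↔
      (pexp b r).val ℓ + (pexp b' r').val ℓ = cox ℓ := by
  have h1 := val_pexp_lt hℓ hr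
  have h2 := val_pexp_lt hℓ hr'
  have h3 := val_pos hℓ (pexp b r)
  constructor
  · rintro ⟨k, hk⟩
    have : k < 2 := by
      by_contra h
      have : cox ℓ * 2 ≤ cox ℓ * k := Nat.mul_le_mul_left _ (by omega)
      omega
    have : k ≠ 0 := by rintro rfl; omega
    obtain rfl : k = 1 := by omega
    rw [hk, mul_one]
  · intro h
    rw [h]

theorem laur_C_C_mul_X (c : ℂ) : laur (MvPowerSeries.C (PowerSeries.C c * PowerSeries.X)) =
    MvPowerSeries.C (zmon (-1) c) := by
  rw [laur, MvPowerSeries.map_C, map_mul, HahnSeries.ofPowerSeries_X, HahnSeries.ofPowerSeries_C,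
    HahnSeries.C_apply, HahnSeries.single_mul_single, zero_add, mul_one, zmon, neg_neg]

theorem trace_red_mul_red (hℓ : 4 ≤ ℓ) (hneg : IsNegative ξ) {b b' : Bool} {r r' : ℕ}
    (hr : r < nres ℓ b) (hr' : r' < nres ℓ b') :
    (red ξ b r * red ξ b' r').trace =
      if b = b' ∧ (pexp b r).val ℓ + (pexp b' r').val ℓ = cox ℓ then
        MvPowerSeries.C (PowerSeries.C (2 * cox ℓ : ℂ) * PowerSeries.X) else 0 := by
  apply laur_injective
  rw [laur_trace, RingHom.map_mul, toLoop_red hℓ hneg hr, toLoop_red hℓ hneg hr', mul_scal,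
    scal_mul, trace_scal, trace_scal, trace_dressed_mul hneg, trace_heis_mul_heis hℓ, kind_pexp,
    kind_pexp]
  simp only [cox_dvd_val_add_iff hℓ hr hr']
  split_ifs with h
  · rw [h.2, Nat.div_self (cox_pos hℓ), laur_C_C_mul_X, zinv, ← map_mul, ← map_mul, zmon_mul_zmon,
      zmon_mul_zmon, one_mul, one_mul]
    rfl
  · rw [map_zero, map_zero, mul_zero, mul_zero]

/-- The summand -h comes from z∂_z acting on the factor z⁻¹ in front of R_i. -/
theorem trace_euler_red_mul_red (hℓ : 4 ≤ ℓ) (hneg : IsNegative ξ) {b b' : Bool} {r r' : ℕ}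
    (hr : r < nres ℓ b) (hr' : r' < nres ℓ b') :
    ((red ξ b r).map (coeffwise eulerP) * red ξ b' r').trace =
      if b = b' ∧ (pexp b r).val ℓ + (pexp b' r').val ℓ = cox ℓ then
        MvPowerSeries.C (PowerSeries.C (2 * ((pexp b r).val ℓ - cox ℓ : ℂ)) * PowerSeries.X)
      else 0 := by
  apply laur_injective
  have h1 : laur.mapMatrix ((red ξ b r).map (coeffwise eulerP)) =
      scal (coeffwise eulerK zinv) (dressed ξ (pexp b r)) + scal zinv (euler (dressed ξ (pexp b r))) := by
    have e : laur.mapMatrix ((red ξ b r).map (coeffwise eulerP)) =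
        euler (laur.mapMatrix (red ξ b r)) := by
      ext1 i j
      exact laur_eulerP _
    rw [e, toLoop_red hℓ hneg hr]
    ext1 i j
    exact isDeriv_euler.mul _ _
  have h2 : coeffwise eulerK zinv = MvPowerSeries.C (zmon (-1) (-1)) := by
    rw [zinv, coeffwise_C isDeriv_eulerK, eulerK_zmon]
    norm_num
  rw [laur_trace, RingHom.map_mul, h1, h2, toLoop_red hℓ hneg hr', mul_scal, add_mul,
    scal_mul, scal_mul, trace_scal, Matrix.trace_add, trace_scal, trace_scal,
    trace_dressed_mul hneg, trace_euler_dressed_mul hℓ hneg, trace_heis_mul_heis hℓ,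
    trace_euler_heis_mul_heis hℓ, kind_pexp, kind_pexp]
  simp only [cox_dvd_val_add_iff hℓ hr hr']
  split_ifs with h
  · rw [h.2, Nat.div_self (cox_pos hℓ), laur_C_C_mul_X, zinv, ← map_mul, ← map_mul, ← map_add,
      ← map_mul, zmon_mul_zmon, zmon_mul_zmon, Nat.cast_one, show (-1 : ℤ) + 1 = 0 by norm_num,
      ← zmon_add, zmon_mul_zmon, add_zero]
    congr 2
    ring
  · rw [map_zero, map_zero, mul_zero, mul_zero, add_zero, mul_zero]

/-- The z⁰ coefficient of z^s Tr(Θ⁻¹ z∂_zΘ Λ_j) is the coefficient of z^{-s}, and dividing by z in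
`redLogd` moves it to z^{-(s+1)}. -/
theorem pderiv_logTau (hℓ : 4 ≤ ℓ) (hneg : IsNegative ξ) {logτ : TSeries ℂ}
    (hτ : IsLogTau ℓ ξ logτ) (b : Bool) (s r : ℕ) (T : PosExp →₀ ℕ) :
    MvPowerSeries.coeff T (MvPowerSeries.pderiv ℂ (pexp b (nres ℓ b * s + r)) logτ) =
      -(kappa * PowerSeries.coeff (s + 1) (MvPowerSeries.coeff T (redLogd ξ b r))) := by
  have h : centralCoeff ℓ ξ (pexp b (nres ℓ b * s + r)) = resKappa (logd ξ _) :=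
    centralCoeff_eq hneg _
  rw [hτ, map_neg, h, coeff_resKappa, logd_shift hℓ, MvPowerSeries.coeff_C_mul, coeff_zmon_mul,
    one_mul, redLogd, coeff_down, coeff_zinv_mul]
  congr 3
  push_cast
  ring

end Reduced

end DrinfeldSokolovD

namespace DrinfeldSokolovD

section

open scoped MvPowerSeries.WithPiTopology

/-! ### Infinite sums of power series -/

theorem hasSum_of_eq {ι A : Type*} [AddCommMonoid A] [TopologicalSpace A] {f g : ι → A}
    {a : A} (e : ∀ i, f i = g i) (h : HasSum g a) : HasSum f a := by
  rwa [funext e]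

theorem hasSum_coeffSum {σ : Type} (c : ℕ → MvPowerSeries σ ℂ)
    (h : ∀ e, {i | MvPowerSeries.coeff e (c i) ≠ 0}.Finite) : HasSum c (coeffSum c) := by
  rw [MvPowerSeries.WithPiTopology.hasSum_iff_hasSum_coeff]
  intro e
  have h1 : MvPowerSeries.coeff e (coeffSum c) =
      ∑ i ∈ (h e).toFinset, MvPowerSeries.coeff e (c i) :=
    finsum_eq_sum_of_support_subset _ (by
      intro i hi
      rw [Set.Finite.coe_toFinset]
      exact hi)
  rw [h1]
  refine hasSum_sum_of_ne_finset_zero fun i hi => ?_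
  by_contra h2
  exact hi ((h e).mem_toFinset.mpr h2)

/-- Since v s ≥ s, a fixed monomial meets finitely many terms. Convergence here is purely formal and
carries no analytic content. -/
theorem hasSum_X_pow_mul {σ : Type} (q : σ) {v : ℕ → ℕ} (hv : ∀ s, s ≤ v s)
    (c : ℕ → MvPowerSeries σ ℂ) : HasSum (fun s => MvPowerSeries.X q ^ v s * c s)
      (coeffSum fun s => MvPowerSeries.X q ^ v s * c s) := by
  refine hasSum_coeffSum _ fun e => (Set.finite_Iic (e q)).subset fun s hs => ?_
  by_contra h
  have h' : ¬ s ≤ e q := h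
  have := hv s
  exact hs (MvPowerSeries.X_pow_dvd_iff.mp (dvd_mul_right _ _) e (by omega))

/-- Regroups a sum over all exponents of a kind into the residues modulo the period, on each of
which Λ_j varies only by powers of z. -/
theorem hasSum_of_residues {A : Type*} [AddCommMonoid A] [TopologicalSpace A] [ContinuousAdd A]
    {N : ℕ} (hN : 0 < N) {f : ℕ → A} {S : ℕ → A}
    (h : ∀ r < N, HasSum (fun s => f (N * s + r)) (S r)) :
    HasSum f (∑ r ∈ Finset.range N, S r) := by
  have h1 : ∀ r ∈ Finset.range N, HasSum (fun a => if a % N = r then f a else 0) (S r) := by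
    intro r hr
    have hr' := Finset.mem_range.mp hr
    have hinj : Function.Injective fun s => N * s + r := fun s t hst => by
      have : N * s = N * t := by simpa using hst
      exact Nat.eq_of_mul_eq_mul_left hN this
    refine (hinj.hasSum_iff ?_).mp ?_
    · intro a ha
      rw [if_neg]
      intro h2
      exact ha ⟨a / N, by simp only [← h2]; exact Nat.div_add_mod a N⟩
    · convert h r hr' using 2 with s
      rw [Function.comp_apply, if_pos]
      rw [Nat.mul_add_mod, Nat.mod_eq_of_lt hr']
  convert hasSum_sum h1 using 2 with a
  rw [Finset.sum_ite_eq, if_pos (Finset.mem_range.mpr (Nat.mod_lt _ hN))]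

/-! ### The operators `∇_1`, `∇_2` as derivations -/

/-- `∇_1(ζ_i)` for `q = (i, false)` and `∇_2(ζ̂_i)` for `q = (i, true)`. -/
def nab (ℓ : ℕ) (q : Param) (f : TSeries ParamSeries) : TSeries ParamSeries :=
  if q.2 then nabla2 ℓ q.1 f else nabla1 q.1 f

variable {ℓ : ℕ}

theorem coeff_nab (q : Param) (f : TSeries ParamSeries) (T : PosExp →₀ ℕ) :
    MvPowerSeries.coeff T (nab ℓ q f) = coeffSum fun a : ℕ =>
      MvPowerSeries.X q ^ (pexp q.2 a).val ℓ *
        MvPowerSeries.coeff T (MvPowerSeries.pderiv ParamSeries (pexp q.2 a) f) := by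
  obtain ⟨i, b⟩ := q
  cases b <;> rfl

theorem le_val_pexp (hℓ : 4 ≤ ℓ) (b : Bool) (a : ℕ) : a ≤ (pexp b a).val ℓ := by
  cases b
  · simp only [pexp, PosExp.val]; omega
  · simp only [pexp, PosExp.val]
    have := Nat.le_mul_of_pos_left a (cox_pos hℓ)
    omega

theorem hasSum_nab (hℓ : 4 ≤ ℓ) (q : Param) (f : TSeries ParamSeries) :
    HasSum (fun a => MvPowerSeries.C (MvPowerSeries.X q ^ (pexp q.2 a).val ℓ) *
      MvPowerSeries.pderiv ParamSeries (pexp q.2 a) f) (nab ℓ q f) := by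
  rw [MvPowerSeries.WithPiTopology.hasSum_iff_hasSum_coeff]
  intro T
  rw [coeff_nab]
  simp only [MvPowerSeries.coeff_C_mul]
  exact hasSum_X_pow_mul q (le_val_pexp hℓ q.2) _

/-- A convergent sum of derivations with coefficients constant in the times; both rules pass to the
limit by uniqueness of sums. -/
theorem isDeriv_nab (hℓ : 4 ≤ ℓ) (q : Param) : IsDeriv (nab ℓ q) where
  add f g := by
    refine (hasSum_nab hℓ q (f + g)).unique ?_
    convert (hasSum_nab hℓ q f).add (hasSum_nab hℓ q g) using 2 with a
    rw [map_add, mul_add]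
  mul f g := by
    refine (hasSum_nab hℓ q (f * g)).unique ?_
    refine hasSum_of_eq (fun a => ?_)
      (((hasSum_nab hℓ q f).mul_right g).add ((hasSum_nab hℓ q g).mul_left f))
    rw [(isDeriv_pderiv _).mul]
    ring

theorem nab_C (hℓ : 4 ≤ ℓ) (q : Param) (a : ParamSeries) : nab ℓ q (MvPowerSeries.C a) = 0 := by
  refine (hasSum_nab hℓ q _).unique ?_
  convert hasSum_zero using 2 with k
  rw [MvPowerSeries.pderiv_C, mul_zero]

/-! ### Substitution of `p ^ h` for `z` -/

/-- The substitution of `p ^ h` for `z` in power series in `1/z`. -/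
def pw (hℓ : 4 ≤ ℓ) (p : Param) : PowerSeries ℂ →+* ParamSeries :=
  ((MvPowerSeries.rename (R := ℂ) (Function.Embedding.punit (β := Param) p)).toRingHom).comp
    (PowerSeries.expand (cox ℓ) (cox_pos hℓ).ne').toRingHom

theorem pw_C (hℓ : 4 ≤ ℓ) (p : Param) (c : ℂ) :
    pw hℓ p (PowerSeries.C c) = MvPowerSeries.C c := by
  change MvPowerSeries.rename (R := ℂ) (Function.Embedding.punit (β := Param) p)
    (PowerSeries.expand _ _ (PowerSeries.C c)) = _
  rw [PowerSeries.expand_C]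
  exact MvPowerSeries.rename_C _ _

theorem pw_X (hℓ : 4 ≤ ℓ) (p : Param) :
    pw hℓ p PowerSeries.X = MvPowerSeries.X p ^ cox ℓ := by
  change MvPowerSeries.rename (R := ℂ) (Function.Embedding.punit (β := Param) p)
    (PowerSeries.expand _ _ PowerSeries.X) = _
  rw [PowerSeries.expand_X, map_pow]
  congr 1
  exact MvPowerSeries.rename_X _ _

theorem hasSum_pw (hℓ : 4 ≤ ℓ) (p : Param) (a : PowerSeries ℂ) :
    HasSum (fun k => MvPowerSeries.X p ^ (cox ℓ * k) * MvPowerSeries.C (PowerSeries.coeff k a))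
      (pw hℓ p a) := by
  classical
  rw [MvPowerSeries.WithPiTopology.hasSum_iff_hasSum_coeff]
  intro e
  have hc := cox_pos hℓ
  have h1 : ∀ k, MvPowerSeries.coeff e (MvPowerSeries.X p ^ (cox ℓ * k) *
      MvPowerSeries.C (PowerSeries.coeff k a)) =
      if e = Finsupp.single p (cox ℓ * k) then PowerSeries.coeff k a else 0 := by
    intro k
    rw [MvPowerSeries.X_pow_eq, MvPowerSeries.coeff_mul_C, MvPowerSeries.coeff_monomial, ite_mul,
      one_mul, zero_mul]
  simp only [h1]
  change HasSum _ (MvPowerSeries.coeff e (MvPowerSeries.rename _ (PowerSeries.expand _ _ a)))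
  by_cases he : ∃ k, e = Finsupp.single p (cox ℓ * k)
  · obtain ⟨k, rfl⟩ := he
    have e1 : Finsupp.single p (cox ℓ * k) =
        Finsupp.embDomain (Function.Embedding.punit (β := Param) p)
          (Finsupp.single PUnit.unit (cox ℓ * k)) := by
      rw [Finsupp.embDomain_single]; rfl
    have e2 : MvPowerSeries.coeff (Finsupp.single p (cox ℓ * k)) (MvPowerSeries.rename
        (Function.Embedding.punit (β := Param) p) (PowerSeries.expand (cox ℓ) hc.ne' a)) =
        PowerSeries.coeff k a := by
      rw [e1]
      refine (MvPowerSeries.coeff_embDomain_rename _ _ _).trans ?_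
      exact PowerSeries.coeff_expand_mul _ _ _ _
    rw [e2]
    convert hasSum_ite_eq k (PowerSeries.coeff k a) using 2 with j
    by_cases hj : j = k
    · subst hj; simp
    · rw [if_neg hj, if_neg]
      intro h
      have := congrArg (fun f => f p) h
      simp only [Finsupp.single_eq_same] at this
      exact hj (Nat.eq_of_mul_eq_mul_left hc this).symm
  · have e2 : MvPowerSeries.coeff e (MvPowerSeries.rename
        (Function.Embedding.punit (β := Param) p) (PowerSeries.expand (cox ℓ) hc.ne' a)) = 0 := by
      by_cases h : e ∈ Set.range (Finsupp.mapDomain (M := ℕ) (Function.Embedding.punit (β := Param) p))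
      · obtain ⟨x, rfl⟩ := h
        obtain ⟨n, rfl⟩ : ∃ n, x = Finsupp.single PUnit.unit n :=
          ⟨x PUnit.unit, Finsupp.unique_single x⟩
        rw [← Finsupp.embDomain_eq_mapDomain]
        refine (MvPowerSeries.coeff_embDomain_rename _ _ _).trans ?_
        refine PowerSeries.coeff_expand_of_not_dvd _ _ _ ?_
        rintro ⟨k, rfl⟩
        exact he ⟨k, by rw [Finsupp.mapDomain_single]; rfl⟩
      · exact MvPowerSeries.coeff_rename_eq_zero _ _ h
    rw [e2]
    convert hasSum_zero using 2 with k
    rw [if_neg fun h => he ⟨k, h⟩]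

/-! ### Telescoping sums -/

/-- Multiplication by z shifts the coefficients and pushes exactly one of them, a_{s+2}, out of the
negative part. -/
theorem negShift_eq (s : ℕ) (a : PowerSeries ℂ) : negShift s a =
    PowerSeries.X * (negShift (s + 1) a + PowerSeries.C (PowerSeries.coeff (s + 2) a)) := by
  ext k
  rcases k with _ | k
  · simp [negShift]
  · rw [PowerSeries.coeff_succ_X_mul, map_add, PowerSeries.coeff_C, negShift, negShift,
      PowerSeries.coeff_mk, PowerSeries.coeff_mk, if_neg (Nat.succ_ne_zero k)]
    rcases k with _ | k
    · simp only [if_true, zero_add]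
      congr 2
      ring
    · rw [if_neg (Nat.succ_ne_zero k), if_neg (Nat.succ_ne_zero k), add_zero]
      congr 2
      ring

theorem eulerP_X_mul (a : PowerSeries ℂ) :
    eulerP (PowerSeries.X * a) = PowerSeries.X * eulerP a - PowerSeries.X * a := by
  ext k
  rcases k with _ | k
  · simp [eulerP]
  · rw [map_sub, PowerSeries.coeff_succ_X_mul, PowerSeries.coeff_succ_X_mul, eulerP, eulerP,
      PowerSeries.coeff_mk, PowerSeries.coeff_mk, PowerSeries.coeff_succ_X_mul]
    push_cast
    ring

theorem eulerP_add_C (a : PowerSeries ℂ) (c : ℂ) :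
    eulerP (a + PowerSeries.C c) = eulerP a := by
  ext k
  rw [eulerP, eulerP, PowerSeries.coeff_mk, PowerSeries.coeff_mk, map_add, PowerSeries.coeff_C]
  split_ifs with h
  · simp [h]
  · rw [add_zero]

theorem X_mul_negShift_zero (a : PowerSeries ℂ) : PowerSeries.X * negShift 0 a =
    a - PowerSeries.C (PowerSeries.coeff 0 a) -
      PowerSeries.X * PowerSeries.C (PowerSeries.coeff 1 a) := by
  ext k
  rcases k with _ | k
  · simp
  · rw [map_sub, map_sub, PowerSeries.coeff_succ_X_mul, PowerSeries.coeff_succ_X_mul,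
      PowerSeries.coeff_C, PowerSeries.coeff_C, if_neg (Nat.succ_ne_zero k), negShift,
      PowerSeries.coeff_mk]
    rcases k with _ | k <;> simp

variable (hℓ : 4 ≤ ℓ) (q p : Param)

/-- `∑_s q ^ (-h s) (z ^ (s + 1) a)_{<0}` at `z = p ^ h`. -/
def tele (a : PowerSeries ℂ) : ParamSeries :=
  coeffSum fun s => MvPowerSeries.X q ^ (cox ℓ * s) * pw hℓ p (negShift s a)

/-- `∑_s q ^ (-h s) z ∂_z (z ^ (s + 1) a)_{<0}` at `z = p ^ h`. -/
def teleE (a : PowerSeries ℂ) : ParamSeries :=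
  coeffSum fun s => MvPowerSeries.X q ^ (cox ℓ * s) * pw hℓ p (eulerP (negShift s a))

include hℓ in
theorem le_cox_mul (s : ℕ) : s ≤ cox ℓ * s := Nat.le_mul_of_pos_left s (cox_pos hℓ)

theorem hasSum_tele (a : PowerSeries ℂ) :
    HasSum (fun s => MvPowerSeries.X q ^ (cox ℓ * s) * pw hℓ p (negShift s a)) (tele hℓ q p a) :=
  hasSum_X_pow_mul q (le_cox_mul hℓ) _

theorem hasSum_teleE (a : PowerSeries ℂ) :
    HasSum (fun s => MvPowerSeries.X q ^ (cox ℓ * s) * pw hℓ p (eulerP (negShift s a)))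
      (teleE hℓ q p a) :=
  hasSum_X_pow_mul q (le_cox_mul hℓ) _

theorem X_pow_mul_pw_negShift_zero (a : PowerSeries ℂ) :
    MvPowerSeries.X q ^ cox ℓ * pw hℓ q (negShift 0 a) =
      pw hℓ q a - MvPowerSeries.C (PowerSeries.coeff 0 a) -
        MvPowerSeries.X q ^ cox ℓ * MvPowerSeries.C (PowerSeries.coeff 1 a) := by
  have h := congrArg (pw hℓ q) (X_mul_negShift_zero a)
  rwa [map_mul, pw_X, map_sub, map_sub, map_mul, pw_X, pw_C, pw_C] at h

/-- Inserting `negShift_eq` in each term shifts the sum by one. The coefficients pushed out are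
collected into `negShift 0 a` at q. -/
theorem tele_shift (a : PowerSeries ℂ) : MvPowerSeries.X q ^ cox ℓ * tele hℓ q p a =
    MvPowerSeries.X p ^ cox ℓ *
      (tele hℓ q p a - pw hℓ p (negShift 0 a) + pw hℓ q (negShift 0 a)) := by
  have h1 := (hasSum_nat_add_iff' 1).mpr (hasSum_tele hℓ q p a)
  have h2 := (hasSum_nat_add_iff' 1).mpr (hasSum_pw hℓ q (negShift 0 a))
  have e0 : PowerSeries.coeff 0 (negShift 0 a) = 0 := by rw [negShift, PowerSeries.coeff_mk, if_pos rfl]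
  rw [Finset.sum_range_one, mul_zero, pow_zero, one_mul] at h1 h2
  rw [e0, map_zero, sub_zero] at h2
  refine ((hasSum_tele hℓ q p a).mul_left _).unique ?_
  convert (h1.add h2).mul_left (MvPowerSeries.X p ^ cox ℓ) using 2 with s
  have e1 : PowerSeries.coeff (s + 1) (negShift 0 a) = PowerSeries.coeff (s + 2) a := by
    rw [negShift, PowerSeries.coeff_mk, if_neg (Nat.succ_ne_zero s)]
  rw [negShift_eq s, map_mul, map_add, pw_X, pw_C, e1, mul_add (cox ℓ) s 1, mul_one, pow_add]
  ring

/-- With x = p^{-h} and u = q^{-h}, the coefficient of a_N in `tele`, for N ≥ 1, is the geometric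
sum x (x^{N-1} - u^{N-1})/(x - u). Clearing denominators and restoring a_0 gives the closed form. -/
theorem tele_eq (a : PowerSeries ℂ) :
    MvPowerSeries.X q ^ cox ℓ * (MvPowerSeries.X p ^ cox ℓ - MvPowerSeries.X q ^ cox ℓ) *
      tele hℓ q p a =
    MvPowerSeries.X q ^ cox ℓ * pw hℓ p a - MvPowerSeries.X p ^ cox ℓ * pw hℓ q a +
      (MvPowerSeries.X p ^ cox ℓ - MvPowerSeries.X q ^ cox ℓ) *
        MvPowerSeries.C (PowerSeries.coeff 0 a) := by
  have h1 := tele_shift hℓ q p a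
  have h2 := X_pow_mul_pw_negShift_zero hℓ q a
  have h3 := X_pow_mul_pw_negShift_zero hℓ p a
  linear_combination -(MvPowerSeries.X q ^ cox ℓ : ParamSeries) * h1 +
    (MvPowerSeries.X q ^ cox ℓ : ParamSeries) * h3 - (MvPowerSeries.X p ^ cox ℓ : ParamSeries) * h2

theorem teleE_shift (a : PowerSeries ℂ) : MvPowerSeries.X q ^ cox ℓ * teleE hℓ q p a =
    MvPowerSeries.X p ^ cox ℓ * (teleE hℓ q p a - pw hℓ p (eulerP (negShift 0 a))) -
      MvPowerSeries.X q ^ cox ℓ * tele hℓ q p a := by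
  have h1 := (hasSum_nat_add_iff' 1).mpr (hasSum_teleE hℓ q p a)
  rw [Finset.sum_range_one, mul_zero, pow_zero, one_mul] at h1
  refine ((hasSum_teleE hℓ q p a).mul_left _).unique ?_
  refine hasSum_of_eq (fun s => ?_) ((h1.mul_left (MvPowerSeries.X p ^ cox ℓ)).sub
    ((hasSum_tele hℓ q p a).mul_left (MvPowerSeries.X q ^ cox ℓ)))
  rw [negShift_eq s, eulerP_X_mul, eulerP_add_C, ← negShift_eq, map_sub, map_mul, pw_X,
    mul_add (cox ℓ) s 1, mul_one, pow_add]
  ring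

/-- This is z∂_z = -x d/dx, for x = p^{-h}, applied to the closed form in `tele_eq`. The proof again
uses a shift recursion, now with the extra term from z∂_z of 1/z. -/
theorem teleE_eq (a : PowerSeries ℂ) :
    (MvPowerSeries.X p ^ cox ℓ - MvPowerSeries.X q ^ cox ℓ) ^ 2 * teleE hℓ q p a =
    MvPowerSeries.X p ^ cox ℓ * (pw hℓ p a - pw hℓ q a) +
      (MvPowerSeries.X p ^ cox ℓ - MvPowerSeries.X q ^ cox ℓ) * pw hℓ p (eulerP a) := by
  have h1 := teleE_shift hℓ q p a
  have h2 := tele_eq hℓ q p a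
  have h3 := X_pow_mul_pw_negShift_zero hℓ p a
  have h4 : MvPowerSeries.X p ^ cox ℓ * pw hℓ p (eulerP (negShift 0 a)) =
      pw hℓ p (eulerP a) + pw hℓ p a - MvPowerSeries.C (PowerSeries.coeff 0 a) := by
    have e : eulerP (PowerSeries.X * negShift 0 a) =
        eulerP a + PowerSeries.X * PowerSeries.C (PowerSeries.coeff 1 a) := by
      have e1 : a = PowerSeries.X * (negShift 0 a + PowerSeries.C (PowerSeries.coeff 1 a)) +
          PowerSeries.C (PowerSeries.coeff 0 a) := by
        rw [mul_add, X_mul_negShift_zero]; ring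
      have e2 := congrArg eulerP e1
      rw [eulerP_add_C, eulerP_X_mul, eulerP_add_C] at e2
      rw [eulerP_X_mul, e2]
      ring
    rw [eulerP_X_mul] at e
    have h := congrArg (pw hℓ p) e
    rw [map_sub, map_mul, map_mul, map_add, map_mul, pw_X, pw_C] at h
    linear_combination h + h3
  linear_combination -(MvPowerSeries.X p ^ cox ℓ - MvPowerSeries.X q ^ cox ℓ : ParamSeries) * h1 +
    h2 + (MvPowerSeries.X p ^ cox ℓ - MvPowerSeries.X q ^ cox ℓ : ParamSeries) * h4

end

end DrinfeldSokolovD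

namespace DrinfeldSokolovD

/-! ### The exponential `exp (∑ t_j Λ_j)` -/

variable {ℓ : ℕ}

/-- `∑_j t_j Λ_j`. -/
def timeSum (ℓ : ℕ) : Loop ℓ := Matrix.of fun i k =>
  coeffSum fun j : PosExp => MvPowerSeries.monomial (Finsupp.single j 1) (heis ℓ j i k)

theorem coeff_coeffSum {σ ι R : Type} [Semiring R] (s : ι → MvPowerSeries σ R) (e : σ →₀ ℕ) :
    MvPowerSeries.coeff e (coeffSum s) = ∑ᶠ i, MvPowerSeries.coeff e (s i) := rfl

theorem coeff_smul_eq (c : ℂ) (f : TSeries InvLaurent) (T : PosExp →₀ ℕ) :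
    MvPowerSeries.coeff T (c • f) = zmon 0 c * MvPowerSeries.coeff T f := by
  have h : algebraMap ℂ InvLaurent c = zmon 0 c := by
    rw [HahnSeries.algebraMap_apply']
    exact (HahnSeries.ofPowerSeries_C c).trans (by rw [HahnSeries.C_apply, zmon, neg_zero])
  rw [Algebra.smul_def, MvPowerSeries.algebraMap_apply, MvPowerSeries.coeff_C_mul, h]

theorem gmat_apply (ℓ : ℕ) (i k : Fin (2 * ℓ)) : gmat ℓ i k =
    coeffSum fun n : ℕ => ((n.factorial : ℂ))⁻¹ • (timeSum ℓ ^ n) i k := rfl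

/-- The coefficient of a loop at a monomial in the times. -/
def loopCoeff (T : PosExp →₀ ℕ) (A : Loop ℓ) : Mat ℓ InvLaurent :=
  A.map (MvPowerSeries.coeff T)

theorem loop_ext {A B : Loop ℓ} (h : ∀ T, loopCoeff T A = loopCoeff T B) : A = B := by
  ext1 i j
  ext1 T
  exact congrFun (congrFun (h T) i) j

theorem loopCoeff_mul_constLoop (T : PosExp →₀ ℕ) (A : Loop ℓ) (L : Mat ℓ InvLaurent) :
    loopCoeff T (A * constLoop L) = loopCoeff T A * L := by
  ext1 i j
  change MvPowerSeries.coeff T ((A * constLoop L) i j) = _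
  rw [Matrix.mul_apply, Matrix.mul_apply, map_sum]
  exact Finset.sum_congr rfl fun k _ => MvPowerSeries.coeff_mul_C _ _ _

theorem loopCoeff_constLoop_mul (T : PosExp →₀ ℕ) (A : Loop ℓ) (L : Mat ℓ InvLaurent) :
    loopCoeff T (constLoop L * A) = L * loopCoeff T A := by
  ext1 i j
  change MvPowerSeries.coeff T ((constLoop L * A) i j) = _
  rw [Matrix.mul_apply, Matrix.mul_apply, map_sum]
  exact Finset.sum_congr rfl fun k _ => MvPowerSeries.coeff_C_mul _ _ _

theorem loopCoeff_timeSum_single (j : PosExp) :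
    loopCoeff (Finsupp.single j 1) (timeSum ℓ) = heis ℓ j := by
  classical
  ext1 i k
  change (∑ᶠ j', MvPowerSeries.coeff (Finsupp.single j 1)
    (MvPowerSeries.monomial (Finsupp.single j' 1) (heis ℓ j' i k))) = _
  rw [finsum_eq_single _ j]
  · rw [MvPowerSeries.coeff_monomial, if_pos rfl]
  · intro j' h
    rw [MvPowerSeries.coeff_monomial, if_neg]
    exact fun e => h (Finsupp.single_left_injective one_ne_zero e).symm

theorem loopCoeff_timeSum_eq_zero {T : PosExp →₀ ℕ} (h : ∀ j, T ≠ Finsupp.single j 1) :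
    loopCoeff T (timeSum ℓ) = 0 := by
  classical
  ext1 i k
  change (∑ᶠ j', MvPowerSeries.coeff T
    (MvPowerSeries.monomial (Finsupp.single j' 1) (heis ℓ j' i k))) = 0
  refine finsum_eq_zero_of_forall_eq_zero fun j => ?_
  rw [MvPowerSeries.coeff_monomial, if_neg (h j)]

theorem timeSum_comm (hℓ : 4 ≤ ℓ) (j : PosExp) :
    timeSum ℓ * constLoop (heis ℓ j) = constLoop (heis ℓ j) * timeSum ℓ := by
  refine loop_ext fun T => ?_
  rw [loopCoeff_mul_constLoop, loopCoeff_constLoop_mul]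
  by_cases h : ∃ j', T = Finsupp.single j' 1
  · obtain ⟨j', rfl⟩ := h
    rw [loopCoeff_timeSum_single, heis_mul_comm hℓ]
  · rw [loopCoeff_timeSum_eq_zero (not_exists.mp h), zero_mul, mul_zero]

theorem map_pderiv_timeSum (j : PosExp) :
    (timeSum ℓ).map (MvPowerSeries.pderiv InvLaurent j) = constLoop (heis ℓ j) := by
  classical
  ext1 i k
  ext1 T
  rw [Matrix.map_apply, MvPowerSeries.coeff_pderiv]
  change loopCoeff (T + Finsupp.single j 1) (timeSum ℓ) i k * _ =
    MvPowerSeries.coeff T (MvPowerSeries.C (heis ℓ j i k))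
  rw [MvPowerSeries.coeff_C]
  split_ifs with hT
  · rw [hT, zero_add, loopCoeff_timeSum_single]
    simp
  · rw [loopCoeff_timeSum_eq_zero, Matrix.zero_apply, zero_mul]
    intro j' h
    apply hT
    have h1 : (T + Finsupp.single j 1).degree = (Finsupp.single j' 1).degree := by rw [h]
    rw [map_add, Finsupp.degree_single, Finsupp.degree_single] at h1
    exact (Finsupp.degree_eq_zero_iff T).mp (by omega)

theorem coeff_timeSum_pow {n : ℕ} {T : PosExp →₀ ℕ} (h : T.degree < n) (i k : Fin (2 * ℓ)) :
    MvPowerSeries.coeff T ((timeSum ℓ ^ n) i k) = 0 := by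
  classical
  induction n generalizing T i k with
  | zero => omega
  | succ n ih =>
    rw [pow_succ, Matrix.mul_apply, map_sum]
    refine Finset.sum_eq_zero fun m _ => ?_
    rw [MvPowerSeries.coeff_mul]
    refine Finset.sum_eq_zero fun p hp => ?_
    have h1 := congrArg Finsupp.degree (Finset.HasAntidiagonal.mem_antidiagonal.mp hp)
    rw [map_add] at h1
    rcases lt_or_ge p.1.degree n with h2 | h2
    · rw [ih h2, zero_mul]
    · have h3 : loopCoeff p.2 (timeSum ℓ) = 0 := by
        refine loopCoeff_timeSum_eq_zero fun j hj => ?_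
        rw [hj, Finsupp.degree_single] at h1
        omega
      have h4 : MvPowerSeries.coeff p.2 (timeSum ℓ m k) = 0 := congrFun (congrFun h3 m) k
      rw [h4, mul_zero]

/-- ∑ t_j Λ_j is homogeneous of degree one in the times, so its n-th power does not reach monomials
of degree below n. -/
theorem loopCoeff_gmat {T : PosExp →₀ ℕ} {M : ℕ} (h : T.degree < M) :
    loopCoeff T (gmat ℓ) = loopCoeff T (expSum (timeSum ℓ) M) := by
  ext1 i k
  change MvPowerSeries.coeff T (gmat ℓ i k) = MvPowerSeries.coeff T (expSum (timeSum ℓ) M i k)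
  have h0 : ∀ n, MvPowerSeries.coeff T (((n.factorial : ℂ))⁻¹ • (timeSum ℓ ^ n) i k) =
      zmon 0 ((n.factorial : ℂ))⁻¹ * MvPowerSeries.coeff T ((timeSum ℓ ^ n) i k) := fun n =>
    coeff_smul_eq _ _ _
  rw [gmat_apply, coeff_coeffSum, finsum_congr h0, expSum, Matrix.sum_apply, map_sum,
    finsum_eq_sum_of_support_subset (s := Finset.range M)]
  · refine Finset.sum_congr rfl fun n _ => ?_
    rw [scal_apply, cst, MvPowerSeries.coeff_C_mul]
  · intro n hn
    rw [Finset.coe_range, Set.mem_Iio]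
    by_contra h1
    exact hn (mul_eq_zero_of_right _ (coeff_timeSum_pow (by omega) i k))

theorem gmat_comm (hℓ : 4 ≤ ℓ) (j : PosExp) :
    gmat ℓ * constLoop (heis ℓ j) = constLoop (heis ℓ j) * gmat ℓ := by
  refine loop_ext fun T => ?_
  rw [loopCoeff_mul_constLoop, loopCoeff_constLoop_mul, loopCoeff_gmat (Nat.lt_succ_self _),
    ← loopCoeff_mul_constLoop, ← loopCoeff_constLoop_mul]
  congr 1
  rw [expSum, Finset.sum_mul, Finset.mul_sum]
  refine Finset.sum_congr rfl fun n _ => ?_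
  rw [scal_mul, mul_scal, (Commute.pow_left (timeSum_comm hℓ j) n).eq]

theorem map_pderiv_expSum (hℓ : 4 ≤ ℓ) (j : PosExp) (M : ℕ) :
    (expSum (timeSum ℓ) (M + 1)).map (MvPowerSeries.pderiv InvLaurent j) =
      constLoop (heis ℓ j) * expSum (timeSum ℓ) M := by
  have hD := isDeriv_pderiv (R := InvLaurent) j
  have hc : ∀ c, MvPowerSeries.pderiv InvLaurent j (cst c) = 0 := fun c => MvPowerSeries.pderiv_C
  have hp : ∀ n, (timeSum ℓ ^ (n + 1)).map (MvPowerSeries.pderiv InvLaurent j) =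
      scal (cst (n + 1 : ℕ)) (constLoop (heis ℓ j) * timeSum ℓ ^ n) := by
    intro n
    induction n with
    | zero => rw [zero_add, pow_one, map_pderiv_timeSum, pow_zero, mul_one, cst_natCast,
        Nat.cast_one, one_scal]
    | succ n ih =>
      rw [pow_succ, hD.map_mul, ih, map_pderiv_timeSum, scal_mul, mul_assoc, ← pow_succ,
        (Commute.pow_left (timeSum_comm hℓ j) (n + 1)).eq, cst_natCast, cst_natCast,
        Nat.cast_succ (n + 1), add_scal, one_scal]
  rw [expSum, hD.map_sum, Finset.sum_range_succ', expSum, Finset.mul_sum]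
  have h0 : (scal (cst ((Nat.factorial 0 : ℂ))⁻¹) (timeSum ℓ ^ 0)).map
      (MvPowerSeries.pderiv InvLaurent j) = 0 := by
    rw [hD.map_scal_of_const (hc _), pow_zero, hD.map_one, scal_zero]
  rw [h0, add_zero]
  refine Finset.sum_congr rfl fun n _ => ?_
  rw [hD.map_scal_of_const (hc _), hp, scal_scal, cst_mul_cst, mul_scal]
  congr 2
  have h1 : ((n + 1 : ℕ) : ℂ) ≠ 0 := Nat.cast_ne_zero.mpr (Nat.succ_ne_zero n)
  rw [Nat.factorial_succ, Nat.cast_mul, mul_inv, mul_comm, ← mul_assoc, mul_inv_cancel₀ h1, one_mul]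

/-- The Λ_j commute, so the usual rule for exponentials holds. A derivative in a time lowers the
degree by one, so the truncation on the left is one longer. -/
theorem map_pderiv_gmat (hℓ : 4 ≤ ℓ) (j : PosExp) :
    (gmat ℓ).map (MvPowerSeries.pderiv InvLaurent j) = constLoop (heis ℓ j) * gmat ℓ := by
  refine loop_ext fun T => ?_
  have h1 : ∀ A : Loop ℓ, loopCoeff T (A.map (MvPowerSeries.pderiv InvLaurent j)) =
      scal (zmon 0 (T j + 1)) (loopCoeff (T + Finsupp.single j 1) A) := by
    intro A
    ext1 i k
    change MvPowerSeries.coeff T (MvPowerSeries.pderiv InvLaurent j (A i k)) = _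
    rw [MvPowerSeries.coeff_pderiv, mul_comm, scal_apply, zmon_add, zmon_natCast, zmon_zero_one]
    rfl
  rw [h1, loopCoeff_gmat (M := T.degree + 2) (by
    rw [map_add, Finsupp.degree_single]; omega), ← h1, map_pderiv_expSum hℓ,
    loopCoeff_constLoop_mul, loopCoeff_constLoop_mul, loopCoeff_gmat (M := T.degree + 1) (by omega)]

theorem loopCoeff_zero_gmat : loopCoeff 0 (gmat ℓ) = 1 := by
  rw [loopCoeff_gmat (M := 1) (by rw [map_zero]; exact one_pos), expSum, Finset.sum_range_one,
    pow_zero, Nat.factorial_zero, Nat.cast_one, inv_one]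
  have h : cst 1 = 1 := by rw [cst, zmon_zero_one, map_one]
  rw [h, one_scal]
  exact map_one (MvPowerSeries.constantCoeff (σ := PosExp) (R := InvLaurent)).mapMatrix

theorem isUnit_det_gmat : IsUnit (gmat ℓ).det := by
  rw [MvPowerSeries.isUnit_iff_constantCoeff, RingHom.map_det]
  have h : (MvPowerSeries.constantCoeff (σ := PosExp) (R := InvLaurent)).mapMatrix (gmat ℓ) = 1 :=
    loopCoeff_zero_gmat
  rw [h, Matrix.det_one]
  exact isUnit_one

/-! ### Logarithmic derivatives of the wave function -/

/-- For w = g Θ⁻¹ the logarithmic derivative is D(g) g⁻¹ minus the g-conjugate of Θ⁻¹ D(Θ). The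
conjugation drops out of the trace against L since g commutes with L. -/
theorem trace_log_deriv_wave {R n : Type*} [CommRing R] [Fintype n] [DecidableEq n] {D : R → R}
    (hD : IsDeriv D) {g g' T S L : Matrix n n R} (hg : g * g' = 1) (hT : T * S = 1)
    (hL : g * L = L * g) : ((g * S).map D * (T * g') * L).trace =
      (g.map D * g' * L).trace - (S * T.map D * L).trace := by
  have hS : S * T = 1 := mul_eq_one_comm.mp hT
  have hg' : g' * g = 1 := mul_eq_one_comm.mp hg
  have e : g' * L = L * g' := by
    calc g' * L = g' * L * (g * g') := by rw [hg, mul_one]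
      _ = g' * (g * L) * g' := by rw [hL]; simp only [mul_assoc]
      _ = L * g' := by rw [← mul_assoc g', hg', one_mul]
  rw [hD.map_mul, hD.map_inv hT, add_mul, add_mul, Matrix.trace_add, mul_assoc (g.map D) S,
    ← mul_assoc S T, hS, one_mul, sub_eq_add_neg]
  congr 1
  rw [mul_neg, neg_mul, neg_mul, Matrix.trace_neg]
  congr 1
  rw [mul_assoc _ (T * g'), mul_assoc T, e, mul_assoc g, Matrix.trace_mul_comm g]
  simp only [mul_assoc]
  rw [hg', mul_one, ← mul_assoc S T, hS, one_mul]

/-- `Tr (z ∂_z g · g⁻¹ Λ_i)`. -/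
def logdG (ℓ : ℕ) (i : PosExp) : TSeries InvLaurent :=
  (euler (gmat ℓ) * (gmat ℓ)⁻¹ * constLoop (heis ℓ i)).trace

theorem trace_log_deriv_pderiv {R n : Type*} [CommRing R] [Fintype n] [DecidableEq n]
    {g g' L M E dL : Matrix n n R} (hg : g * g' = 1) (hLM : L * M = M * L) :
    ((dL * g + L * E) * g' * M + E * (-(g' * (L * g) * g')) * M).trace = (dL * M).trace := by
  rw [Matrix.trace_add, add_mul, add_mul, Matrix.trace_add, mul_assoc dL, hg, mul_one, add_assoc]
  have e : (L * E * g' * M).trace + (E * -(g' * (L * g) * g') * M).trace = 0 := by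
    rw [mul_neg, neg_mul, Matrix.trace_neg, mul_assoc g', mul_assoc L g g', hg, mul_one,
      mul_assoc L, mul_assoc L, Matrix.trace_mul_comm L, mul_assoc _ M L, ← hLM]
    simp only [mul_assoc]
    exact add_neg_cancel _
  rw [e, add_zero]

/-- Since ∂_j g = Λ_j g, the logarithmic derivative of g changes by z∂_zΛ_j plus a commutator with
Λ_j, which is invisible in the trace against Λ_i. The result is constant in the times, so `logdG` is
affine in them. -/
theorem pderiv_logdG (hℓ : 4 ≤ ℓ) (i j : PosExp) :
    MvPowerSeries.pderiv InvLaurent j (logdG ℓ i) =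
      MvPowerSeries.C ((heis ℓ j).map eulerK * heis ℓ i).trace := by
  have hD := isDeriv_pderiv (R := InvLaurent) j
  have hg := Matrix.mul_nonsing_inv _ (isUnit_det_gmat (ℓ := ℓ))
  rw [logdG, ← hD.trace_map, hD.map_mul, hD.map_mul, map_pderiv_constLoop, mul_zero, add_zero,
    hD.map_inv hg, euler_map_pderiv, map_pderiv_gmat hℓ, euler_mul, euler_constLoop, add_mul,
    ← trace_constLoop, constLoop_mul]
  refine trace_log_deriv_pderiv hg ?_
  rw [← constLoop_mul, heis_mul_comm hℓ, constLoop_mul]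

theorem constantCoeff_logdG (i : PosExp) :
    MvPowerSeries.constantCoeff (logdG ℓ i) = 0 := by
  have h1 : (MvPowerSeries.constantCoeff (σ := PosExp) (R := InvLaurent)).mapMatrix
      (euler (gmat ℓ)) = (loopCoeff 0 (gmat ℓ)).map eulerK := rfl
  have h2 : MvPowerSeries.constantCoeff (logdG ℓ i) =
      ((MvPowerSeries.constantCoeff (σ := PosExp) (R := InvLaurent)).mapMatrix
        (euler (gmat ℓ) * (gmat ℓ)⁻¹ * constLoop (heis ℓ i))).trace := by
    rw [logdG, Matrix.trace, Matrix.trace, map_sum]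
    rfl
  rw [h2, RingHom.map_mul, RingHom.map_mul, h1, loopCoeff_zero_gmat, isDeriv_eulerK.map_one,
    zero_mul, zero_mul, Matrix.trace_zero]

end DrinfeldSokolovD

namespace DrinfeldSokolovD

/-! ### The matrices `Ψ` and `K` -/

/-- The substitution `z = ζ ^ h` in loops. -/
def subst (ℓ : ℕ) : TSeries InvLaurent →+* TSeries InvLaurent :=
  MvPowerSeries.map (substPow (cox ℓ))

variable {ℓ : ℕ} {ξ : Mat ℓ (TSeries (PowerSeries ℂ))}

theorem Psi_eq : Psi ℓ ξ = constLoop (Pmat ℓ)⁻¹ *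
    ((subst ℓ).mapMatrix (gmat ℓ) * (subst ℓ).mapMatrix (Theta ξ)⁻¹) := by
  rw [← map_mul]
  rfl

theorem subst_constLoop (A : Mat ℓ InvLaurent) :
    (subst ℓ).mapMatrix (constLoop A) = constLoop (A.map (substPow (cox ℓ))) := by
  ext1 i j
  exact MvPowerSeries.map_C _ _

theorem constLoop_one : constLoop (1 : Mat ℓ InvLaurent) = 1 :=
  map_one (MvPowerSeries.C (σ := PosExp) (R := InvLaurent)).mapMatrix

theorem Psi_inv (hℓ : 4 ≤ ℓ) (hneg : IsNegative ξ) : (Psi ℓ ξ)⁻¹ =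
    (subst ℓ).mapMatrix (Theta ξ) * (subst ℓ).mapMatrix (gmat ℓ)⁻¹ * constLoop (Pmat ℓ) := by
  refine Matrix.inv_eq_right_inv ?_
  have h1 : (subst ℓ).mapMatrix (Theta ξ)⁻¹ * (subst ℓ).mapMatrix (Theta ξ) = 1 := by
    rw [← map_mul, Theta_inv_mul hneg, map_one]
  have h2 : (subst ℓ).mapMatrix (gmat ℓ) * (subst ℓ).mapMatrix (gmat ℓ)⁻¹ = 1 := by
    rw [← map_mul, Matrix.mul_nonsing_inv _ isUnit_det_gmat, map_one]
  have h3 : constLoop (Pmat ℓ)⁻¹ * constLoop (Pmat ℓ) = 1 := by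
    rw [← constLoop_mul, Matrix.nonsing_inv_mul _ (isUnit_det_Pmat hℓ), constLoop_one]
  rw [Psi_eq]
  generalize (subst ℓ).mapMatrix (Theta ξ)⁻¹ = a at *
  generalize (subst ℓ).mapMatrix (Theta ξ) = b at *
  generalize (subst ℓ).mapMatrix (gmat ℓ)⁻¹ = c at *
  generalize (subst ℓ).mapMatrix (gmat ℓ) = d at *
  calc _ = constLoop (Pmat ℓ)⁻¹ * (d * ((a * b) * c)) * constLoop (Pmat ℓ) := by
        simp only [mul_assoc]
    _ = 1 := by rw [h1, one_mul, h2, mul_one, h3]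

/-- The sum of the `D_j` over the exponents of one kind below the Coxeter number. -/
theorem Dtilde_Dprime_eq (b : Bool) : (if b then Dprime ℓ else Dtilde ℓ) =
    ∑ r ∈ Finset.range (nres ℓ b), Dmat ℓ (pexp b r) := by
  cases b
  · rfl
  · simp [nres, Dprime, pexp]

theorem constLoop_sum {ι : Type*} (s : Finset ι) (f : ι → Mat ℓ InvLaurent) :
    constLoop (∑ i ∈ s, f i) = ∑ i ∈ s, constLoop (f i) :=
  map_sum (MvPowerSeries.C (σ := PosExp) (R := InvLaurent)).mapMatrix f s

theorem Pmat_mul_D_mul (hℓ : 4 ≤ ℓ) (b : Bool) :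
    constLoop (Pmat ℓ) * constLoop (if b then Dprime ℓ else Dtilde ℓ) * constLoop (Pmat ℓ)⁻¹ =
      ∑ r ∈ Finset.range (nres ℓ b), scal (MvPowerSeries.C (zmon (-((pexp b r).val ℓ : ℤ)) 1))
        ((subst ℓ).mapMatrix (constLoop (heis ℓ (pexp b r)))) := by
  rw [Dtilde_Dprime_eq, ← constLoop_mul, ← constLoop_mul, Finset.mul_sum, Finset.sum_mul,
    constLoop_sum]
  refine Finset.sum_congr rfl fun r _ => ?_
  rw [Pmat_mul_Dmat_mul hℓ, constLoop_scal, subst_constLoop]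

/-- P D_j P⁻¹ = ζ^{-j} Λ_j(ζ^h), and g commutes with Λ_j, so conjugation by Ψ⁻¹ reduces to dressing
by Θ. -/
theorem Kmat_eq (hℓ : 4 ≤ ℓ) (hneg : IsNegative ξ) (b : Bool) : Kmat ℓ ξ b =
    ∑ r ∈ Finset.range (nres ℓ b), scal (MvPowerSeries.C (zmon (-((pexp b r).val ℓ : ℤ)) 1))
      ((subst ℓ).mapMatrix (dressed ξ (pexp b r))) := by
  have hP := Pmat_mul_D_mul hℓ b
  have hK : Kmat ℓ ξ b = (Psi ℓ ξ)⁻¹ * constLoop (if b then Dprime ℓ else Dtilde ℓ) * Psi ℓ ξ := rfl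
  have e : ∀ a c d e p q f : Loop ℓ, a * c * p * f * (q * (d * e)) = a * (c * (p * f * q) * d) * e := by
    intros; simp only [mul_assoc]
  rw [hK, Psi_inv hℓ hneg, Psi_eq, e, hP, Finset.mul_sum, Finset.sum_mul, Finset.mul_sum,
    Finset.sum_mul]
  refine Finset.sum_congr rfl fun r _ => ?_
  have hg : (gmat ℓ)⁻¹ * constLoop (heis ℓ (pexp b r)) * gmat ℓ = constLoop (heis ℓ (pexp b r)) := by
    rw [mul_assoc, ← gmat_comm hℓ, ← mul_assoc, Matrix.nonsing_inv_mul _ isUnit_det_gmat, one_mul]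
  rw [mul_scal, scal_mul, mul_scal, scal_mul, ← map_mul, ← map_mul, hg, ← map_mul, ← map_mul]
  rfl

/-! ### The logarithmic derivative of `Ψ` -/

theorem eulerK_substPow {h : ℕ} (hh : 0 < h) (a : InvLaurent) :
    eulerK (substPow h a) = h * substPow h (eulerK a) := by
  rw [← zmon_natCast]
  ext n
  rw [coeff_zmon_mul, add_zero, eulerK_coeff]
  by_cases hn : (h : ℤ) ∣ n
  · obtain ⟨k, rfl⟩ := hn
    rw [substPow_coeff_mul hh, substPow_coeff_mul hh, eulerK_coeff]
    push_cast
    ring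
  · rw [substPow_coeff_of_not_dvd hh _ hn, substPow_coeff_of_not_dvd hh _ hn, mul_zero, mul_zero]

theorem euler_subst (hℓ : 4 ≤ ℓ) (A : Loop ℓ) : euler ((subst ℓ).mapMatrix A) =
    scal (cox ℓ : TSeries InvLaurent) ((subst ℓ).mapMatrix (euler A)) := by
  ext1 i j
  ext1 T
  have h1 : (cox ℓ : TSeries InvLaurent) = MvPowerSeries.C (cox ℓ : InvLaurent) := by
    rw [map_natCast]
  rw [scal_apply, h1, MvPowerSeries.coeff_C_mul]
  exact eulerK_substPow (cox_pos hℓ) _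

theorem exists_colP_eq (c : ℕ) (r : Fin (2 * ℓ)) :
    ∃ e : ℂ, colP ℓ c (r.val + 1) = zmon (-height ℓ r) e := by
  have h0 : ∀ k : ℤ, ∃ e : ℂ, (0 : InvLaurent) = zmon k e := fun k => ⟨0, (zmon_zero k).symm⟩
  have h1 : ∀ {k k' : ℤ} (e' : ℂ), k = k' → ∃ e : ℂ, zmon k e' = zmon k' e := by
    rintro k _ e' rfl
    exact ⟨e', rfl⟩
  by_cases hr : r.val < ℓ
  · rw [height_of_lt hr]
    simp only [colP, betaEntry, betaZeroEntry]
    split_ifs <;> first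
      | exact h0 _
      | exact h1 _ (by omega)
  · rw [height_of_not_lt hr]
    simp only [colP, betaEntry, betaZeroEntry]
    split_ifs <;> first
      | exact h0 _
      | exact h1 _ (by omega)

/-- Every entry in row r of P is a constant times ζ to the power minus the height of r. -/
theorem map_eulerK_Pmat (ℓ : ℕ) : (Pmat ℓ).map eulerK =
    Matrix.diagonal (fun i => zmon 0 (-(height ℓ i : ℂ))) * Pmat ℓ := by
  ext1 r c
  obtain ⟨e, he⟩ := exists_colP_eq (ℓ := ℓ) c.val r
  rw [Matrix.diagonal_mul, Matrix.map_apply, Pmat_apply, he, zmon_zero_mul_zmon, eulerK_zmon,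
    zmon_zero_mul_zmon]
  push_cast
  rfl

theorem IsDeriv.trace_map_inv_mul {R n : Type*} [CommRing R] [Fintype n] [DecidableEq n] {D : R → R}
    (hD : IsDeriv D) {A B : Matrix n n R} (h : A * B = 1) (C : Matrix n n R) :
    (B.map D * A * C).trace = -(A.map D * (C * B)).trace := by
  rw [hD.map_inv h, neg_mul, neg_mul, Matrix.trace_neg, mul_assoc (B * A.map D),
    mul_eq_one_comm.mp h, mul_one, mul_assoc, Matrix.trace_mul_comm, mul_assoc]

theorem IsDeriv.trace_map_mul_mul_inv {R n : Type*} [CommRing R] [Fintype n] [DecidableEq n]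
    {D : R → R} (hD : IsDeriv D) {A B W W' : Matrix n n R} (hW : W * W' = 1) (C : Matrix n n R) :
    ((B * W).map D * (W' * A) * C).trace =
      (B.map D * A * C).trace + (W.map D * W' * (A * C * B)).trace := by
  rw [hD.map_mul, add_mul, add_mul, Matrix.trace_add, mul_assoc (B.map D), ← mul_assoc W, hW,
    one_mul]
  congr 1
  rw [mul_assoc B, mul_assoc B, Matrix.trace_mul_comm B]
  simp only [mul_assoc]

theorem trace_mapMatrix {R S n : Type*} [CommRing R] [CommRing S] [Fintype n] [DecidableEq n]
    (f : R →+* S) (A : Matrix n n R) : (f.mapMatrix A).trace = f A.trace := by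
  rw [Matrix.trace, Matrix.trace, map_sum]
  rfl

/-- By homogeneity of the rows of P, this is up to sign the trace of a diagonal matrix times P D
P⁻¹, a combination of the Λ_j, whose diagonals vanish. -/
theorem trace_map_eulerK_inv_Pmat (hℓ : 4 ≤ ℓ) (he : Even ℓ) (b : Bool) :
    ((Pmat ℓ)⁻¹.map eulerK * Pmat ℓ * (if b then Dprime ℓ else Dtilde ℓ)).trace = 0 := by
  have hP := Matrix.mul_nonsing_inv _ (isUnit_det_Pmat hℓ)
  have h0 : ∀ r, (Matrix.diagonal (fun i => zmon 0 (-(height ℓ i : ℂ))) *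
      (Pmat ℓ * Dmat ℓ (pexp b r) * (Pmat ℓ)⁻¹)).trace = 0 := by
    intro r
    rw [Pmat_mul_Dmat_mul hℓ, Matrix.trace]
    refine Finset.sum_eq_zero fun i _ => ?_
    rw [Matrix.diag_apply, Matrix.diagonal_mul, scal_apply, Matrix.map_apply,
      heis_diag_eq_zero hℓ he, map_zero, mul_zero, mul_zero]
  refine (isDeriv_eulerK.trace_map_inv_mul hP _).trans (neg_eq_zero.mpr ?_)
  rw [map_eulerK_Pmat, mul_assoc, Dtilde_Dprime_eq, Finset.sum_mul, Finset.mul_sum,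
    Finset.mul_sum, Matrix.trace_sum]
  refine Finset.sum_eq_zero fun r _ => ?_
  rw [← mul_assoc (Pmat ℓ), h0]

/-- The contributions of P, g and Θ separate, and that of P is zero. The factor h is the ratio of
ζ∂_ζ to z∂_z. -/
theorem trace_euler_Psi (hℓ : 4 ≤ ℓ) (he : Even ℓ) (hneg : IsNegative ξ) (b : Bool) :
    (euler (Psi ℓ ξ) * (Psi ℓ ξ)⁻¹ * constLoop (if b then Dprime ℓ else Dtilde ℓ)).trace =
      cox ℓ * ∑ r ∈ Finset.range (nres ℓ b), MvPowerSeries.C (zmon (-((pexp b r).val ℓ : ℤ)) 1) *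
        subst ℓ (logdG ℓ (pexp b r) - logd ξ (pexp b r)) := by
  have hg := Matrix.mul_nonsing_inv _ (isUnit_det_gmat (ℓ := ℓ))
  have hw : gmat ℓ * (Theta ξ)⁻¹ * (Theta ξ * (gmat ℓ)⁻¹) = 1 := by
    rw [mul_assoc, ← mul_assoc (Theta ξ)⁻¹, Theta_inv_mul hneg, one_mul, hg]
  have hW : (subst ℓ).mapMatrix (gmat ℓ * (Theta ξ)⁻¹) *
      (subst ℓ).mapMatrix (Theta ξ * (gmat ℓ)⁻¹) = 1 := by
    rw [← map_mul, hw, map_one]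
  have h1 : (euler (constLoop (Pmat ℓ)⁻¹) * constLoop (Pmat ℓ) *
      constLoop (if b then Dprime ℓ else Dtilde ℓ)).trace = 0 := by
    rw [euler_constLoop, ← constLoop_mul, ← constLoop_mul, trace_constLoop,
      trace_map_eulerK_inv_Pmat hℓ he, map_zero]
  have h2 : (euler (constLoop (Pmat ℓ)⁻¹ * (subst ℓ).mapMatrix (gmat ℓ * (Theta ξ)⁻¹)) *
      ((subst ℓ).mapMatrix (Theta ξ * (gmat ℓ)⁻¹) * constLoop (Pmat ℓ)) *
      constLoop (if b then Dprime ℓ else Dtilde ℓ)).trace =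
      (euler (constLoop (Pmat ℓ)⁻¹) * constLoop (Pmat ℓ) *
        constLoop (if b then Dprime ℓ else Dtilde ℓ)).trace +
      (euler ((subst ℓ).mapMatrix (gmat ℓ * (Theta ξ)⁻¹)) *
        (subst ℓ).mapMatrix (Theta ξ * (gmat ℓ)⁻¹) *
        (constLoop (Pmat ℓ) * constLoop (if b then Dprime ℓ else Dtilde ℓ) *
          constLoop (Pmat ℓ)⁻¹)).trace :=
    isDeriv_euler.trace_map_mul_mul_inv hW _
  have h3 : ∀ r, (euler (gmat ℓ * (Theta ξ)⁻¹) * (Theta ξ * (gmat ℓ)⁻¹) *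
      constLoop (heis ℓ (pexp b r))).trace = logdG ℓ (pexp b r) - logd ξ (pexp b r) := fun r =>
    trace_log_deriv_wave isDeriv_euler hg (Theta_mul_inv hneg) (gmat_comm hℓ _)
  rw [Psi_inv hℓ hneg, Psi_eq, ← map_mul, ← map_mul, h2, h1, zero_add, Pmat_mul_D_mul hℓ,
    euler_subst hℓ, scal_mul, scal_mul, trace_scal, ← map_mul, Finset.mul_sum, Matrix.trace_sum]
  congr 1
  refine Finset.sum_congr rfl fun r _ => ?_
  rw [mul_scal, trace_scal, ← map_mul, trace_mapMatrix, h3]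

end DrinfeldSokolovD

namespace DrinfeldSokolovD

/-! ### Series with coefficients in the field of fractions -/

/-- The inclusion of the series with coefficients in the ring of parameters. -/
def incl : TSeries ParamSeries →+* TSeries ParamField :=
  MvPowerSeries.map (algebraMap ParamSeries ParamField)

theorem incl_injective : Function.Injective incl := by
  intro f g h
  ext1 T
  have h1 := congrArg (MvPowerSeries.coeff T) h
  rw [incl, MvPowerSeries.coeff_map, MvPowerSeries.coeff_map] at h1
  exact IsFractionRing.injective ParamSeries ParamField h1

/-- Elements of the field of fractions as constant series. -/
def cF : ParamField →+* TSeries ParamField := MvPowerSeries.C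

/-- The inclusion of the parameter series into their field of fractions. -/
def frac : ParamSeries →+* ParamField := algebraMap ParamSeries ParamField

theorem frac_ne_zero {a : ParamSeries} (h : a ≠ 0) : frac a ≠ 0 := fun h0 =>
  h (IsFractionRing.injective ParamSeries ParamField (h0.trans (map_zero _).symm))

theorem incl_C (a : ParamSeries) : incl (MvPowerSeries.C a) = cF (frac a) :=
  MvPowerSeries.map_C _ _

theorem cF_cancel {x : ParamField} (hx : x ≠ 0) {f g : TSeries ParamField}
    (h : cF x * f = cF x * g) : f = g := by
  have h1 := congrArg (cF x⁻¹ * ·) h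
  simp only [← mul_assoc, ← map_mul, inv_mul_cancel₀ hx, map_one, one_mul] at h1
  exact h1

variable {ℓ : ℕ}

/-- `∇_q F = G`, for series that have a common denominator. -/
def HasNabla (ℓ : ℕ) (q : Param) (F G : TSeries ParamField) : Prop :=
  ∃ d : ParamSeries, d ≠ 0 ∧ ∃ f : TSeries ParamSeries,
    incl f = cF (frac d) * F ∧ incl (nab ℓ q f) = cF (frac d) * G

namespace HasNabla

variable {q : Param} {F F' G G' : TSeries ParamField}

theorem incl (f : TSeries ParamSeries) : HasNabla ℓ q (incl f) (DrinfeldSokolovD.incl (nab ℓ q f)) :=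
  ⟨1, one_ne_zero, f, by rw [map_one, map_one, one_mul], by rw [map_one, map_one, one_mul]⟩

theorem nab_C_mul (hℓ : 4 ≤ ℓ) (d : ParamSeries) (f : TSeries ParamSeries) :
    nab ℓ q (MvPowerSeries.C d * f) = MvPowerSeries.C d * nab ℓ q f := by
  rw [(isDeriv_nab hℓ q).mul, nab_C hℓ, zero_mul, zero_add]

/-- Denominators are constant in the times, so ∇_q commutes with multiplication by them;
cross-multiplying two presentations compares the derivatives. -/
theorem unique (hℓ : 4 ≤ ℓ) (h : HasNabla ℓ q F G) (h' : HasNabla ℓ q F G') : G = G' := by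
  obtain ⟨d, hd, f, h1, h2⟩ := h
  obtain ⟨d', hd', f', h1', h2'⟩ := h'
  have e : MvPowerSeries.C d' * f = MvPowerSeries.C d * f' := by
    apply incl_injective
    rw [map_mul, map_mul, incl_C, incl_C, h1, h1']
    ring
  have e2 := congrArg (fun g => DrinfeldSokolovD.incl (nab ℓ q g)) e
  simp only [nab_C_mul hℓ, map_mul, incl_C, h2, h2'] at e2
  rw [mul_left_comm] at e2
  exact cF_cancel (frac_ne_zero hd') (cF_cancel (frac_ne_zero hd) e2)

theorem add (hℓ : 4 ≤ ℓ) (h : HasNabla ℓ q F G) (h' : HasNabla ℓ q F' G') :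
    HasNabla ℓ q (F + F') (G + G') := by
  obtain ⟨d, hd, f, h1, h2⟩ := h
  obtain ⟨d', hd', f', h1', h2'⟩ := h'
  refine ⟨d * d', mul_ne_zero hd hd', MvPowerSeries.C d' * f + MvPowerSeries.C d * f', ?_, ?_⟩
  · simp only [map_add, map_mul, incl_C, h1, h1']
    ring
  · rw [(isDeriv_nab hℓ q).add, nab_C_mul hℓ, nab_C_mul hℓ]
    simp only [map_add, map_mul, incl_C, h2, h2']
    ring

theorem mul (hℓ : 4 ≤ ℓ) (h : HasNabla ℓ q F G) (h' : HasNabla ℓ q F' G') :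
    HasNabla ℓ q (F * F') (G * F' + F * G') := by
  obtain ⟨d, hd, f, h1, h2⟩ := h
  obtain ⟨d', hd', f', h1', h2'⟩ := h'
  refine ⟨d * d', mul_ne_zero hd hd', f * f', ?_, ?_⟩
  · simp only [map_mul, h1, h1']
    ring
  · rw [(isDeriv_nab hℓ q).mul]
    simp only [map_add, map_mul, h1, h1', h2, h2']
    ring

theorem const (hℓ : 4 ≤ ℓ) (x : ParamField) : HasNabla ℓ q (cF x) 0 := by
  obtain ⟨n, d, hd, rfl⟩ := IsFractionRing.div_surjective (A := ParamSeries) x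
  have hd' : d ≠ 0 := nonZeroDivisors.ne_zero hd
  refine ⟨d, hd', MvPowerSeries.C n, ?_, ?_⟩
  · rw [incl_C, ← map_mul]
    congr 1
    exact (mul_div_cancel₀ _ (frac_ne_zero hd')).symm
  · rw [nab_C hℓ, map_zero, mul_zero]

theorem zero (hℓ : 4 ≤ ℓ) : HasNabla ℓ q 0 0 := by
  have h := const (q := q) hℓ 0
  rwa [map_zero] at h

theorem const_mul (hℓ : 4 ≤ ℓ) (x : ParamField) (h : HasNabla ℓ q F G) :
    HasNabla ℓ q (cF x * F) (cF x * G) := by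
  have h1 := (const hℓ x).mul hℓ h
  rwa [zero_mul, zero_add] at h1

theorem sum (hℓ : 4 ≤ ℓ) {ι : Type*} {s : Finset ι} {F G : ι → TSeries ParamField}
    (h : ∀ i ∈ s, HasNabla ℓ q (F i) (G i)) : HasNabla ℓ q (∑ i ∈ s, F i) (∑ i ∈ s, G i) := by
  classical
  induction s using Finset.induction_on with
  | empty => simpa using zero hℓ
  | insert a s ha ih =>
    rw [Finset.sum_insert ha, Finset.sum_insert ha]
    exact (h a (Finset.mem_insert_self a s)).add hℓ
      (ih fun i hi => h i (Finset.mem_insert_of_mem hi))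

theorem list_sum (hℓ : 4 ≤ ℓ) {ι : Type*} {F G : ι → TSeries ParamField} (l : List ι)
    (h : ∀ i ∈ l, HasNabla ℓ q (F i) (G i)) : HasNabla ℓ q (l.map F).sum (l.map G).sum := by
  induction l with
  | nil => exact zero hℓ
  | cons a l ih =>
    rw [List.map_cons, List.map_cons, List.sum_cons, List.sum_cons]
    exact (h a List.mem_cons_self).add hℓ (ih fun i hi => h i (List.mem_cons_of_mem a hi))

end HasNabla

/-- `∇_q A = B` for matrices. -/
def MatHasNabla (q : Param) (A B : Mat ℓ (TSeries ParamField)) : Prop :=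
  ∀ i j, HasNabla ℓ q (A i j) (B i j)

namespace MatHasNabla

variable {q : Param} {A A' B B' : Mat ℓ (TSeries ParamField)}

theorem mul (hℓ : 4 ≤ ℓ) (h : MatHasNabla q A B) (h' : MatHasNabla q A' B') :
    MatHasNabla q (A * A') (B * A' + A * B') := fun i j => by
  rw [Matrix.mul_apply, Matrix.add_apply, Matrix.mul_apply, Matrix.mul_apply,
    ← Finset.sum_add_distrib]
  exact HasNabla.sum hℓ fun k _ => (h i k).mul hℓ (h' k j)

theorem scal (hℓ : 4 ≤ ℓ) (x : ParamField) (h : MatHasNabla q A B) :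
    MatHasNabla q (scal (cF x) A) (scal (cF x) B) := fun i j => (h i j).const_mul hℓ x

theorem trace (hℓ : 4 ≤ ℓ) (h : MatHasNabla q A B) : HasNabla ℓ q A.trace B.trace :=
  HasNabla.sum hℓ fun i _ => h i i

end MatHasNabla

/-! ### Substitution of parameters -/

theorem substPow_ofPowerSeries (hℓ : 4 ≤ ℓ) (a : PowerSeries ℂ) :
    substPow (cox ℓ) (HahnSeries.ofPowerSeries ℤ ℂ a) =
      HahnSeries.ofPowerSeries ℤ ℂ (PowerSeries.expand (cox ℓ) (cox_pos hℓ).ne' a) := by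
  have hneg : ∀ (b : PowerSeries ℂ) (n : ℤ), n < 0 → (HahnSeries.ofPowerSeries ℤ ℂ b).coeff n = 0 := by
    intro b n hn
    rw [HahnSeries.ofPowerSeries_apply]
    refine HahnSeries.embDomain_of_notMem_range ?_
    rintro ⟨k, hk⟩
    have : (k : ℤ) = n := hk
    omega
  have hc := cox_pos hℓ
  ext n
  by_cases hn : ((cox ℓ : ℕ) : ℤ) ∣ n
  · obtain ⟨k, rfl⟩ := hn
    rw [substPow_coeff_mul hc]
    rcases lt_or_ge k 0 with h | h
    · rw [hneg _ _ h, hneg _ _ (mul_neg_of_pos_of_neg (by exact_mod_cast hc) h)]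
    · lift k to ℕ using h
      rw [HahnSeries.ofPowerSeries_apply_coeff, ← Nat.cast_mul,
        HahnSeries.ofPowerSeries_apply_coeff, PowerSeries.coeff_expand_mul]
  · rw [substPow_coeff_of_not_dvd hc _ hn]
    rcases lt_or_ge n 0 with h | h
    · rw [hneg _ _ h]
    · lift n to ℕ using h
      rw [HahnSeries.ofPowerSeries_apply_coeff, PowerSeries.coeff_expand_of_not_dvd]
      exact_mod_cast hn

theorem laurentAt_ofPowerSeries (p : Param) (a : PowerSeries ℂ) :
    laurentAt p (HahnSeries.ofPowerSeries ℤ ℂ a) = powerAt p a :=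
  IsFractionRing.lift_algebraMap (powerAt_injective p) a

theorem laurentAt_zmon_neg (p : Param) (n : ℕ) (c : ℂ) :
    laurentAt p (zmon (-n) c) = frac (MvPowerSeries.C c * MvPowerSeries.X p ^ n) := by
  have h : zmon (-n) c =
      HahnSeries.ofPowerSeries ℤ ℂ (PowerSeries.C c * PowerSeries.X ^ n) := by
    rw [map_mul, map_pow, HahnSeries.ofPowerSeries_X, HahnSeries.ofPowerSeries_C,
      HahnSeries.C_apply, HahnSeries.single_pow, HahnSeries.single_mul_single, zmon, neg_neg,
      zero_add, one_pow, mul_one, nsmul_one]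
  rw [h, laurentAt_ofPowerSeries]
  change algebraMap ParamSeries ParamField (MvPowerSeries.rename (R := ℂ)
    (Function.Embedding.punit (β := Param) p) (PowerSeries.C c * PowerSeries.X ^ n)) = _
  rw [map_mul, map_pow]
  have h1 : MvPowerSeries.rename (R := ℂ) (Function.Embedding.punit (β := Param) p)
    (PowerSeries.C c) = MvPowerSeries.C c := MvPowerSeries.rename_C _ _
  have h2 : MvPowerSeries.rename (R := ℂ) (Function.Embedding.punit (β := Param) p)
    PowerSeries.X = MvPowerSeries.X p := MvPowerSeries.rename_X _ _
  rw [h1, h2]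
  rfl

theorem frac_X_ne_zero (p : Param) : frac (MvPowerSeries.X p) ≠ 0 :=
  frac_ne_zero (by
    intro h
    have h1 := MvPowerSeries.coeff_index_single_self_X (R := ℂ) p
    rw [h, map_zero] at h1
    exact zero_ne_one h1)

theorem par_eq (p : Param) : par p = (frac (MvPowerSeries.X p))⁻¹ := rfl

theorem laurentAt_zmon_nat (p : Param) (n : ℕ) (c : ℂ) :
    laurentAt p (zmon n c) = frac (MvPowerSeries.C c) * par p ^ n := by
  have h1 : zmon n c * zmon (-n) 1 = zmon (-(0 : ℕ)) c := by
    rw [zmon_mul_zmon, mul_one, add_neg_cancel]; rfl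
  have h2 := congrArg (laurentAt p) h1
  rw [map_mul, laurentAt_zmon_neg, laurentAt_zmon_neg, pow_zero, mul_one, map_one, one_mul,
    map_pow] at h2
  rw [par_eq, inv_pow, ← h2, mul_assoc, mul_inv_cancel₀ (pow_ne_zero _ (frac_X_ne_zero p)), mul_one]

/-- The substitution of `p ^ h` for `z` in series depending on the times. -/
def evp (hℓ : 4 ≤ ℓ) (p : Param) : TSeries (PowerSeries ℂ) →+* TSeries ParamSeries :=
  MvPowerSeries.map (pw hℓ p)

theorem seriesAt_subst_laur (hℓ : 4 ≤ ℓ) (p : Param) (f : TSeries (PowerSeries ℂ)) :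
    seriesAt p (subst ℓ (laur f)) = incl (evp hℓ p f) := by
  ext1 T
  rw [seriesAt, subst, laur, incl, evp, MvPowerSeries.coeff_map, MvPowerSeries.coeff_map,
    MvPowerSeries.coeff_map, MvPowerSeries.coeff_map, MvPowerSeries.coeff_map,
    substPow_ofPowerSeries hℓ, laurentAt_ofPowerSeries]
  rfl

theorem seriesAt_C (p : Param) (a : InvLaurent) :
    seriesAt p (MvPowerSeries.C a) = cF (laurentAt p a) := MvPowerSeries.map_C _ _

theorem seriesAt_subst_zinv (hℓ : 4 ≤ ℓ) (p : Param) :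
    seriesAt p (subst ℓ zinv) = cF (frac (MvPowerSeries.X p ^ cox ℓ)) := by
  rw [← laur_X, seriesAt_subst_laur hℓ, evp, MvPowerSeries.map_C, pw_X, incl_C]

end DrinfeldSokolovD

namespace DrinfeldSokolovD

variable {ℓ : ℕ} {ξ : Mat ℓ (TSeries (PowerSeries ℂ))} (hℓ : 4 ≤ ℓ)

/-! ### The derivatives of the matrices `K` -/

section

open scoped MvPowerSeries.WithPiTopology

/-- Within a residue r the weight q^{-j} factors as q^{-hs} times q to minus the r-th exponent,
leaving a sum over s to which the telescoping applies. -/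
theorem nab_evp {q p : Param} {f : TSeries (PowerSeries ℂ)} {G : ℕ → TSeries ParamSeries}
    (h : ∀ r < nres ℓ q.2, HasSum (fun s => MvPowerSeries.C (MvPowerSeries.X q ^ (cox ℓ * s)) *
      evp hℓ p (MvPowerSeries.pderiv (PowerSeries ℂ) (pexp q.2 (nres ℓ q.2 * s + r)) f)) (G r)) :
    nab ℓ q (evp hℓ p f) = ∑ r ∈ Finset.range (nres ℓ q.2),
      MvPowerSeries.C (MvPowerSeries.X q ^ (pexp q.2 r).val ℓ) * G r := by
  refine (hasSum_nab hℓ q _).unique (hasSum_of_residues (nres_pos hℓ _) fun r hr => ?_)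
  refine hasSum_of_eq (fun s => ?_) ((h r hr).mul_left _)
  rw [val_pexp_shift hℓ, evp, pderiv_map, pow_add, map_mul]
  ring

theorem hasSum_coeffwise_tele (q p : Param) (f : TSeries (PowerSeries ℂ)) :
    HasSum (fun s => MvPowerSeries.C (MvPowerSeries.X q ^ (cox ℓ * s)) *
      evp hℓ p (coeffwise (negShift s) f)) (coeffwise (tele hℓ q p) f) := by
  rw [MvPowerSeries.WithPiTopology.hasSum_iff_hasSum_coeff]
  intro T
  refine hasSum_of_eq (fun s => ?_) (hasSum_tele hℓ q p (MvPowerSeries.coeff T f))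
  rw [MvPowerSeries.coeff_C_mul, evp, MvPowerSeries.coeff_map, coeff_coeffwise]

theorem hasSum_coeffwise_teleE (q p : Param) (f : TSeries (PowerSeries ℂ)) :
    HasSum (fun s => MvPowerSeries.C (MvPowerSeries.X q ^ (cox ℓ * s)) *
      evp hℓ p (coeffwise (fun a => eulerP (negShift s a)) f)) (coeffwise (teleE hℓ q p) f) := by
  rw [MvPowerSeries.WithPiTopology.hasSum_iff_hasSum_coeff]
  intro T
  refine hasSum_of_eq (fun s => ?_) (hasSum_teleE hℓ q p (MvPowerSeries.coeff T f))
  rw [MvPowerSeries.coeff_C_mul, evp, MvPowerSeries.coeff_map, coeff_coeffwise]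

/-- The sum of `z⁻¹ Θ Λ_j Θ⁻¹` over the exponents `j` below the Coxeter number of the kind of `q`,
with weights `q ^ (-j)`, under a map of the coefficients. -/
def wsum (ξ : Mat ℓ (TSeries (PowerSeries ℂ))) (q : Param)
    (φ : TSeries (PowerSeries ℂ) → TSeries ParamSeries) : Mat ℓ (TSeries ParamSeries) :=
  ∑ r ∈ Finset.range (nres ℓ q.2),
    scal (MvPowerSeries.C (MvPowerSeries.X q ^ (pexp q.2 r).val ℓ)) ((red ξ q.2 r).map φ)

theorem wsum_apply (q : Param) (φ : TSeries (PowerSeries ℂ) → TSeries ParamSeries)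
    (i j : Fin (2 * ℓ)) : wsum ξ q φ i j = ∑ r ∈ Finset.range (nres ℓ q.2),
      MvPowerSeries.C (MvPowerSeries.X q ^ (pexp q.2 r).val ℓ) * φ (red ξ q.2 r i j) := by
  rw [wsum, Matrix.sum_apply]
  rfl

/-- The Lax equations, summed with weights q^{-j}: only the negative parts depend on s, and their
sum is `tele`. -/
theorem nab_red (hneg : IsNegative ξ) (hsol : IsSolution ℓ ξ) (q p : Param) {b : Bool} {r : ℕ}
    (hr : r < nres ℓ b) : ((red ξ b r).map (evp hℓ p)).map (nab ℓ q) =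
      wsum ξ q (coeffwise (tele hℓ q p)) * (red ξ b r).map (evp hℓ p) -
        (red ξ b r).map (evp hℓ p) * wsum ξ q (coeffwise (tele hℓ q p)) := by
  ext1 i j
  rw [Matrix.map_apply, Matrix.map_apply, nab_evp hℓ (G := fun r' =>
    ∑ k, (coeffwise (tele hℓ q p) (red ξ q.2 r' i k) * evp hℓ p (red ξ b r k j) -
      evp hℓ p (red ξ b r i k) * coeffwise (tele hℓ q p) (red ξ q.2 r' k j)))]
  · simp only [Matrix.sub_apply, Matrix.mul_apply, wsum_apply, Matrix.map_apply, Finset.mul_sum,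
      Finset.sum_mul, ← Finset.sum_sub_distrib]
    rw [Finset.sum_comm]
    refine Finset.sum_congr rfl fun k _ => Finset.sum_congr rfl fun r' _ => ?_
    ring
  · intro r' hr'
    have h1 : ∀ s, MvPowerSeries.pderiv (PowerSeries ℂ) (pexp q.2 (nres ℓ q.2 * s + r'))
        (red ξ b r i j) = ∑ k, (coeffwise (negShift s) (red ξ q.2 r' i k) * red ξ b r k j -
          red ξ b r i k * coeffwise (negShift s) (red ξ q.2 r' k j)) := by
      intro s
      have h := congrFun (congrFun (pderiv_red hℓ hneg hsol hr q.2 s r') i) j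
      rw [Matrix.sub_apply, Matrix.mul_apply, Matrix.mul_apply, ← Finset.sum_sub_distrib] at h
      exact h
    refine hasSum_of_eq (fun s => ?_) (hasSum_sum fun k (_ : k ∈ Finset.univ) =>
      ((hasSum_coeffwise_tele hℓ q p (red ξ q.2 r' i k)).mul_right (evp hℓ p (red ξ b r k j))).sub
        ((hasSum_coeffwise_tele hℓ q p (red ξ q.2 r' k j)).mul_left (evp hℓ p (red ξ b r i k))))
    rw [h1, map_sum, Finset.mul_sum]
    refine Finset.sum_congr rfl fun k _ => ?_
    rw [map_sub, map_mul, map_mul]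
    ring

theorem nab_redLogd (hneg : IsNegative ξ) (hsol : IsSolution ℓ ξ) (q p : Param) {b : Bool} {r : ℕ}
    (hr : r < nres ℓ b) : nab ℓ q (evp hℓ p (redLogd ξ b r)) =
      (wsum ξ q (coeffwise (teleE hℓ q p)) * (red ξ b r).map (evp hℓ p)).trace := by
  rw [nab_evp hℓ (G := fun r' => ∑ i, ∑ k,
    coeffwise (teleE hℓ q p) (red ξ q.2 r' i k) * evp hℓ p (red ξ b r k i))]
  · simp only [Matrix.trace, Matrix.diag_apply, Matrix.mul_apply, wsum_apply, Matrix.map_apply,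
      Finset.mul_sum, Finset.sum_mul]
    rw [Finset.sum_comm]
    refine Finset.sum_congr rfl fun i _ => ?_
    rw [Finset.sum_comm]
    refine Finset.sum_congr rfl fun k _ => Finset.sum_congr rfl fun r' _ => ?_
    ring
  · intro r' hr'
    refine hasSum_of_eq (fun s => ?_) (hasSum_sum fun i (_ : i ∈ Finset.univ) =>
      hasSum_sum fun k (_ : k ∈ Finset.univ) =>
        (hasSum_coeffwise_teleE hℓ q p (red ξ q.2 r' i k)).mul_right (evp hℓ p (red ξ b r k i)))
    rw [pderiv_redLogd hℓ hneg hsol hr]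
    simp only [Matrix.trace, Matrix.diag_apply, Matrix.mul_apply, Matrix.map_apply, map_sum,
      map_mul, Finset.mul_sum, mul_assoc]

/-- The series `∑ a_{k+1} q ^ (-h k)`. -/
def tailSum (q : Param) (a : PowerSeries ℂ) : ParamSeries :=
  coeffSum fun s => MvPowerSeries.X q ^ (cox ℓ * s) * MvPowerSeries.C (PowerSeries.coeff (s + 1) a)

theorem X_pow_mul_tailSum (q : Param) (a : PowerSeries ℂ) :
    MvPowerSeries.X q ^ cox ℓ * tailSum (ℓ := ℓ) q a =
      pw hℓ q a - MvPowerSeries.C (PowerSeries.coeff 0 a) := by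
  have h1 := (hasSum_nat_add_iff' 1).mpr (hasSum_pw hℓ q a)
  rw [Finset.sum_range_one, mul_zero, pow_zero, one_mul] at h1
  refine HasSum.unique ?_ h1
  refine hasSum_of_eq (fun s => ?_) ((hasSum_X_pow_mul q (le_cox_mul hℓ) _).mul_left
    (MvPowerSeries.X q ^ cox ℓ))
  rw [mul_add (cox ℓ) s 1, mul_one, pow_add]
  ring

/-- The factor q^{-h} compensates the index s + 1 in `pderiv_logTau`. No correction arises because
`redLogd` has zero constant term in 1/z. -/
theorem nab_logTau (hneg : IsNegative ξ) {logτ : TSeries ℂ} (hτ : IsLogTau ℓ ξ logτ) (q : Param) :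
    MvPowerSeries.C (MvPowerSeries.X q ^ cox ℓ) *
        nab ℓ q (MvPowerSeries.map MvPowerSeries.C logτ) =
      -(MvPowerSeries.C (MvPowerSeries.C kappa) * ∑ r ∈ Finset.range (nres ℓ q.2),
        MvPowerSeries.C (MvPowerSeries.X q ^ (pexp q.2 r).val ℓ) *
          evp hℓ q (redLogd ξ q.2 r)) := by
  have h1 : nab ℓ q (MvPowerSeries.map MvPowerSeries.C logτ) =
      ∑ r ∈ Finset.range (nres ℓ q.2), MvPowerSeries.C (MvPowerSeries.X q ^ (pexp q.2 r).val ℓ) *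
        -(MvPowerSeries.C (MvPowerSeries.C kappa) * coeffwise (tailSum (ℓ := ℓ) q) (redLogd ξ q.2 r)) := by
    refine (hasSum_nab hℓ q _).unique (hasSum_of_residues (nres_pos hℓ _) fun r hr => ?_)
    have h2 : HasSum (fun s => MvPowerSeries.C (MvPowerSeries.X q ^ (cox ℓ * s)) *
        coeffwise (fun a => MvPowerSeries.C (PowerSeries.coeff (s + 1) a)) (redLogd ξ q.2 r))
        (coeffwise (tailSum (ℓ := ℓ) q) (redLogd ξ q.2 r)) := by
      rw [MvPowerSeries.WithPiTopology.hasSum_iff_hasSum_coeff]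
      intro T
      refine hasSum_of_eq (fun s => ?_) (hasSum_X_pow_mul q (le_cox_mul hℓ) _)
      rw [MvPowerSeries.coeff_C_mul]
      rfl
    refine hasSum_of_eq (fun s => ?_) (((h2.mul_left _).neg).mul_left _)
    have h3 : MvPowerSeries.pderiv ParamSeries (pexp q.2 (nres ℓ q.2 * s + r))
        (MvPowerSeries.map MvPowerSeries.C logτ) = -(MvPowerSeries.C (MvPowerSeries.C kappa) *
          coeffwise (fun a => MvPowerSeries.C (PowerSeries.coeff (s + 1) a)) (redLogd ξ q.2 r)) := by
      rw [pderiv_map]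
      ext1 T
      rw [MvPowerSeries.coeff_map, pderiv_logTau hℓ hneg hτ, map_neg, map_neg,
        MvPowerSeries.coeff_C_mul, map_mul]
      rfl
    rw [h3, val_pexp_shift hℓ, pow_add, map_mul]
    ring
  rw [h1, Finset.mul_sum, Finset.mul_sum, ← Finset.sum_neg_distrib]
  refine Finset.sum_congr rfl fun r hr => ?_
  have h4 : MvPowerSeries.C (MvPowerSeries.X q ^ cox ℓ) *
      coeffwise (tailSum (ℓ := ℓ) q) (redLogd ξ q.2 r) = evp hℓ q (redLogd ξ q.2 r) := by
    ext1 T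
    rw [MvPowerSeries.coeff_C_mul, coeff_coeffwise, X_pow_mul_tailSum hℓ,
      coeff_zero_redLogd hℓ hneg (Finset.mem_range.mp hr), map_zero, sub_zero, evp,
      MvPowerSeries.coeff_map]
  rw [← h4]
  ring

end

/-- The matrix `K(q)` multiplied by `q ^ (-h)`. -/
def Khat (ξ : Mat ℓ (TSeries (PowerSeries ℂ))) (q : Param) : Mat ℓ (TSeries ParamSeries) :=
  wsum ξ q (evp hℓ q)

/-- `K_1(ζ_i)` or `K_2(ζ̂_i)`. -/
def Kpar (ξ : Mat ℓ (TSeries (PowerSeries ℂ))) (q : Param) : Mat ℓ (TSeries ParamField) :=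
  (Kmat ℓ ξ q.2).map (seriesAt q)

theorem Khat_eq (hneg : IsNegative ξ) (q : Param) :
    incl.mapMatrix (Khat hℓ ξ q) = scal (cF (frac (MvPowerSeries.X q ^ cox ℓ))) (Kpar ξ q) := by
  have h1 : Kpar ξ q = (seriesAt q).mapMatrix (Kmat ℓ ξ q.2) := rfl
  rw [h1, Kmat_eq hℓ hneg, map_sum, scal_sum, Khat, wsum, map_sum]
  refine Finset.sum_congr rfl fun r hr => ?_
  have h2 : (seriesAt q).mapMatrix ((subst ℓ).mapMatrix (scal zinv (dressed ξ (pexp q.2 r)))) =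
      incl.mapMatrix ((red ξ q.2 r).map (evp hℓ q)) := by
    rw [← toLoop_red hℓ hneg (Finset.mem_range.mp hr)]
    ext1 i j
    exact seriesAt_subst_laur hℓ q _
  have h3 : ∀ (a : TSeries InvLaurent) (A : Loop ℓ), (seriesAt q).mapMatrix (scal a A) =
      scal (seriesAt q a) ((seriesAt q).mapMatrix A) := fun a A => map_scal _ a A
  have h4 : ∀ (a : TSeries InvLaurent) (A : Loop ℓ), (subst ℓ).mapMatrix (scal a A) =
      scal (subst ℓ a) ((subst ℓ).mapMatrix A) := fun a A => map_scal _ a A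
  rw [h4, h3, seriesAt_subst_zinv hℓ] at h2
  have h2' : ∀ x : TSeries ParamField, scal (cF (frac (MvPowerSeries.X q ^ cox ℓ))) (scal x
      ((seriesAt q).mapMatrix ((subst ℓ).mapMatrix (dressed ξ (pexp q.2 r))))) =
      scal x (incl.mapMatrix ((red ξ q.2 r).map (evp hℓ q))) := fun x => by
    rw [← h2, scal_scal, scal_scal, mul_comm x]
  rw [h3, seriesAt_C, laurentAt_zmon_neg, map_one, one_mul, h2']
  exact (map_scal incl _ _).trans (by rw [incl_C]; rfl)

/-- `tele_eq` for every coefficient in the times. The last term collects the constant terms of z⁻¹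
R_j; it does not depend on p apart from its factor and becomes E(q). -/
theorem wsum_tele (q p : Param) :
    scal (MvPowerSeries.C (MvPowerSeries.X q ^ cox ℓ *
        (MvPowerSeries.X p ^ cox ℓ - MvPowerSeries.X q ^ cox ℓ)))
      (wsum ξ q (coeffwise (tele hℓ q p))) =
    scal (MvPowerSeries.C (MvPowerSeries.X q ^ cox ℓ)) (wsum ξ q (evp hℓ p)) -
      scal (MvPowerSeries.C (MvPowerSeries.X p ^ cox ℓ)) (Khat hℓ ξ q) +
      scal (MvPowerSeries.C (MvPowerSeries.X p ^ cox ℓ - MvPowerSeries.X q ^ cox ℓ))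
        (wsum ξ q (coeffwise fun a => MvPowerSeries.C (PowerSeries.coeff 0 a))) := by
  ext1 i j
  simp only [Matrix.add_apply, Matrix.sub_apply, scal_apply, Khat, wsum_apply, Finset.mul_sum]
  rw [← Finset.sum_sub_distrib, ← Finset.sum_add_distrib]
  refine Finset.sum_congr rfl fun r _ => ?_
  have h : MvPowerSeries.C (MvPowerSeries.X q ^ cox ℓ *
        (MvPowerSeries.X p ^ cox ℓ - MvPowerSeries.X q ^ cox ℓ)) *
      coeffwise (tele hℓ q p) (red ξ q.2 r i j) =
      MvPowerSeries.C (MvPowerSeries.X q ^ cox ℓ) * evp hℓ p (red ξ q.2 r i j) -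
        MvPowerSeries.C (MvPowerSeries.X p ^ cox ℓ) * evp hℓ q (red ξ q.2 r i j) +
        MvPowerSeries.C (MvPowerSeries.X p ^ cox ℓ - MvPowerSeries.X q ^ cox ℓ) *
          coeffwise (fun a => MvPowerSeries.C (PowerSeries.coeff 0 a)) (red ξ q.2 r i j) := by
    ext1 T
    rw [MvPowerSeries.coeff_C_mul, coeff_coeffwise, map_add, map_sub, MvPowerSeries.coeff_C_mul,
      MvPowerSeries.coeff_C_mul, MvPowerSeries.coeff_C_mul, coeff_coeffwise, evp, evp,
      MvPowerSeries.coeff_map, MvPowerSeries.coeff_map]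
    exact tele_eq hℓ q p _
  linear_combination MvPowerSeries.C (MvPowerSeries.X q ^ (pexp q.2 r).val ℓ) * h

theorem map_nab_Khat (hneg : IsNegative ξ) (hsol : IsSolution ℓ ξ) (q p : Param) :
    (Khat hℓ ξ p).map (nab ℓ q) = wsum ξ q (coeffwise (tele hℓ q p)) * Khat hℓ ξ p -
      Khat hℓ ξ p * wsum ξ q (coeffwise (tele hℓ q p)) := by
  rw [Khat, wsum, (isDeriv_nab hℓ q).map_sum, Finset.mul_sum, Finset.sum_mul,
    ← Finset.sum_sub_distrib]
  refine Finset.sum_congr rfl fun r hr => ?_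
  rw [(isDeriv_nab hℓ q).map_scal_of_const (nab_C hℓ q _),
    nab_red hℓ hneg hsol q p (Finset.mem_range.mp hr), mul_scal, scal_mul, scal_sub]

/-- All dressed generators are evaluated at the same point p^h here, whatever the weights, so they
commute. -/
theorem wsum_comm (hneg : IsNegative ξ) (q p : Param) :
    wsum ξ q (evp hℓ p) * Khat hℓ ξ p = Khat hℓ ξ p * wsum ξ q (evp hℓ p) := by
  rw [Khat, wsum, wsum, Finset.sum_mul_sum, Finset.sum_mul_sum, Finset.sum_comm]
  refine Finset.sum_congr rfl fun r hr => Finset.sum_congr rfl fun r' hr' => ?_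
  have h : (red ξ q.2 r').map (evp hℓ p) * (red ξ p.2 r).map (evp hℓ p) =
      (red ξ p.2 r).map (evp hℓ p) * (red ξ q.2 r').map (evp hℓ p) := by
    have h1 := congrArg (evp hℓ p).mapMatrix
      (red_comm hℓ hneg (Finset.mem_range.mp hr') (Finset.mem_range.mp hr))
    rwa [map_mul, map_mul] at h1
  rw [scal_mul, mul_scal, scal_scal, scal_mul, mul_scal, scal_scal, h,
    mul_comm (MvPowerSeries.C (MvPowerSeries.X q ^ _))]

/-- `p ^ h / (q ^ h - p ^ h)`. -/
def sfac (ℓ : ℕ) (p q : Param) : ParamField :=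
  frac (MvPowerSeries.X q ^ cox ℓ) /
    (frac (MvPowerSeries.X p ^ cox ℓ) - frac (MvPowerSeries.X q ^ cox ℓ))

/-- The part of `∇_q K(p)` that does not depend on `p`. -/
def efac (ξ : Mat ℓ (TSeries (PowerSeries ℂ))) (q : Param) : Mat ℓ (TSeries ParamField) :=
  scal (cF (frac (MvPowerSeries.X q ^ cox ℓ))⁻¹) (incl.mapMatrix
    (wsum ξ q (coeffwise fun a => MvPowerSeries.C (PowerSeries.coeff 0 a))))

theorem X_pow_injective {n : ℕ} (hn : 0 < n) {p q : Param}
    (h : (MvPowerSeries.X p ^ n : ParamSeries) = MvPowerSeries.X q ^ n) : p = q := by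
  classical
  by_contra hpq
  have h1 := congrArg (MvPowerSeries.coeff (Finsupp.single p n)) h
  rw [MvPowerSeries.coeff_X_pow, MvPowerSeries.coeff_X_pow, if_pos rfl, if_neg] at h1
  · exact one_ne_zero h1
  · intro h2
    have := congrArg (fun f => f p) h2
    simp only [Finsupp.single_eq_same] at this
    rw [Finsupp.single_eq_of_ne hpq] at this
    omega

theorem frac_sub_ne_zero (hℓ : 4 ≤ ℓ) {p q : Param} (h : p ≠ q) :
    frac (MvPowerSeries.X p ^ cox ℓ) - frac (MvPowerSeries.X q ^ cox ℓ) ≠ 0 := by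
  rw [← map_sub]
  exact frac_ne_zero (sub_ne_zero.mpr fun h1 => h (X_pow_injective (cox_pos hℓ) h1))

theorem frac_X_pow_ne_zero (p : Param) (n : ℕ) : frac (MvPowerSeries.X p ^ n) ≠ 0 := by
  rw [map_pow]
  exact pow_ne_zero _ (frac_X_ne_zero p)

/-- Of the three terms of `wsum_tele`, the one evaluated at p commutes with K(p) and drops out. The
other two give the commutators with K(q) and E(q). -/
theorem matHasNabla_Kpar (hℓ : 4 ≤ ℓ) (hneg : IsNegative ξ) (hsol : IsSolution ℓ ξ) {q p : Param} (hqp : q ≠ p) :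
    MatHasNabla q (Kpar ξ p) (scal (cF (sfac ℓ q p)) (Kpar ξ q * Kpar ξ p - Kpar ξ p * Kpar ξ q) +
      (efac ξ q * Kpar ξ p - Kpar ξ p * efac ξ q)) := by
  set V : ParamSeries := MvPowerSeries.X p ^ cox ℓ with hV
  set U : ParamSeries := MvPowerSeries.X q ^ cox ℓ with hU
  have hVne : frac V ≠ 0 := frac_X_pow_ne_zero _ _
  have hUne : frac U ≠ 0 := frac_X_pow_ne_zero _ _
  have hUV : frac U - frac V ≠ 0 := frac_sub_ne_zero hℓ hqp
  have hV0 : V ≠ 0 := fun h => hVne (by rw [h, map_zero])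
  set E := wsum ξ q (coeffwise fun a => MvPowerSeries.C (PowerSeries.coeff 0 a)) with hE
  have h1 : scal (MvPowerSeries.C (U * (V - U))) ((Khat hℓ ξ p).map (nab ℓ q)) =
      -scal (MvPowerSeries.C V) (Khat hℓ ξ q * Khat hℓ ξ p - Khat hℓ ξ p * Khat hℓ ξ q) +
        scal (MvPowerSeries.C (V - U)) (E * Khat hℓ ξ p - Khat hℓ ξ p * E) := by
    rw [map_nab_Khat hℓ hneg hsol, scal_sub, ← scal_mul, ← mul_scal, wsum_tele hℓ]
    simp only [add_mul, sub_mul, mul_add, mul_sub, scal_mul, mul_scal, wsum_comm hℓ hneg,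
      scal_sub]
    abel
  have h2 := congrArg incl.mapMatrix h1
  have hs : ∀ (a : TSeries ParamSeries) (A : Mat ℓ (TSeries ParamSeries)),
      incl.mapMatrix (scal a A) = scal (incl a) (incl.mapMatrix A) := fun a A => map_scal _ a A
  simp only [map_add, map_neg, map_sub, map_mul, hs, Khat_eq hℓ hneg, incl_C] at h2
  have h3 : incl.mapMatrix ((Khat hℓ ξ p).map (nab ℓ q)) = scal (cF (frac V))
      (scal (cF (sfac ℓ q p)) (Kpar ξ q * Kpar ξ p - Kpar ξ p * Kpar ξ q) +
        (efac ξ q * Kpar ξ p - Kpar ξ p * efac ξ q)) := by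
    ext1 i j
    refine cF_cancel (mul_ne_zero hUne hUV) ?_
    have h4 := congrFun (congrFun h2 i) j
    have h5 : cF (sfac ℓ q p) * (cF (frac U) - cF (frac V)) = cF (frac V) := by
      rw [← map_sub, ← map_mul]
      exact congrArg cF (div_mul_cancel₀ _ hUV)
    have h6 : cF (frac U)⁻¹ * cF (frac U) = 1 := by
      rw [← map_mul, inv_mul_cancel₀ hUne, map_one]
    simp only [efac, scal_mul, mul_scal, Matrix.add_apply, Matrix.sub_apply, Matrix.neg_apply,
      scal_apply, map_mul, map_sub] at h4 ⊢
    linear_combination -h4 -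
      cF (frac U) * cF (frac V) * ((Kpar ξ q * Kpar ξ p) i j - (Kpar ξ p * Kpar ξ q) i j) * h5 -
      (cF (frac U) - cF (frac V)) * cF (frac V) *
        ((incl.mapMatrix E * Kpar ξ p) i j - (Kpar ξ p * incl.mapMatrix E) i j) * h6
  intro i j
  refine ⟨V, hV0, Khat hℓ ξ p i j, ?_, ?_⟩
  · exact congrFun (congrFun (Khat_eq hℓ hneg p) i) j
  · exact congrFun (congrFun h3 i) j

end DrinfeldSokolovD

namespace DrinfeldSokolovD

variable {ℓ : ℕ} {ξ : Mat ℓ (TSeries (PowerSeries ℂ))}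

/-! ### The two-point function -/

/-- Abel summation, a weighted companion of the geometric sum. -/
theorem sum_range_mul_geom {R : Type*} [CommRing R] (a b : R) (N : ℕ) :
    (∑ r ∈ Finset.range N, (r : R) * (a ^ r * b ^ (N - 1 - r))) * (b - a) =
      a * (∑ r ∈ Finset.range N, a ^ r * b ^ (N - 1 - r)) - N * a ^ N := by
  induction N with
  | zero => simp
  | succ N ih =>
    have h : ∀ r ∈ Finset.range N, b ^ (N + 1 - 1 - r) = b * b ^ (N - 1 - r) := fun r hr => by
      rw [← pow_succ']
      congr 1
      have := Finset.mem_range.mp hr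
      omega
    have h1 : ∑ r ∈ Finset.range N, (r : R) * (a ^ r * b ^ (N + 1 - 1 - r)) =
        b * ∑ r ∈ Finset.range N, (r : R) * (a ^ r * b ^ (N - 1 - r)) := by
      rw [Finset.mul_sum]
      exact Finset.sum_congr rfl fun r hr => by rw [h r hr]; ring
    have h2 : ∑ r ∈ Finset.range N, a ^ r * b ^ (N + 1 - 1 - r) =
        b * ∑ r ∈ Finset.range N, a ^ r * b ^ (N - 1 - r) := by
      rw [Finset.mul_sum]
      exact Finset.sum_congr rfl fun r hr => by rw [h r hr]; ring
    rw [Finset.sum_range_succ, Finset.sum_range_succ, h1, h2, Nat.add_sub_cancel, Nat.sub_self,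
      pow_zero]
    push_cast
    linear_combination b * ih

/-- The closed form of the correction for the odd exponents 2r + 1, with a = ζ₁^{-2}, b = ζ₂^{-2}
and N = ℓ - 1. The terms proportional to N cancel between the geometric sum and its weighted
companion. -/
theorem odd_correction {R : Type*} [CommRing R] (a b : R) (N : ℕ) :
    (∑ r ∈ Finset.range N, a ^ r * b ^ (N - 1 - r) *
        ((2 * r + 1) * (b ^ N - a ^ N) + 2 * N * a ^ N)) * (b - a) ^ 2 =
      (b ^ N - a ^ N) ^ 2 * (a + b) := by
  have hG : (∑ r ∈ Finset.range N, a ^ r * b ^ (N - 1 - r)) * (b - a) = b ^ N - a ^ N := by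
    linear_combination -geom_sum₂_mul a b N
  have hH := sum_range_mul_geom a b N
  have e : ∑ r ∈ Finset.range N, a ^ r * b ^ (N - 1 - r) *
        ((2 * r + 1) * (b ^ N - a ^ N) + 2 * N * a ^ N) =
      2 * (b ^ N - a ^ N) * (∑ r ∈ Finset.range N, (r : R) * (a ^ r * b ^ (N - 1 - r))) +
        (b ^ N - a ^ N + 2 * N * a ^ N) * ∑ r ∈ Finset.range N, a ^ r * b ^ (N - 1 - r) := by
    rw [Finset.mul_sum, Finset.mul_sum, ← Finset.sum_add_distrib]
    exact Finset.sum_congr rfl fun r _ => by ring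
  rw [e]
  linear_combination 2 * (b ^ N - a ^ N) * (b - a) * hH + ((b ^ N - a ^ N) * (b + a) + 2 * N * a ^ N *
    (b - a)) * hG

/-- The rational part of the two-point function with its denominator cleared. -/
def corrSeries (ℓ : ℕ) (p q : Param) : ParamSeries :=
  ∑ r ∈ Finset.range (nres ℓ p.2), ∑ r' ∈ Finset.range (nres ℓ q.2),
    if p.2 = q.2 ∧ (pexp p.2 r).val ℓ + (pexp q.2 r').val ℓ = cox ℓ then
      MvPowerSeries.X p ^ (pexp p.2 r).val ℓ * MvPowerSeries.X q ^ (pexp q.2 r').val ℓ *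
        (((pexp p.2 r).val ℓ : ParamSeries) *
          (MvPowerSeries.X q ^ cox ℓ - MvPowerSeries.X p ^ cox ℓ) +
          (cox ℓ : ParamSeries) * MvPowerSeries.X p ^ cox ℓ)
    else 0

/-- The rational part of the two-point function. -/
def twoCorr (ℓ : ℕ) (p q : Param) : ParamField :=
  if p.2 = q.2 then
    if p.2 then ((ℓ : ParamField) - 1) * par p ^ (ℓ - 1) * par q ^ (ℓ - 1) *
      (par p ^ cox ℓ + par q ^ cox ℓ) / (par p ^ cox ℓ - par q ^ cox ℓ) ^ 2
    else par p * par q * (par p ^ 2 + par q ^ 2) / (par p ^ 2 - par q ^ 2) ^ 2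
  else 0

theorem corrSeries_true (hℓ : 4 ≤ ℓ) (i j : ℕ) : corrSeries ℓ (i, true) (j, true) =
    ((ℓ - 1 : ℕ) : ParamSeries) * (MvPowerSeries.X (i, true) * MvPowerSeries.X (j, true)) ^ (ℓ - 1) *
      (MvPowerSeries.X (i, true) ^ cox ℓ + MvPowerSeries.X (j, true) ^ cox ℓ) := by
  have h1 : (pexp true 0).val ℓ = ℓ - 1 := by simp [pexp, PosExp.val]
  have h2 : cox ℓ = 2 * (ℓ - 1) := cox_eq hℓ
  rw [corrSeries]
  simp only [nres, if_true, Finset.sum_range_one, h1]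
  rw [if_pos ⟨trivial, by omega⟩, mul_pow]
  have h3 : ((cox ℓ : ℕ) : ParamSeries) = 2 * ((ℓ - 1 : ℕ) : ParamSeries) := by
    rw [h2]; push_cast; ring
  rw [h3]
  ring

theorem corrSeries_false (hℓ : 4 ≤ ℓ) (i j : ℕ) : corrSeries ℓ (i, false) (j, false) *
    (MvPowerSeries.X (j, false) ^ 2 - MvPowerSeries.X (i, false) ^ 2) ^ 2 =
      (MvPowerSeries.X (j, false) ^ cox ℓ - MvPowerSeries.X (i, false) ^ cox ℓ) ^ 2 *
      (MvPowerSeries.X (i, false) * MvPowerSeries.X (j, false) *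
      (MvPowerSeries.X (i, false) ^ 2 + MvPowerSeries.X (j, false) ^ 2)) := by
  have h1 : ∀ r, (pexp false r).val ℓ = 2 * r + 1 := fun r => rfl
  have h2 : cox ℓ = 2 * (ℓ - 1) := cox_eq hℓ
  set x : ParamSeries := MvPowerSeries.X (i, false)
  set y : ParamSeries := MvPowerSeries.X (j, false)
  have h3 : corrSeries ℓ (i, false) (j, false) = x * y * ∑ r ∈ Finset.range (ℓ - 1),
      (x ^ 2) ^ r * (y ^ 2) ^ (ℓ - 1 - 1 - r) *
        ((2 * r + 1) * ((y ^ 2) ^ (ℓ - 1) - (x ^ 2) ^ (ℓ - 1)) +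
          2 * (ℓ - 1 : ℕ) * (x ^ 2) ^ (ℓ - 1)) := by
    rw [corrSeries, Finset.mul_sum]
    refine Finset.sum_congr rfl fun r hr => ?_
    have hr' := Finset.mem_range.mp hr
    simp only [nres, h1] at hr' ⊢
    have hr'' : r < ℓ - 1 := hr'
    -- The exponents 2r + 1 and 2r' + 1 add up to h = 2ℓ - 2 exactly when r + r' = ℓ - 2.
    rw [Finset.sum_eq_single (ℓ - 1 - 1 - r)]
    · rw [if_pos ⟨trivial, by omega⟩, h2]
      push_cast
      ring
    · intro b _ hb
      rw [if_neg]
      rintro ⟨_, h⟩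
      omega
    · intro h
      exact absurd (Finset.mem_range.mpr (by simp only [Bool.false_eq_true, if_false]; omega)) h
  have h4 := odd_correction (x ^ 2) (y ^ 2) (ℓ - 1)
  rw [h3, h2, pow_mul x, pow_mul y]
  linear_combination x * y * h4

theorem corrSeries_ne {p q : Param} (h : p.2 ≠ q.2) : corrSeries ℓ p q = 0 :=
  Finset.sum_eq_zero fun _ _ => Finset.sum_eq_zero fun _ _ => if_neg fun h' => h h'.1

/-- For odd exponents the double sum collapses to the denominator (ζ₁² - ζ₂²)²; for the second kind
ℓ - 1 is its own complement and h = 2(ℓ - 1). -/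
theorem frac_corrSeries (hℓ : 4 ≤ ℓ) {p q : Param} (hpq : p ≠ q) : frac (corrSeries ℓ p q) =
    (frac (MvPowerSeries.X q ^ cox ℓ) - frac (MvPowerSeries.X p ^ cox ℓ)) ^ 2 *
      twoCorr ℓ p q := by
  have hc := cox_pos hℓ
  have h2 : cox ℓ = 2 * (ℓ - 1) := cox_eq hℓ
  have hne : ∀ n, 0 < n → frac (MvPowerSeries.X q) ^ n - frac (MvPowerSeries.X p) ^ n ≠ 0 :=
    fun n hn => by
      rw [← map_pow, ← map_pow, ← map_sub]
      exact frac_ne_zero (sub_ne_zero.mpr fun h => hpq (X_pow_injective hn h).symm)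
  have hx := frac_X_ne_zero p
  have hy := frac_X_ne_zero q
  have hdiv : ∀ n, 0 < n → (par p ^ n + par q ^ n) / (par p ^ n - par q ^ n) ^ 2 =
      (frac (MvPowerSeries.X p) * frac (MvPowerSeries.X q)) ^ n *
        (frac (MvPowerSeries.X p) ^ n + frac (MvPowerSeries.X q) ^ n) /
        (frac (MvPowerSeries.X q) ^ n - frac (MvPowerSeries.X p) ^ n) ^ 2 := by
    intro n hn
    have h1 := hne n hn
    have hxn := pow_ne_zero n hx
    have hyn := pow_ne_zero n hy
    rw [par_eq, par_eq, inv_pow, inv_pow, mul_pow]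
    generalize frac (MvPowerSeries.X p) ^ n = x at *
    generalize frac (MvPowerSeries.X q) ^ n = y at *
    have e : x⁻¹ - y⁻¹ = (y - x) / (x * y) := by field_simp
    rw [e]
    field_simp
    ring
  obtain ⟨i, b⟩ := p
  obtain ⟨j, b'⟩ := q
  rcases eq_or_ne b b' with rfl | hb
  · cases b
    · have h3 := congrArg frac (corrSeries_false hℓ i j)
      simp only [map_mul, map_pow, map_sub, map_add] at h3 ⊢
      rw [twoCorr, if_pos rfl, if_neg Bool.false_ne_true, mul_div_assoc, hdiv 2 two_pos, par_eq,
        par_eq]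
      have h4 := hne 2 two_pos
      generalize frac (MvPowerSeries.X (i, false)) = x at *
      generalize frac (MvPowerSeries.X (j, false)) = y at *
      field_simp
      linear_combination h3
    · have h3 := congrArg frac (corrSeries_true hℓ i j)
      have h5 : ((ℓ : ParamField) - 1) = ((ℓ - 1 : ℕ) : ParamField) := by
        rw [Nat.cast_sub (by omega), Nat.cast_one]
      simp only [map_mul, map_pow, map_add, map_natCast] at h3 ⊢
      rw [twoCorr, if_pos rfl, if_pos rfl, mul_div_assoc, hdiv _ hc, par_eq, par_eq, h5, h3]
      have h4 := hne _ hc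
      generalize frac (MvPowerSeries.X (i, true)) = x at *
      generalize frac (MvPowerSeries.X (j, true)) = y at *
      have e1 : (x * y) ^ cox ℓ = x ^ (ℓ - 1) * y ^ (ℓ - 1) * (x * y) ^ (ℓ - 1) := by
        rw [h2]; ring
      have hxn := pow_ne_zero (ℓ - 1) hx
      have hyn := pow_ne_zero (ℓ - 1) hy
      rw [e1, inv_pow, inv_pow]
      field_simp
  · rw [corrSeries_ne hb, twoCorr, if_neg hb, map_zero, mul_zero]

/-! ### Second derivatives of the tau function -/

variable (hℓ : 4 ≤ ℓ)

theorem trace_wsum_mul_Khat (p q : Param) (φ : TSeries (PowerSeries ℂ) → TSeries ParamSeries) :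
    (wsum ξ p φ * Khat hℓ ξ q).trace = ∑ r ∈ Finset.range (nres ℓ p.2),
      ∑ r' ∈ Finset.range (nres ℓ q.2), MvPowerSeries.C
        (MvPowerSeries.X p ^ (pexp p.2 r).val ℓ * MvPowerSeries.X q ^ (pexp q.2 r').val ℓ) *
        ((red ξ p.2 r).map φ * (red ξ q.2 r').map (evp hℓ q)).trace := by
  rw [Khat, wsum, wsum, Finset.sum_mul_sum, Matrix.trace_sum]
  refine Finset.sum_congr rfl fun r _ => ?_
  rw [Matrix.trace_sum]
  refine Finset.sum_congr rfl fun r' _ => ?_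
  rw [scal_mul, mul_scal, scal_scal, trace_scal, map_mul]

theorem wsum_teleE (p q : Param) :
    scal (MvPowerSeries.C ((MvPowerSeries.X q ^ cox ℓ - MvPowerSeries.X p ^ cox ℓ) ^ 2))
      (wsum ξ p (coeffwise (teleE hℓ p q))) =
    scal (MvPowerSeries.C (MvPowerSeries.X q ^ cox ℓ)) (wsum ξ p (evp hℓ q) - Khat hℓ ξ p) +
      scal (MvPowerSeries.C (MvPowerSeries.X q ^ cox ℓ - MvPowerSeries.X p ^ cox ℓ))
        (wsum ξ p fun f => evp hℓ q (coeffwise eulerP f)) := by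
  ext1 i j
  simp only [Matrix.add_apply, Matrix.sub_apply, scal_apply, Khat, wsum_apply, Finset.mul_sum]
  rw [← Finset.sum_sub_distrib, Finset.mul_sum, ← Finset.sum_add_distrib]
  refine Finset.sum_congr rfl fun r _ => ?_
  have h : MvPowerSeries.C ((MvPowerSeries.X q ^ cox ℓ - MvPowerSeries.X p ^ cox ℓ) ^ 2) *
      coeffwise (teleE hℓ p q) (red ξ p.2 r i j) =
      MvPowerSeries.C (MvPowerSeries.X q ^ cox ℓ) *
          (evp hℓ q (red ξ p.2 r i j) - evp hℓ p (red ξ p.2 r i j)) +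
        MvPowerSeries.C (MvPowerSeries.X q ^ cox ℓ - MvPowerSeries.X p ^ cox ℓ) *
          evp hℓ q (coeffwise eulerP (red ξ p.2 r i j)) := by
    ext1 T
    rw [MvPowerSeries.coeff_C_mul, coeff_coeffwise, map_add, MvPowerSeries.coeff_C_mul, map_sub,
      MvPowerSeries.coeff_C_mul, evp, evp, MvPowerSeries.coeff_map, MvPowerSeries.coeff_map,
      MvPowerSeries.coeff_map, coeff_coeffwise]
    exact teleE_eq hℓ p q _
  linear_combination MvPowerSeries.C (MvPowerSeries.X p ^ (pexp p.2 r).val ℓ) * h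

theorem evp_C_C_mul_X (q : Param) (c : ℂ) : evp hℓ q (MvPowerSeries.C (PowerSeries.C c *
    PowerSeries.X)) = MvPowerSeries.C (MvPowerSeries.C c * MvPowerSeries.X q ^ cox ℓ) := by
  rw [evp, MvPowerSeries.map_C, map_mul, pw_C, pw_X]

theorem trace_map_evp (q : Param) (A : Mat ℓ (TSeries (PowerSeries ℂ))) :
    (A.map (evp hℓ q)).trace = evp hℓ q A.trace := (map_sum (evp hℓ q) _ _).symm

/-- The terms of `teleE_eq` with both matrices evaluated at q are traces of products of undressed
Λ's, hence constant in the times; κ cancels the factor 2 of these traces. -/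
theorem corr_sum (hneg : IsNegative ξ) (p q : Param) : MvPowerSeries.C (MvPowerSeries.C kappa) *
    (MvPowerSeries.C (MvPowerSeries.X q ^ cox ℓ) * (wsum ξ p (evp hℓ q) * Khat hℓ ξ q).trace +
      MvPowerSeries.C (MvPowerSeries.X q ^ cox ℓ - MvPowerSeries.X p ^ cox ℓ) *
        ((wsum ξ p fun f => evp hℓ q (coeffwise eulerP f)) * Khat hℓ ξ q).trace) =
    MvPowerSeries.C (MvPowerSeries.X q ^ cox ℓ * corrSeries ℓ p q) := by
  rw [trace_wsum_mul_Khat, trace_wsum_mul_Khat, Finset.mul_sum, Finset.mul_sum,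
    ← Finset.sum_add_distrib, Finset.mul_sum, corrSeries, Finset.mul_sum, map_sum]
  refine Finset.sum_congr rfl fun r hr => ?_
  rw [Finset.mul_sum, Finset.mul_sum, ← Finset.sum_add_distrib, Finset.mul_sum, Finset.mul_sum,
    map_sum]
  refine Finset.sum_congr rfl fun r' hr' => ?_
  have hr := Finset.mem_range.mp hr
  have hr' := Finset.mem_range.mp hr'
  have h1 : ((red ξ p.2 r).map (evp hℓ q) * (red ξ q.2 r').map (evp hℓ q)).trace =
      evp hℓ q (red ξ p.2 r * red ξ q.2 r').trace := by
    rw [← trace_map_evp, Matrix.map_mul]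
  have h2 : ((red ξ p.2 r).map (fun f => evp hℓ q (coeffwise eulerP f)) *
      (red ξ q.2 r').map (evp hℓ q)).trace =
      evp hℓ q ((red ξ p.2 r).map (coeffwise eulerP) * red ξ q.2 r').trace := by
    rw [← trace_map_evp, Matrix.map_mul, Matrix.map_map]
    rfl
  rw [h1, h2, trace_red_mul_red hℓ hneg hr hr', trace_euler_red_mul_red hℓ hneg hr hr']
  split_ifs with h
  · rw [evp_C_C_mul_X, evp_C_C_mul_X]
    have hk : (MvPowerSeries.C (σ := Param) kappa) * 2 = 1 := by
      rw [← map_ofNat (MvPowerSeries.C (σ := Param)) 2, ← map_mul, kappa]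
      norm_num
    simp only [← map_mul, ← map_add]
    congr 1
    simp only [map_mul, map_sub, map_natCast, map_ofNat]
    linear_combination (MvPowerSeries.X p ^ (pexp p.2 r).val ℓ * MvPowerSeries.X q ^
      (pexp q.2 r').val ℓ * MvPowerSeries.X q ^ cox ℓ * (((pexp p.2 r).val ℓ : ParamSeries) *
          (MvPowerSeries.X q ^ cox ℓ - MvPowerSeries.X p ^ cox ℓ) +
          (cox ℓ : ParamSeries) * MvPowerSeries.X p ^ cox ℓ)) * hk
  · simp only [map_zero, mul_zero, add_zero]

/-- Applies ∇_p to `nab_logTau` and inserts the closed form of `teleE`. Its term evaluated at p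
gives Tr(K(p) K(q)), and its terms evaluated at q give the rational correction. -/
theorem nab_nab_logTau (hneg : IsNegative ξ) (hsol : IsSolution ℓ ξ) {logτ : TSeries ℂ}
    (hτ : IsLogTau ℓ ξ logτ) (p q : Param) :
    MvPowerSeries.C ((MvPowerSeries.X q ^ cox ℓ - MvPowerSeries.X p ^ cox ℓ) ^ 2) *
      nab ℓ p (nab ℓ q (MvPowerSeries.map MvPowerSeries.C logτ)) =
    MvPowerSeries.C (MvPowerSeries.C kappa) * (Khat hℓ ξ p * Khat hℓ ξ q).trace -
      MvPowerSeries.C (corrSeries ℓ p q) := by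
  have h1 := congrArg (nab ℓ p) (nab_logTau hℓ hneg hτ q)
  have hd := isDeriv_nab hℓ p
  have h2 : nab ℓ p (-(MvPowerSeries.C (MvPowerSeries.C kappa) * ∑ r ∈ Finset.range (nres ℓ q.2),
        MvPowerSeries.C (MvPowerSeries.X q ^ (pexp q.2 r).val ℓ) *
          evp hℓ q (redLogd ξ q.2 r))) = -(MvPowerSeries.C (MvPowerSeries.C kappa) *
      (wsum ξ p (coeffwise (teleE hℓ p q)) * Khat hℓ ξ q).trace) := by
    rw [hd.neg, HasNabla.nab_C_mul hℓ, hd.sum]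
    congr 2
    rw [Khat]
    conv_rhs => rw [wsum.eq_def ξ q]
    rw [Finset.mul_sum, Matrix.trace_sum]
    refine Finset.sum_congr rfl fun r hr => ?_
    rw [HasNabla.nab_C_mul hℓ, nab_redLogd hℓ hneg hsol p q (Finset.mem_range.mp hr), mul_scal,
      trace_scal]
  rw [h2, HasNabla.nab_C_mul hℓ] at h1
  have h3 := congrArg (fun A => (A * Khat hℓ ξ q).trace) (wsum_teleE (ξ := ξ) hℓ p q)
  simp only [add_mul, sub_mul, scal_mul, scal_sub, Matrix.trace_add, Matrix.trace_sub,
    trace_scal] at h3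
  have h4 := corr_sum hℓ hneg p q
  have h5 : (MvPowerSeries.C (MvPowerSeries.X q ^ cox ℓ) : TSeries ParamSeries) ≠ 0 := by
    intro h
    have := congrArg (MvPowerSeries.coeff 0) h
    rw [MvPowerSeries.coeff_zero_C, map_zero] at this
    exact frac_X_pow_ne_zero q _ (by rw [this, map_zero])
  refine mul_left_cancel₀ h5 ?_
  rw [map_mul] at h4
  linear_combination MvPowerSeries.C
    ((MvPowerSeries.X q ^ cox ℓ - MvPowerSeries.X p ^ cox ℓ) ^ 2) * h1 -
    MvPowerSeries.C (MvPowerSeries.C kappa) * h3 - h4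

theorem incl_nab_nab_logTau (hℓ : 4 ≤ ℓ) (hneg : IsNegative ξ) (hsol : IsSolution ℓ ξ) {logτ : TSeries ℂ}
    (hτ : IsLogTau ℓ ξ logτ) {p q : Param} (hpq : p ≠ q) :
    incl (nab ℓ p (nab ℓ q (MvPowerSeries.map MvPowerSeries.C logτ))) =
      -(cF (frac (MvPowerSeries.C kappa)) * (cF (sfac ℓ p q * sfac ℓ q p) *
        (Kpar ξ p * Kpar ξ q).trace)) - cF (twoCorr ℓ p q) := by
  have h1 := congrArg incl (nab_nab_logTau hℓ hneg hsol hτ p q)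
  have h2 : frac (MvPowerSeries.X q ^ cox ℓ) - frac (MvPowerSeries.X p ^ cox ℓ) ≠ 0 :=
    frac_sub_ne_zero hℓ hpq.symm
  have h3 : incl (Khat hℓ ξ p * Khat hℓ ξ q).trace =
      cF (frac (MvPowerSeries.X p ^ cox ℓ) * frac (MvPowerSeries.X q ^ cox ℓ)) *
        (Kpar ξ p * Kpar ξ q).trace := by
    rw [← trace_mapMatrix, map_mul, Khat_eq hℓ hneg, Khat_eq hℓ hneg, scal_mul, mul_scal,
      trace_scal, trace_scal, map_mul, mul_assoc]
  rw [map_mul, map_sub, map_mul, incl_C, incl_C, incl_C, h3, frac_corrSeries hℓ hpq, map_pow,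
    map_sub] at h1
  refine cF_cancel (pow_ne_zero 2 h2) (h1.trans ?_)
  have h4 : (frac (MvPowerSeries.X q ^ cox ℓ) - frac (MvPowerSeries.X p ^ cox ℓ)) ^ 2 *
      (sfac ℓ p q * sfac ℓ q p) =
      -(frac (MvPowerSeries.X p ^ cox ℓ) * frac (MvPowerSeries.X q ^ cox ℓ)) := by
    have h5 := frac_sub_ne_zero hℓ hpq
    rw [sfac, sfac]
    generalize frac (MvPowerSeries.X p ^ cox ℓ) = x at *
    generalize frac (MvPowerSeries.X q ^ cox ℓ) = y at *
    field_simp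
    ring
  have h6 := congrArg cF h4
  rw [map_mul, map_neg] at h6
  simp only [map_mul] at h6 ⊢
  linear_combination cF (frac (MvPowerSeries.C kappa)) * (Kpar ξ p * Kpar ξ q).trace * h6

end DrinfeldSokolovD

namespace DrinfeldSokolovD

variable {ℓ : ℕ}

/-! ### Higher derivatives of the tau function -/

/-- The star product `K(a) ⋆ K(l₁) ⋆ ⋯` of the factors along the path from `a` to `c` through
the parameters in the list. -/
def pathProd (ξ : Mat ℓ (TSeries (PowerSeries ℂ))) :
    Param → List Param → Param → Mat ℓ (TSeries ParamField)
  | a, [], c => scal (cF (sfac ℓ a c)) (Kpar ξ a)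
  | a, b :: l, c => scal (cF (sfac ℓ a b)) (Kpar ξ a * pathProd ξ b l c)

/-- The trace of the star product along a closed path. -/
def cycTrace (ξ : Mat ℓ (TSeries (PowerSeries ℂ))) : List Param → TSeries ParamField
  | [] => 0
  | a :: l => (pathProd ξ a l a).trace

/-- A partial fraction identity: two weights at the ends of an edge combine into the weights of the
path through q. -/
theorem sfac_mul_sfac (hℓ : 4 ≤ ℓ) {p p' q : Param} (h : p ≠ p') (h1 : q ≠ p) (h2 : q ≠ p') :
    sfac ℓ p p' * (sfac ℓ q p' - sfac ℓ q p) = sfac ℓ p q * sfac ℓ q p' := by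
  have e := frac_sub_ne_zero hℓ h
  have e1 := frac_sub_ne_zero hℓ h1
  have e1' := frac_sub_ne_zero hℓ h1.symm
  have e2 := frac_sub_ne_zero hℓ h2
  simp only [sfac]
  generalize frac (MvPowerSeries.X p ^ cox ℓ) = x at *
  generalize frac (MvPowerSeries.X p' ^ cox ℓ) = y at *
  generalize frac (MvPowerSeries.X q ^ cox ℓ) = u at *
  field_simp
  ring

variable {ξ : Mat ℓ (TSeries (PowerSeries ℂ))}

theorem sum_pathProd_cons (a b c : Param) (L : List (List Param)) :
    ((L.map (List.cons b)).map fun w => pathProd ξ a w c).sum =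
      scal (cF (sfac ℓ a b)) (Kpar ξ a * (L.map fun w => pathProd ξ b w c).sum) := by
  induction L with
  | nil => simp [scal_zero]
  | cons w L ih =>
    rw [List.map_cons, List.map_cons, List.map_cons, List.sum_cons, List.sum_cons, ih, mul_add,
      scal_add, pathProd]

/-- By Leibniz each K on the path contributes a commutator with K(q). At every edge the two adjacent
terms combine by `sfac_mul_sfac` into the path with q inserted there. What survives is one term at
each end and the commutator with E(q). -/
theorem matHasNabla_pathProd (hℓ : 4 ≤ ℓ) (hneg : IsNegative ξ) (hsol : IsSolution ℓ ξ)
    {q : Param} (c : Param) (hqc : q ≠ c) (l : List Param) : ∀ a, (a :: l).Nodup → c ∉ l →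
      (l = [] → a ≠ c) → q ∉ a :: l → MatHasNabla q (pathProd ξ a l c)
        (scal (cF (sfac ℓ q a)) (Kpar ξ q * pathProd ξ a l c) -
          scal (cF (sfac ℓ q c)) (pathProd ξ a l c * Kpar ξ q) +
          (efac ξ q * pathProd ξ a l c - pathProd ξ a l c * efac ξ q) +
          ((List.permutations'Aux q l).map fun w => pathProd ξ a w c).sum) := by
  induction l with
  | nil =>
    intro a _ _ hac hqa
    have hqa' : q ≠ a := fun h => hqa (h ▸ List.mem_cons_self)
    have h1 := (matHasNabla_Kpar hℓ hneg hsol hqa').scal hℓ (sfac ℓ a c)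
    have h2 := congrArg cF (sfac_mul_sfac hℓ (hac rfl) hqa' hqc)
    rw [map_mul, map_mul, map_sub] at h2
    refine (congrArg (MatHasNabla q _) ?_).mpr h1
    ext1 i j
    simp only [List.permutations'Aux, List.map_cons, List.map_nil, List.sum_cons, List.sum_nil,
      add_zero, pathProd, scal_mul, mul_scal, scal_scal, scal_sub, Matrix.add_apply,
      Matrix.sub_apply, scal_apply]
    linear_combination -(Kpar ξ a * Kpar ξ q) i j * h2
  | cons b l ih =>
    intro a hnd hcl _ hqa
    have hnd' := List.nodup_cons.mp hnd
    have hab : a ≠ b := fun h => hnd'.1 (h ▸ List.mem_cons_self)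
    have hqa' : q ≠ a := fun h => hqa (h ▸ List.mem_cons_self)
    have hqb : q ∉ b :: l := fun h => hqa (List.mem_cons_of_mem a h)
    have hqb' : q ≠ b := fun h => hqb (h ▸ List.mem_cons_self)
    have h1 := ih b hnd'.2 (fun h => hcl (List.mem_cons_of_mem b h))
      (fun _ h => hcl (h ▸ List.mem_cons_self)) hqb
    have h3 := ((matHasNabla_Kpar hℓ hneg hsol hqa').mul hℓ h1).scal hℓ (sfac ℓ a b)
    have h2 := congrArg cF (sfac_mul_sfac hℓ hab hqa' hqb')
    rw [map_mul, map_mul, map_sub] at h2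
    refine (congrArg (MatHasNabla q _) ?_).mpr h3
    rw [List.permutations'Aux, List.map_cons, List.sum_cons, sum_pathProd_cons]
    ext1 i j
    simp only [pathProd, scal_mul, mul_scal, scal_scal, scal_sub, Matrix.add_apply,
      Matrix.sub_apply, scal_apply, mul_add, mul_sub, add_mul, sub_mul, mul_assoc]
    linear_combination -(Kpar ξ a * (Kpar ξ q * pathProd ξ b l c)) i j * h2

theorem trace_list_sum (L : List (Mat ℓ (TSeries ParamField))) :
    L.sum.trace = (L.map Matrix.trace).sum := by
  induction L with
  | nil => simp
  | cons A L ih => rw [List.sum_cons, Matrix.trace_add, ih, List.map_cons, List.sum_cons]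

/-- When the path closes up, the two end terms carry the same weight and cancel under the trace, as
does the commutator with E(q). -/
theorem hasNabla_cycTrace (hℓ : 4 ≤ ℓ) (hneg : IsNegative ξ) (hsol : IsSolution ℓ ξ)
    {q a : Param} {l : List Param} (hl : l ≠ []) (hnd : (a :: l).Nodup) (hq : q ∉ a :: l) :
    HasNabla ℓ q (cycTrace ξ (a :: l))
      ((List.permutations'Aux q l).map fun w => cycTrace ξ (a :: w)).sum := by
  have hqa : q ≠ a := fun h => hq (h ▸ List.mem_cons_self)
  have h1 := (matHasNabla_pathProd hℓ hneg hsol a hqa l a hnd (List.nodup_cons.mp hnd).1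
    (fun h => absurd h hl) hq).trace hℓ
  have h2 : ((List.permutations'Aux q l).map fun w => cycTrace ξ (a :: w)).sum =
      ((List.permutations'Aux q l).map fun w => pathProd ξ a w a).sum.trace := by
    rw [trace_list_sum, List.map_map]
    rfl
  rw [h2]
  rw [Matrix.trace_add, Matrix.trace_add, Matrix.trace_sub, Matrix.trace_sub, trace_scal,
    trace_scal, Matrix.trace_mul_comm (Kpar ξ q), sub_self, zero_add,
    Matrix.trace_mul_comm (efac ξ q), sub_self, zero_add] at h1
  exact h1

/-- The iterated application of the operators `∇_q`. -/
def nabs (ℓ : ℕ) (l : List Param) (f : TSeries ParamSeries) : TSeries ParamSeries :=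
  l.foldr (nab ℓ) f

theorem hasNabla_sum_flatMap (hℓ : 4 ≤ ℓ) (hneg : IsNegative ξ) (hsol : IsSolution ℓ ξ)
    {q a : Param} (L : List (List Param))
    (h : ∀ w ∈ L, w ≠ [] ∧ (a :: w).Nodup ∧ q ∉ a :: w) :
    HasNabla ℓ q (L.map fun w => cycTrace ξ (a :: w)).sum
      ((L.flatMap (List.permutations'Aux q)).map fun w => cycTrace ξ (a :: w)).sum := by
  have h1 := HasNabla.list_sum (q := q) hℓ (F := fun w => cycTrace ξ (a :: w))
    (G := fun l => ((List.permutations'Aux q l).map fun w => cycTrace ξ (a :: w)).sum) L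
    fun w hw => hasNabla_cycTrace hℓ hneg hsol (h w hw).1 (h w hw).2.1 (h w hw).2.2
  convert h1 using 1
  clear h h1
  induction L with
  | nil => rfl
  | cons w L ih =>
    rw [List.flatMap_cons, List.map_append, List.sum_append, ih, List.map_cons, List.sum_cons]

/-- Induction on the number of operators, starting from the two-point formula. The parameter a of
the innermost operator anchors the cyclic orders. The rational correction is constant in the times,
so the next ∇ removes it. -/
theorem incl_nabs_logTau (hℓ : 4 ≤ ℓ) (hneg : IsNegative ξ) (hsol : IsSolution ℓ ξ)
    {logτ : TSeries ℂ} (hτ : IsLogTau ℓ ξ logτ) (a : Param) (l : List Param) :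
    ∀ b, (a :: b :: l).Nodup →
      incl (nabs ℓ (b :: l ++ [a]) (MvPowerSeries.map MvPowerSeries.C logτ)) =
        -(cF (frac (MvPowerSeries.C kappa)) *
          (((b :: l).permutations').map fun w => cycTrace ξ (a :: w)).sum) -
        cF (if l = [] then twoCorr ℓ b a else 0) := by
  induction l with
  | nil =>
    intro b hnd
    have hba : b ≠ a := fun h => (List.nodup_cons.mp hnd).1 (h ▸ List.mem_cons_self)
    have h1 := incl_nab_nab_logTau hℓ hneg hsol hτ hba
    rw [if_pos rfl]
    refine h1.trans ?_
    simp only [List.permutations', List.flatMap_cons, List.permutations'Aux, List.flatMap_nil,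
      List.append_nil, List.map_cons, List.map_nil, List.sum_cons, List.sum_nil, add_zero, cycTrace,
      pathProd, mul_scal, trace_scal, map_mul, Matrix.trace_mul_comm (Kpar ξ a)]
    ring
  | cons c l ih =>
    intro b hnd
    have h0 : (a :: c :: l).Nodup := by
      simp only [List.nodup_cons, List.mem_cons, not_or] at hnd ⊢
      tauto
    have hb : b ∉ a :: c :: l := by
      simp only [List.nodup_cons, List.mem_cons, not_or] at hnd ⊢
      exact ⟨fun h => hnd.1.1 h.symm, hnd.2.1⟩
    have h1 := HasNabla.incl (ℓ := ℓ) (q := b)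
      (nabs ℓ (c :: l ++ [a]) (MvPowerSeries.map MvPowerSeries.C logτ))
    rw [ih c h0] at h1
    have h2 := hasNabla_sum_flatMap (q := b) (a := a) hℓ hneg hsol (c :: l).permutations'
      fun w hw => by
        have hp := List.mem_permutations'.mp hw
        refine ⟨?_, (hp.cons a).nodup_iff.mpr h0, fun h => hb ((hp.cons a).mem_iff.mp h)⟩
        rintro rfl
        exact List.cons_ne_nil _ _ hp.nil_eq.symm
    have h3 := (h2.const_mul hℓ (-frac (MvPowerSeries.C kappa))).add hℓ
      (HasNabla.const (q := b) hℓ (-(if l = [] then twoCorr ℓ c a else 0)))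
    rw [map_neg, neg_mul, neg_mul, map_neg, ← sub_eq_add_neg, add_zero] at h3
    rw [if_neg (List.cons_ne_nil c l), map_zero, sub_zero]
    exact h1.unique hℓ h3

end DrinfeldSokolovD

namespace DrinfeldSokolovD

/-! ### Sums over permutations -/

section

variable {α M : Type*} [AddCommMonoid M]

theorem sum_permutations'Aux (a : α) (l : List α) : ∀ g : List α → M,
    ((List.permutations'Aux a l).map g).sum =
      ∑ k ∈ Finset.range (l.length + 1), g (l.take k ++ a :: l.drop k) := by
  induction l with
  | nil => intro g; simp [List.permutations'Aux]
  | cons b l ih =>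
    intro g
    rw [List.permutations'Aux, List.map_cons, List.sum_cons, List.map_map, ih, List.length_cons,
      Finset.sum_range_succ' _ (l.length + 1), add_comm]
    rfl

theorem nodup_permutations' {l : List α} (h : l.Nodup) : l.permutations'.Nodup :=
  (List.permutations_perm_permutations' l).nodup_iff.mp (List.nodup_permutations l h)

theorem map_rotate_permutations' {l : List α} (h : l.Nodup) (k : ℕ) :
    (l.permutations'.map fun w => w.rotate k).Perm l.permutations' := by
  rw [List.perm_ext_iff_of_nodup ((nodup_permutations' h).map (List.rotate_injective k))
    (nodup_permutations' h)]
  intro w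
  simp only [List.mem_map, List.mem_permutations']
  constructor
  · rintro ⟨v, hv, rfl⟩
    exact (List.rotate_perm v k).trans hv
  · intro hw
    -- The inverse of the rotation by k: together they rotate by a multiple of the length, hence
    -- trivially.
    refine ⟨w.rotate (w.length * k - k), (List.rotate_perm w _).trans hw, ?_⟩
    rcases w with _ | ⟨b, w⟩
    · simp
    · rw [List.rotate_rotate, Nat.sub_add_cancel (Nat.le_mul_of_pos_left k (by simp)),
        List.rotate_length_mul]

theorem list_sum_finset_sum {ι : Type*} (L : List α) (s : Finset ι) (f : ι → α → M) :
    (L.map fun w => ∑ k ∈ s, f k w).sum = ∑ k ∈ s, (L.map (f k)).sum := by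
  induction L with
  | nil => simp
  | cons w L ih => simp only [List.map_cons, List.sum_cons, ih, Finset.sum_add_distrib]

/-- By cyclic invariance, inserting a at position k amounts to putting a first and rotating the rest
by k. Rotation permutes the permutations of l, so all length + 1 positions give the same sum. -/
theorem sum_permutations'_cons {g : List α → M}
    (hg : ∀ (l l' : List α) (a : α), g (l ++ a :: l') = g (a :: l' ++ l)) (a : α) {l : List α}
    (h : l.Nodup) : (((a :: l).permutations').map g).sum =
      (l.length + 1) • ((l.permutations').map fun w => g (a :: w)).sum := by
  have h1 : ∀ L : List (List α), ((L.flatMap (List.permutations'Aux a)).map g).sum =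
      (L.map fun w => ((List.permutations'Aux a w).map g).sum).sum := by
    intro L
    induction L with
    | nil => rfl
    | cons w L ih =>
      rw [List.flatMap_cons, List.map_append, List.sum_append, ih, List.map_cons, List.sum_cons]
  rw [List.permutations', h1]
  have h2 : (l.permutations').map (fun w => ((List.permutations'Aux a w).map g).sum) =
      (l.permutations').map fun w => ∑ k ∈ Finset.range (l.length + 1), g (a :: w.rotate k) := by
    refine List.map_congr_left fun w hw => ?_
    have hl := (List.mem_permutations'.mp hw).length_eq
    rw [sum_permutations'Aux, hl]
    refine Finset.sum_congr rfl fun k hk => ?_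
    have hk' := Finset.mem_range.mp hk
    rw [hg, List.rotate_eq_drop_append_take_mod]
    rcases eq_or_lt_of_le (show k ≤ w.length by omega) with h | h
    · rw [h, Nat.mod_self]
      simp
    · rw [Nat.mod_eq_of_lt h]
      rfl
  rw [h2, list_sum_finset_sum]
  have h3 : ∀ k, ((l.permutations').map fun w => g (a :: w.rotate k)).sum =
      ((l.permutations').map fun w => g (a :: w)).sum := by
    intro k
    have := ((map_rotate_permutations' h k).map fun w => g (a :: w)).sum_eq
    rwa [List.map_map] at this
  simp only [h3, Finset.sum_const, Finset.card_range]

theorem sum_perm_ofFn {m : ℕ} {φ : Fin m → α} (hφ : Function.Injective φ) (g : List α → M) :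
    ∑ ρ : Equiv.Perm (Fin m), g (List.ofFn (φ ∘ ρ)) =
      (((List.ofFn φ).permutations').map g).sum := by
  have h1 : ((Finset.univ : Finset (Equiv.Perm (Fin m))).toList.map
      fun ρ : Equiv.Perm (Fin m) => List.ofFn (φ ∘ ρ)).Perm (List.ofFn φ).permutations' := by
    have hnd : ((Finset.univ : Finset (Equiv.Perm (Fin m))).toList.map
        fun ρ : Equiv.Perm (Fin m) => List.ofFn (φ ∘ ρ)).Nodup := by
      refine (Finset.nodup_toList _).map fun ρ ρ' h => ?_
      ext1 i
      exact hφ (congrFun (List.ofFn_injective h) i)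
    -- Distinct ρ give distinct lists, all of them permutations, and both lists have m! members.
    refine (List.subperm_of_subset hnd ?_).perm_of_length_le ?_
    · intro w hw
      obtain ⟨ρ, -, rfl⟩ := List.mem_map.mp hw
      exact List.mem_permutations'.mpr (ρ.ofFn_comp_perm φ)
    · rw [List.length_map, Finset.length_toList, Finset.card_univ, Fintype.card_perm,
        Fintype.card_fin, ← (List.permutations_perm_permutations' _).length_eq,
        List.length_permutations, List.length_ofFn]
  rw [← (h1.map g).sum_eq, List.map_map, ← Finset.sum_map_toList]
  rfl

end

variable {ℓ : ℕ} {ξ : Mat ℓ (TSeries (PowerSeries ℂ))}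

theorem pathProd_append (a b c : Param) (l l' : List Param) :
    pathProd ξ a (l ++ b :: l') c = pathProd ξ a l b * pathProd ξ b l' c := by
  induction l generalizing a with
  | nil => rw [List.nil_append, pathProd, pathProd, scal_mul]
  | cons d l ih => rw [List.cons_append, pathProd, pathProd, ih, scal_mul, mul_assoc]

theorem cycTrace_rotate (l l' : List Param) (a : Param) :
    cycTrace ξ (l ++ a :: l') = cycTrace ξ (a :: l' ++ l) := by
  rcases l with _ | ⟨b, l⟩
  · rw [List.append_nil, List.nil_append]
  · rw [List.cons_append, List.cons_append, cycTrace, cycTrace, pathProd_append, pathProd_append,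
      Matrix.trace_mul_comm]

/-! ### The star product as a product along a cycle -/

/-- Valid for p = q as well: both quotients then have denominator zero and are zero by convention.
-/
theorem par_quotient (p q : Param) :
    par p ^ cox ℓ / (par q ^ cox ℓ - par p ^ cox ℓ) = sfac ℓ p q := by
  rw [sfac, par_eq, par_eq, inv_pow, inv_pow, ← map_pow, ← map_pow]
  have h1 := frac_X_pow_ne_zero p (cox ℓ)
  have h2 := frac_X_pow_ne_zero q (cox ℓ)
  generalize frac (MvPowerSeries.X p ^ cox ℓ) = x at *
  generalize frac (MvPowerSeries.X q ^ cox ℓ) = y at *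
  have e : y⁻¹ - x⁻¹ = (x - y) / (x * y) := by field_simp
  rw [e]
  rcases eq_or_ne x y with rfl | h
  · simp
  · have := sub_ne_zero.mpr h
    field_simp

theorem pathProd_ofFn {n : ℕ} (p : Fin (n + 1) → Param) (c : Param) :
    pathProd ξ (p 0) (List.ofFn fun j : Fin n => p j.succ) c =
      scal (cF ((∏ j : Fin n, sfac ℓ (p j.castSucc) (p j.succ)) * sfac ℓ (p (Fin.last n)) c))
        (List.ofFn fun j => Kpar ξ (p j)).prod := by
  induction n with
  | zero => simp [pathProd]
  | succ n ih =>
    rw [List.ofFn_succ, pathProd, ih fun j => p j.succ, Fin.prod_univ_succ, mul_scal, scal_scal,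
      List.ofFn_succ (f := fun j => Kpar ξ (p j)), List.prod_cons, ← map_mul, ← mul_assoc]
    rfl

/-- The factor of index i in the star prefactor is the weight of the edge to its cyclic successor;
the last edge returns to the first parameter. -/
theorem trace_starProd {n : ℕ} (p : Fin (n + 1) → Param) :
    (starProd ℓ p fun k => Kpar ξ (p k)).trace = cycTrace ξ (List.ofFn p) := by
  rw [List.ofFn_succ, cycTrace, pathProd_ofFn, starProd, ← Finset.prod_div_distrib]
  simp only [par_quotient]
  rw [Fin.prod_univ_castSucc, finRotate_last]
  simp only [finRotate_apply, Fin.coeSucc_eq_succ]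
  rw [trace_scal, Matrix.trace_smul, MvPowerSeries.smul_eq_C_mul]
  rfl

/-- In `starK` the kinds are attached to positions, here to the indices of the parameters;
reindexing by ρ passes from one to the other. -/
theorem trace_starK {n : ℕ} (ρ : Equiv.Perm (Fin (n + 1))) : (starK ℓ ξ ρ).trace =
    ∑ ε : Fin (n + 1) → Bool,
      cycTrace ξ (List.ofFn ((fun i : Fin (n + 1) => ((i : ℕ), ε i)) ∘ ρ)) := by
  rw [starK, Matrix.trace_sum]
  rw [← (Equiv.arrowCongr ρ.symm (Equiv.refl Bool)).sum_comp]
  refine Finset.sum_congr rfl fun ε _ => ?_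
  exact trace_starProd (ξ := ξ) fun k => ((ρ k : ℕ), ε (ρ k))

/-! ### The generating series as a sum over the kinds of the parameters -/

/-- Multiplies out the product of the operators ∇_1 + ∇_2 by additivity, one choice of kind for each
index. -/
theorem genSeries_eq (hℓ : 4 ≤ ℓ) (m : ℕ) (logτ : TSeries ℂ) : genSeries ℓ m logτ =
    ∑ ε : Fin m → Bool, nabs ℓ (List.ofFn fun i => ((i : ℕ), ε i))
      (MvPowerSeries.map MvPowerSeries.C logτ) := by
  have h : ∀ (n : ℕ) (idx : Fin n → ℕ), (List.ofFn idx).foldr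
      (fun i f => nabla1 i f + nabla2 ℓ i f) (MvPowerSeries.map MvPowerSeries.C logτ) =
      ∑ ε : Fin n → Bool, nabs ℓ (List.ofFn fun i => (idx i, ε i))
        (MvPowerSeries.map MvPowerSeries.C logτ) := by
    intro n
    induction n with
    | zero => intro idx; simp [nabs]
    | succ n ih =>
      intro idx
      rw [List.ofFn_succ, List.foldr_cons, ih, ← (Fin.consEquiv fun _ => Bool).sum_comp,
        Fintype.sum_prod_type, Fintype.sum_bool, add_comm]
      have hn : ∀ (b : Bool) (ε : Fin n → Bool), nabs ℓ (List.ofFn fun i => (idx i,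
          (Fin.consEquiv fun _ => Bool) (b, ε) i)) (MvPowerSeries.map MvPowerSeries.C logτ) =
          nab ℓ (idx 0, b) (nabs ℓ (List.ofFn fun i => (idx i.succ, ε i))
            (MvPowerSeries.map MvPowerSeries.C logτ)) := by
        intro b ε
        rw [List.ofFn_succ]
        rfl
      simp only [hn]
      rw [← (isDeriv_nab hℓ _).sum, ← (isDeriv_nab hℓ _).sum]
      rfl
  have h1 : List.range m = List.ofFn fun i : Fin m => (i : ℕ) := by
    refine List.ext_getElem (by simp) fun i _ _ => by simp
  rw [genSeries, h1, h]

theorem smul_eq_cF_mul (c : ℂ) (f : TSeries ParamField) :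
    c • f = cF (frac (MvPowerSeries.C c)) * f := by
  ext1 T
  have h : MvPowerSeries.coeff T (c • f) = c • MvPowerSeries.coeff T f := rfl
  rw [h, cF, MvPowerSeries.coeff_C_mul, Algebra.smul_def]
  rfl

theorem sum_twoCorr : ∑ ε : Fin 2 → Bool, twoCorr ℓ (0, ε 0) (1, ε 1) = correction ℓ := by
  rw [← (Fin.consEquiv fun _ => Bool).sum_comp, Fintype.sum_prod_type, Fintype.sum_bool]
  simp only [← (Fin.consEquiv fun _ => Bool).sum_comp, Fintype.sum_prod_type, Fintype.sum_bool]
  simp [twoCorr, correction, Fin.consEquiv, Fin.cons_one]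
  ring

/-- For each choice of kinds, `incl_nabs_logTau` gives a sum over orders that start at the last
parameter, the one of the innermost operator. Averaging over the m possible starting points turns it
into 1/m times the sum over S_m. -/
theorem mPointSeries_eq (hℓ : 4 ≤ ℓ) (hneg : IsNegative ξ) (hsol : IsSolution ℓ ξ)
    {logτ : TSeries ℂ} (hτ : IsLogTau ℓ ξ logτ) {m : ℕ} (hm : 2 ≤ m) :
    mPointSeries ℓ m logτ =
      (-(m : ℂ)⁻¹) • (∑ ρ : Equiv.Perm (Fin m), kappa • Matrix.trace (starK ℓ ξ ρ)) -
        (if m = 2 then MvPowerSeries.C (correction ℓ) else 0) := by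
  obtain ⟨n, rfl⟩ := Nat.exists_eq_add_of_le' hm
  have h1 : ∀ ε : Fin (n + 2) → Bool, incl (nabs ℓ (List.ofFn fun i => ((i : ℕ), ε i))
      (MvPowerSeries.map MvPowerSeries.C logτ)) =
      (-((n + 2 : ℕ) : ℂ)⁻¹) • (kappa • ∑ ρ : Equiv.Perm (Fin (n + 2)),
        cycTrace ξ (List.ofFn ((fun i : Fin (n + 2) => ((i : ℕ), ε i)) ∘ ρ))) -
        cF (if n = 0 then twoCorr ℓ (0, ε 0) (1, ε 1) else 0) := by
    intro ε
    set φ : Fin (n + 2) → Param := fun i => ((i : ℕ), ε i) with hφ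
    have hinj : Function.Injective φ := fun i j h => Fin.ext (congrArg Prod.fst h)
    set l := List.ofFn fun j : Fin n => φ j.succ.castSucc
    have h2 : List.ofFn φ = φ 0 :: l ++ [φ (Fin.last _)] := by
      rw [List.ofFn_succ', List.concat_eq_append, List.ofFn_succ]
      rfl
    have hperm : (List.ofFn φ).Perm (φ (Fin.last _) :: φ 0 :: l) := by
      rw [h2]
      exact List.perm_append_singleton _ _
    have hnd : (φ (Fin.last _) :: φ 0 :: l).Nodup := hperm.nodup_iff.mp (List.nodup_ofFn.mpr hinj)
    have h3 := incl_nabs_logTau hℓ hneg hsol hτ (φ (Fin.last _)) l (φ 0) hnd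
    rw [sum_perm_ofFn hinj, (hperm.permutations'.map _).sum_eq,
      sum_permutations'_cons cycTrace_rotate _ (List.nodup_cons.mp hnd).2, h2, h3]
    have h4 : (φ 0 :: l).length + 1 = n + 2 := by simp [l]
    have h5 : l = [] ↔ n = 0 := by
      rw [← List.length_eq_zero_iff]
      simp [l]
    congr 1
    · rw [h4, ← Nat.cast_smul_eq_nsmul ℂ, smul_comm kappa, smul_smul, neg_mul,
        inv_mul_cancel₀ (by exact_mod_cast Nat.succ_ne_zero (n + 1)), neg_smul, one_smul,
        smul_eq_cF_mul]
    · congr 1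
      by_cases hn : n = 0
      · subst hn
        rw [if_pos (h5.mpr rfl), if_pos rfl]
        rfl
      · rw [if_neg (fun h => hn (h5.mp h)), if_neg hn]
  have h2 : mPointSeries ℓ (n + 2) logτ = incl (genSeries ℓ (n + 2) logτ) := rfl
  rw [h2, genSeries_eq hℓ, map_sum, Finset.sum_congr rfl fun ε _ => h1 ε, Finset.sum_sub_distrib,
    ← Finset.smul_sum, ← Finset.smul_sum, ← Finset.smul_sum, Finset.sum_comm]
  simp only [trace_starK]
  congr 1
  rw [← map_sum]
  by_cases hn : n = 0
  · subst hn
    simp only [if_true]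
    rw [sum_twoCorr]
    rfl
  · simp only [if_neg hn, Finset.sum_const_zero, map_zero]
    rw [if_neg (by omega)]

end DrinfeldSokolovD

namespace DrinfeldSokolovD

/-! ### The one-point function -/

theorem pexp_injective (b : Bool) : Function.Injective (pexp b) := by
  intro a a' h
  cases b <;> simpa [pexp] using h

section

variable {R : Type} [CommRing R] (b : Bool) (c : ℕ → R)

theorem pderiv_linear (b' : Bool) (a' : ℕ) : MvPowerSeries.pderiv R (pexp b' a')
    (coeffSum fun a => MvPowerSeries.monomial (Finsupp.single (pexp b a) 1) (c a)) =
      MvPowerSeries.C (if b = b' then c a' else 0) := by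
  classical
  ext1 T
  rw [MvPowerSeries.coeff_pderiv, coeff_coeffSum, MvPowerSeries.coeff_C]
  simp only [MvPowerSeries.coeff_monomial]
  split_ifs with hT hb
  · subst hT hb
    rw [finsum_eq_single _ a', if_pos (zero_add _)]
    · simp
    · intro a ha
      rw [if_neg]
      intro h
      rw [zero_add] at h
      exact ha (pexp_injective b (Finsupp.single_left_injective one_ne_zero h)).symm
  · subst hT
    rw [finsum_eq_zero_of_forall_eq_zero, zero_mul]
    intro a
    rw [if_neg]
    intro h
    rw [zero_add] at h
    have h1 := congrArg PosExp.kind (Finsupp.single_left_injective one_ne_zero h)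
    rw [kind_pexp, kind_pexp] at h1
    exact hb h1.symm
  all_goals
    rw [finsum_eq_zero_of_forall_eq_zero, zero_mul]
    intro a
    rw [if_neg]
    intro h
    apply hT
    have h1 := congrArg Finsupp.degree h
    rw [map_add, Finsupp.degree_single, Finsupp.degree_single] at h1
    exact (Finsupp.degree_eq_zero_iff T).mp (by omega)

theorem constantCoeff_linear : MvPowerSeries.constantCoeff
    (coeffSum fun a => MvPowerSeries.monomial (Finsupp.single (pexp b a) 1) (c a)) = 0 := by
  classical
  rw [← MvPowerSeries.coeff_zero_eq_constantCoeff_apply, coeff_coeffSum]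
  refine finsum_eq_zero_of_forall_eq_zero fun a => ?_
  rw [MvPowerSeries.coeff_monomial, if_neg]
  intro h
  exact one_ne_zero (Finsupp.single_eq_zero.mp h.symm)

end

variable {ℓ : ℕ} {ξ : Mat ℓ (TSeries (PowerSeries ℂ))}

/-- Within each kind, every exponent below h has exactly one partner adding up to h. This leaves a
single residue for each time in `sum_logdG`. -/
theorem exists_complement (hℓ : 4 ≤ ℓ) {b : Bool} {r : ℕ} (hr : r < nres ℓ b) :
    ∃ r' < nres ℓ b, (pexp b r).val ℓ + (pexp b r').val ℓ = cox ℓ ∧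
      ∀ r'', (pexp b r).val ℓ + (pexp b r'').val ℓ = cox ℓ → r'' = r' := by
  have h := cox_eq hℓ
  cases b
  · simp only [nres, Bool.false_eq_true, if_false] at hr
    refine ⟨ℓ - 1 - 1 - r, ?_, ?_, ?_⟩
    · simp only [nres, Bool.false_eq_true, if_false]; omega
    · simp only [pexp, PosExp.val]; omega
    · intro r'' h'
      simp only [pexp, PosExp.val] at h'
      omega
  · simp only [nres, if_true] at hr
    obtain rfl : r = 0 := by omega
    refine ⟨0, by simp [nres], ?_, ?_⟩
    · simp only [pexp, PosExp.val, mul_zero]; omega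
    · intro r'' h'
      simp only [pexp, PosExp.val, mul_zero] at h'
      have : cox ℓ * r'' = 0 := by omega
      rcases Nat.mul_eq_zero.mp this with h0 | h0
      · omega
      · exact h0

theorem pderiv_subst_logdG (hℓ : 4 ≤ ℓ) (q : Param) (i j : PosExp) :
    MvPowerSeries.pderiv ParamField j (seriesAt q (subst ℓ (logdG ℓ i))) =
      cF (if j.kind = i.kind ∧ cox ℓ ∣ j.val ℓ + i.val ℓ then
        frac (MvPowerSeries.C (2 * j.val ℓ)) * par q ^ (j.val ℓ + i.val ℓ) else 0) := by
  rw [seriesAt, subst, pderiv_map, pderiv_map, pderiv_logdG hℓ, MvPowerSeries.map_C,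
    MvPowerSeries.map_C, trace_euler_heis_mul_heis hℓ]
  split_ifs with h
  · rw [substPow_zmon (cox_pos hℓ), ← Nat.cast_mul, Nat.mul_div_cancel' h.2, laurentAt_zmon_nat]
    rfl
  · rw [map_zero, map_zero, map_zero, map_zero]

theorem frac_C_kappa_mul (n : ℕ) : frac (MvPowerSeries.C kappa) *
    frac (MvPowerSeries.C (2 * n : ℂ)) = (n : ParamField) := by
  rw [← map_mul, ← map_mul, kappa, ← mul_assoc]
  norm_num

theorem charZero_paramField : CharZero ParamField :=
  charZero_of_injective_ringHom (f := frac.comp (MvPowerSeries.C (σ := Param) (R := ℂ)))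
    ((IsFractionRing.injective ParamSeries ParamField).comp MvPowerSeries.C_injective)

/-- Both sides vanish at zero times and have the same constant derivatives. For each time t_j of
this kind only the complementary residue contributes, and its power of the parameter combines with
the weight to give j times the j-th power. -/
theorem sum_logdG (hℓ : 4 ≤ ℓ) (i : ℕ) (b : Bool) :
    cF (frac (MvPowerSeries.C kappa)) * ∑ r ∈ Finset.range (nres ℓ b),
      cF (frac (MvPowerSeries.X (i, b) ^ (pexp b r).val ℓ)) *
        seriesAt (i, b) (subst ℓ (logdG ℓ (pexp b r))) =
    coeffSum fun a => MvPowerSeries.monomial (Finsupp.single (pexp b a) 1)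
      (((pexp b a).val ℓ : ParamField) * par (i, b) ^ (pexp b a).val ℓ) := by
  have := charZero_paramField
  refine MvPowerSeries.pderiv.ext (fun j => ?_) ?_
  · obtain ⟨b', a, rfl⟩ := exists_pexp j
    have hd := isDeriv_pderiv (R := ParamField) (pexp b' a)
    have hc : ∀ (x : ParamField) (f : TSeries ParamField),
        MvPowerSeries.pderiv ParamField (pexp b' a) (cF x * f) =
          cF x * MvPowerSeries.pderiv ParamField (pexp b' a) f := fun x f => by
      rw [hd.mul, cF, MvPowerSeries.pderiv_C, zero_mul, zero_add]
    rw [pderiv_linear, hc, map_sum]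
    simp only [hc, pderiv_subst_logdG hℓ, kind_pexp]
    by_cases hb : b = b'
    · subst hb
      rw [if_pos rfl]
      have hN := nres_pos hℓ b
      have hr := Nat.mod_lt a hN
      -- Reduces the exponent modulo h to one below h, whose complement is the only surviving
      -- residue.
      have hv : (pexp b a).val ℓ = cox ℓ * (a / nres ℓ b) + (pexp b (a % nres ℓ b)).val ℓ := by
        rw [← val_pexp_shift hℓ, Nat.div_add_mod]
      obtain ⟨r', hr', h1, h2⟩ := exists_complement hℓ hr
      have hdvd : ∀ r, cox ℓ ∣ (pexp b a).val ℓ + (pexp b r).val ℓ ↔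
          cox ℓ ∣ (pexp b (a % nres ℓ b)).val ℓ + (pexp b r).val ℓ := fun r => by
        rw [hv, add_assoc]
        exact Nat.dvd_add_right (Nat.dvd_mul_right _ _)
      rw [Finset.sum_eq_single r']
      · rw [if_pos ⟨rfl, (hdvd r').mpr (h1 ▸ dvd_rfl)⟩, ← map_mul, ← map_mul]
        refine congrArg cF ?_
        rw [← frac_C_kappa_mul, pow_add, par_eq, map_pow]
        have hx := pow_ne_zero ((pexp b r').val ℓ) (frac_X_ne_zero (i, b))
        rw [inv_pow _ ((pexp b r').val ℓ)]
        field_simp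
      · intro r hr0 hne
        rw [if_neg, map_zero, mul_zero]
        rintro ⟨_, h⟩
        exact hne (h2 r ((cox_dvd_val_add_iff hℓ hr (Finset.mem_range.mp hr0)).mp
          ((hdvd r).mp h)))
      · intro h
        exact absurd (Finset.mem_range.mpr hr') h
    · rw [if_neg hb, Finset.sum_eq_zero, mul_zero, map_zero]
      intro r _
      rw [if_neg fun h => hb h.1.symm, map_zero, mul_zero]
  · rw [constantCoeff_linear, map_mul, map_sum, Finset.sum_eq_zero, mul_zero]
    intro r _
    have h : MvPowerSeries.constantCoeff (seriesAt (i, b) (subst ℓ (logdG ℓ (pexp b r)))) =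
        laurentAt (i, b) (substPow (cox ℓ) (MvPowerSeries.constantCoeff (logdG ℓ (pexp b r)))) := rfl
    rw [map_mul, h, constantCoeff_logdG, map_zero, map_zero, mul_zero]

theorem incl_nab_logTau (hℓ : 4 ≤ ℓ) (hneg : IsNegative ξ) {logτ : TSeries ℂ}
    (hτ : IsLogTau ℓ ξ logτ) (q : Param) :
    incl (nab ℓ q (MvPowerSeries.map MvPowerSeries.C logτ)) =
      -(cF (frac (MvPowerSeries.C kappa)) * ∑ r ∈ Finset.range (nres ℓ q.2),
        cF (frac (MvPowerSeries.X q ^ (pexp q.2 r).val ℓ)) *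
          seriesAt q (subst ℓ (logd ξ (pexp q.2 r)))) := by
  have h1 := congrArg incl (nab_logTau hℓ hneg hτ q)
  rw [map_mul, map_neg, map_mul, map_sum, incl_C, incl_C] at h1
  refine cF_cancel (frac_X_pow_ne_zero q (cox ℓ)) (h1.trans ?_)
  rw [mul_neg, mul_left_comm]
  conv_rhs => rw [Finset.mul_sum]
  refine congrArg (fun x => -(_ * x)) (Finset.sum_congr rfl fun r hr => ?_)
  rw [map_mul, incl_C, ← seriesAt_subst_laur hℓ, laur_redLogd hℓ hneg (Finset.mem_range.mp hr),
    map_mul, map_mul, seriesAt_subst_zinv hℓ]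
  ring

/-- In the trace formula for Ψ the Θ part is the derivative of log τ and the g part is the linear
series to be subtracted; the factor h of `trace_euler_Psi` cancels against κ/h. -/
theorem incl_nab_logTau_eq_trace (hℓ : 4 ≤ ℓ) (he : Even ℓ) (hneg : IsNegative ξ)
    {logτ : TSeries ℂ} (hτ : IsLogTau ℓ ξ logτ) (i : ℕ) (b : Bool) :
    incl (nab ℓ (i, b) (MvPowerSeries.map MvPowerSeries.C logτ)) =
      (kappa / (cox ℓ : ℂ)) • seriesAt (i, b) (euler (Psi ℓ ξ) * (Psi ℓ ξ)⁻¹ *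
        constLoop (if b then Dprime ℓ else Dtilde ℓ)).trace -
      coeffSum fun a => MvPowerSeries.monomial (Finsupp.single (pexp b a) 1)
        (((pexp b a).val ℓ : ParamField) * par (i, b) ^ (pexp b a).val ℓ) := by
  have hc : frac (MvPowerSeries.C (kappa / (cox ℓ : ℂ))) * (cox ℓ : ParamField) =
      frac (MvPowerSeries.C kappa) := by
    rw [← map_natCast frac, ← map_natCast (MvPowerSeries.C (σ := Param) (R := ℂ)), ← map_mul,
      ← map_mul, div_mul_cancel₀ _ (by exact_mod_cast (cox_pos hℓ).ne')]
  rw [smul_eq_cF_mul, trace_euler_Psi hℓ he hneg, ← sum_logdG hℓ, incl_nab_logTau hℓ hneg hτ,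
    map_mul, map_natCast, ← mul_assoc, ← map_natCast cF, ← map_mul, hc, ← mul_sub, ← mul_neg,
    map_sum, ← Finset.sum_sub_distrib, ← Finset.sum_neg_distrib]
  refine congrArg (_ * ·) (Finset.sum_congr rfl fun r _ => ?_)
  rw [map_mul, seriesAt_C, laurentAt_zmon_neg, map_one, one_mul, map_sub, map_sub]
  ring

theorem mPointSeries_one (hℓ : 4 ≤ ℓ) (he : Even ℓ) (hneg : IsNegative ξ)
    {logτ : TSeries ℂ} (hτ : IsLogTau ℓ ξ logτ) :
    mPointSeries ℓ 1 logτ =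
      (kappa / (cox ℓ : ℂ)) •
        (seriesAt (0, false) (Matrix.trace (euler (Psi ℓ ξ) * (Psi ℓ ξ)⁻¹ * constLoop (Dtilde ℓ))) +
          seriesAt (0, true) (Matrix.trace (euler (Psi ℓ ξ) * (Psi ℓ ξ)⁻¹ * constLoop (Dprime ℓ))))
      - (coeffSum fun a : ℕ => MvPowerSeries.monomial (Finsupp.single (PosExp.odd a) 1)
          (((2 * a + 1 : ℕ) : ParamField) * par (0, false) ^ (2 * a + 1)))
      - (coeffSum fun s : ℕ => MvPowerSeries.monomial (Finsupp.single (PosExp.prime s) 1)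
          (((cox ℓ * s + (ℓ - 1) : ℕ) : ParamField) *
            par (0, true) ^ (cox ℓ * s + (ℓ - 1)))) := by
  have h1 : mPointSeries ℓ 1 logτ =
      incl (nab ℓ (0, false) (MvPowerSeries.map MvPowerSeries.C logτ) +
        nab ℓ (0, true) (MvPowerSeries.map MvPowerSeries.C logτ)) := rfl
  rw [h1, map_add, incl_nab_logTau_eq_trace hℓ he hneg hτ, incl_nab_logTau_eq_trace hℓ he hneg hτ,
    smul_add]
  exact (sub_add_sub_comm _ _ _ _).trans (sub_sub _ _ _).symm

end DrinfeldSokolovD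

end

theorem mainTheorem8 (ℓ : ℕ) (hℓ : 4 ≤ ℓ) (heven : Even ℓ)
    (ξ : DrinfeldSokolovD.Mat ℓ (DrinfeldSokolovD.TSeries (PowerSeries ℂ)))
    (hneg : DrinfeldSokolovD.IsNegative ξ)
    (hsol : DrinfeldSokolovD.IsSolution ℓ ξ)
    (logτ : DrinfeldSokolovD.TSeries ℂ)
    (hτ : DrinfeldSokolovD.IsLogTau ℓ ξ logτ) :
    -- the explicit form of `D̃`
    (DrinfeldSokolovD.Dtilde ℓ = Matrix.diagonal fun i =>
        if i.val = 0 then DrinfeldSokolovD.zmon 0 (((Real.sqrt 2 : ℝ) : ℂ) * (ℓ - 1))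
        else if i.val = ℓ - 1 then
          DrinfeldSokolovD.zmon 0 (-(((Real.sqrt 2 : ℝ) : ℂ) * (ℓ - 1)))
        else 0) ∧
    -- the case `m = 1`
    (DrinfeldSokolovD.mPointSeries ℓ 1 logτ =
      (DrinfeldSokolovD.kappa / (DrinfeldSokolovD.cox ℓ : ℂ)) •
        (DrinfeldSokolovD.seriesAt (0, false)
            (Matrix.trace (DrinfeldSokolovD.euler (DrinfeldSokolovD.Psi ℓ ξ) *
              (DrinfeldSokolovD.Psi ℓ ξ)⁻¹ *
              DrinfeldSokolovD.constLoop (DrinfeldSokolovD.Dtilde ℓ))) +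
          DrinfeldSokolovD.seriesAt (0, true)
            (Matrix.trace (DrinfeldSokolovD.euler (DrinfeldSokolovD.Psi ℓ ξ) *
              (DrinfeldSokolovD.Psi ℓ ξ)⁻¹ *
              DrinfeldSokolovD.constLoop (DrinfeldSokolovD.Dprime ℓ))))
      - (DrinfeldSokolovD.coeffSum fun a : ℕ =>
          MvPowerSeries.monomial (Finsupp.single (DrinfeldSokolovD.PosExp.odd a) 1)
            (((2 * a + 1 : ℕ) : DrinfeldSokolovD.ParamField) *
              DrinfeldSokolovD.par (0, false) ^ (2 * a + 1)))
      - (DrinfeldSokolovD.coeffSum fun s : ℕ =>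
          MvPowerSeries.monomial (Finsupp.single (DrinfeldSokolovD.PosExp.prime s) 1)
            (((DrinfeldSokolovD.cox ℓ * s + (ℓ - 1) : ℕ) : DrinfeldSokolovD.ParamField) *
              DrinfeldSokolovD.par (0, true) ^ (DrinfeldSokolovD.cox ℓ * s + (ℓ - 1))))) ∧
    -- the case `m ≥ 2`
    (∀ m : ℕ, 2 ≤ m →
      DrinfeldSokolovD.mPointSeries ℓ m logτ =
        (-(m : ℂ)⁻¹) • (∑ ρ : Equiv.Perm (Fin m),
            DrinfeldSokolovD.kappa • Matrix.trace (DrinfeldSokolovD.starK ℓ ξ ρ))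
        - (if m = 2 then MvPowerSeries.C (DrinfeldSokolovD.correction ℓ) else 0)) := by
  exact ⟨DrinfeldSokolovD.Dtilde_eq hℓ,
    DrinfeldSokolovD.mPointSeries_one hℓ heven hneg hτ,
    fun _ hm => DrinfeldSokolovD.mPointSeries_eq hℓ hneg hsol hτ hm⟩
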